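/- **Setting.** Let $M$ be a smooth 7-manifold with a $G_2$ structure: a smooth three-form $\phi$ and its associated Riemannian metric $g$, i.e. at every point there is a $g$-orthonormal coframe $e^1,\dots,e^7$ with $$\phi=e^{127}+e^{347}+e^{567}+e^{135}-e^{245}-e^{146}-e^{236}.$$ Fix $x\in M$ and put $V=T_xM$; $(e_i)$ is any $g$-orthonormal basis of $V$, and all inner products $\langle\cdot,\cdot\rangle$ and norms $\|\cdot\|$ of tensors are the full tensor ones. Let $u\lrcorner\phi=\phi(u,\cdot,\cdot)$, let $\mathfrak g_2^\perp=\{u\lrcorner\phi:u\in V\}\subset\Lambda^2V^*$, and let $\mathfrak g_2\subset\Lambda^2V^*$ be its orthogonal complement, with orthogonal projections $p_7,p_{14}$ of $\Lambda^2V^*$ onto $\mathfrak g_2^\perp$, $\mathfrak g_2$. Write $a\odot b=a\otimes b+b\otimes a$; for subspaces $A,B$ of $\Lambda^2V^*$ let $A\odot B$ be the span of all $\alpha\odot\beta$ with $\alpha\in A,\beta\in B$, and $S^2(A)=A\odot A$. Let $\mathcal K$ be the space of algebraic curvature tensors on $V$: 4-tensors $r$ that are skew in the first two and in the last two variables and satisfy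 $b(r)=0$, where $b(r)(x,y,z,w)=r(x,y,z,w)+r(y,z,x,w)+r(z,x,y,w)$. For $r\in\mathcal K$ set $$\mathrm{Ric}^g(u,v)=\sum_i r(u,e_i,e_i,v),\qquad s_g=\operatorname{tr}_g\mathrm{Ric}^g,\qquad \mathrm{Ric}^\phi(u,v)=\sum_{i,j,k,l}\phi(u,e_i,e_j)\,\phi(v,e_k,e_l)\,r(e_i,e_j,e_k,e_l),$$ $$\mathrm{Ric}^{\mathcal W}=\tfrac1{20}\bigl(4\,\mathrm{Ric}^g_0-5\,\mathrm{Ric}^\phi_0\bigr),$$ where a subscript $0$ denotes the traceless part. For a symmetric 2-tensor $h$ let $$r_g(h)(x,y,z,w)=h(y,z)g(x,w)-h(x,z)g(y,w)+h(x,w)g(y,z)-h(y,w)g(x,z),$$ $$r_\phi(h)=q-\tfrac13 b(q),\qquad q=\sum_{a,b}h(e_a,e_b)\,(e_a\lrcorner\phi)\otimes(e_b\lrcorner\phi).$$ Let $\mathcal W\subset\mathcal K$ be the space of algebraic Weyl tensors ($\mathrm{Ric}^g=0$), $\mathcal W_{77}=\mathcal K\cap S^2(\mathfrak g_2)$, $\mathcal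 W_{64}=\mathcal K\cap(\mathfrak g_2\odot\mathfrak g_2^\perp)$, $\mathcal W_{27}$ the orthogonal complement of $\mathcal W_{77}+\mathcal W_{64}$ in $\mathcal W$, $\mathcal R_0=\{r_g(h): h \text{ symmetric and traceless}\}$ and $\mathcal S=\mathbb R\,r_g(g)$. On $\Lambda^2V^*\otimes\Lambda^2V^*$ let $P^{\mathfrak g_2}=p_{14}\otimes p_{14}$ and $P^\odot=p_{14}\otimes p_7+p_7\otimes p_{14}$. Let $R^g$ be the Riemannian curvature tensor of $g$, $R^g(X,Y,Z,T)=g(R(X,Y)Z,T)$ with $R(X,Y)=[\nabla_X,\nabla_Y]-\nabla_{[X,Y]}$, where $\nabla$ is the Levi-Civita connection. **Theorem 4.10.** 1. At every point there are splittings into pairwise orthogonal subspaces $$\mathcal K=\mathcal W_{77}+\mathcal W_{64}+\mathcal W_{27}+\mathcal R_0+\mathcal S,\qquad \mathcal W=\mathcal W_{77}+\mathcal W_{64}+\mathcal W_{27}.$$ 2. $R^g\in\mathcal K$ at every point. For every $r\in\mathcal K$, in particular for $r=R^g$, let $W$ denote the orthogonal projection of $r$ to $\mathcal W$, and $W_{77},W_{64},W_{27},R_0,S$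 those to $\mathcal W_{77},\mathcal W_{64},\mathcal W_{27},\mathcal R_0,\mathcal S$. Then $$S=\tfrac1{84}s_g\,r_g(g),\qquad R_0=\tfrac15\,r_g(\mathrm{Ric}^g_0),\qquad W_{27}=\tfrac3{112}(r_g-5r_\phi)(\mathrm{Ric}^{\mathcal W}),$$ $$W_{64}=P^\odot(W-W_{27}),\qquad W_{77}=P^{\mathfrak g_2}(W-W_{27}).$$ In particular $W_{27}=0$ if and only if $\mathrm{Ric}^{\mathcal W}=0$, and $$\|r\|^2=\|W_{77}\|^2+\|W_{64}\|^2+\tfrac{15}{28}\|\mathrm{Ric}^{\mathcal W}\|^2+\tfrac45\|\mathrm{Ric}^g_0\|^2+\tfrac1{21}s_g^2 .$$ 3. The three components of the Weyl curvature are conformally invariant: if $f$ is a smooth function on $M$ and $\tilde\phi=e^{3f}\phi$, with associated metric $\tilde g=e^{2f}g$, then the components $\tilde W_d$ ($d=77,64,27$) of $R^{\tilde g}$ with respect to $(\tilde\phi,\tilde g)$ satisfy $\tilde W_d=e^{2f}W_d$ as $(0,4)$-tensors; equivalently, the components agree as $(1,3)$-tensors. -/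

import Mathlib

open scoped Manifold ContDiff
open Bundle

/-! ## Linear algebra of a Euclidean vector space with a three-form

Covariant tensors of degree 2, 3, 4 on a real vector space `V` are functions of 2, 3, 4 vector
variables that are linear in each variable; the subspaces introduced below impose the linearity.
-/

namespace G2

/-- The components of `e¹²⁷ + e³⁴⁷ + e⁵⁶⁷ + e¹³⁵ - e²⁴⁵ - e¹⁴⁶ - e²³⁶`, the standard `G₂`
three-form on `ℝ⁷` (indices are shifted by one). -/
noncomputable def stdForm (i j k : Fin 7) : ℝ :=
  let e (a b c : Fin 7) : ℝ :=
    Matrix.det (Matrix.of fun p q : Fin 3 => if ![a, b, c] p = ![i, j, k] q then (1 : ℝ) else 0)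
  e 0 1 6 + e 2 3 6 + e 4 5 6 + e 0 2 4 - e 1 3 4 - e 0 3 5 - e 1 2 5

section Algebra

variable {V : Type*} [AddCommGroup V] [Module ℝ V]

/-- `e` is a `g`-orthonormal basis of `V`. -/
def IsOrthonormalFrame (g : V → V → ℝ) (e : Fin 7 → V) : Prop :=
  (∀ i j, g (e i) (e j) = if i = j then 1 else 0) ∧ Submodule.span ℝ (Set.range e) = ⊤

/-- `φ` is a `G₂` three-form with associated metric `g`: there is a `g`-orthonormal basis in which
`φ` is the standard three-form, i.e. a `G₂`-adapted basis. -/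
def IsG2Form (g : V → V → ℝ) (φ : V → V → V → ℝ) : Prop :=
  ∃ e : Fin 7 → V, IsOrthonormalFrame g e ∧ ∀ i j k, φ (e i) (e j) (e k) = stdForm i j k

/-- Some `g`-orthonormal basis. It is used only for metric contractions, which do not depend on
the choice. -/
noncomputable def frame (g : V → V → ℝ) : Fin 7 → V :=
  Classical.epsilon (IsOrthonormalFrame g)

/-- The trace `∑ h(eᵢ, eᵢ)`. -/
noncomputable def trace (g : V → V → ℝ) (h : V → V → ℝ) : ℝ :=
  ∑ i, h (frame g i) (frame g i)

/-- The inner product of 2-tensors induced by `g` (tensor norm). -/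
noncomputable def inner₂ (g : V → V → ℝ) (a b : V → V → ℝ) : ℝ :=
  ∑ i, ∑ j, a (frame g i) (frame g j) * b (frame g i) (frame g j)

/-- The inner product of 4-tensors induced by `g` (tensor norm). -/
noncomputable def inner₄ (g : V → V → ℝ) (a b : V → V → V → V → ℝ) : ℝ :=
  ∑ i, ∑ j, ∑ k, ∑ l, a (frame g i) (frame g j) (frame g k) (frame g l) *
    b (frame g i) (frame g j) (frame g k) (frame g l)

/-- The traceless part `h - (tr h / 7) g` of a symmetric 2-tensor. -/
noncomputable def traceless (g : V → V → ℝ) (h : V → V → ℝ) : V → V → ℝ :=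
  h - (trace g h / 7) • g

variable (V) in
/-- The two-forms `Λ²V*`. -/
def twoForms : Submodule ℝ (V → V → ℝ) where
  carrier := {a | (∀ v, IsLinearMap ℝ fun u => a u v) ∧ ∀ u v, a u v = -a v u}
  zero_mem' := ⟨fun _ => ⟨by simp, by simp⟩, by simp⟩
  add_mem' := by
    rintro a b ⟨ha, ha'⟩ ⟨hb, hb'⟩
    refine ⟨fun v => ⟨fun x y => ?_, fun c x => ?_⟩, fun u v => ?_⟩
    · simp only [Pi.add_apply, (ha v).map_add, (hb v).map_add]; ring
    · simp only [Pi.add_apply, (ha v).map_smul, (hb v).map_smul, smul_add]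
    · simp only [Pi.add_apply, ha' u v, hb' u v]; ring
  smul_mem' := by
    rintro t a ⟨ha, ha'⟩
    refine ⟨fun v => ⟨fun x y => ?_, fun c x => ?_⟩, fun u v => ?_⟩
    · simp only [Pi.smul_apply, (ha v).map_add, smul_add]
    · simp only [Pi.smul_apply, (ha v).map_smul, smul_comm t c]
    · simp only [Pi.smul_apply, ha' u v, smul_neg]

/-- `h` is a traceless symmetric 2-tensor, `h ∈ S₀²V*`. -/
def IsTracelessSymm (g : V → V → ℝ) (h : V → V → ℝ) : Prop :=
  (∀ v, IsLinearMap ℝ fun u => h u v) ∧ (∀ u v, h u v = h v u) ∧ trace g h = 0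

variable (V) in
/-- The space `𝒦` of algebraic curvature tensors: 4-tensors that are skew in the first two and in
the last two variables and satisfy the first Bianchi identity. -/
def curvatureTensors : Submodule ℝ (V → V → V → V → ℝ) where
  carrier := {r | (∀ y z w, IsLinearMap ℝ fun x => r x y z w) ∧
    (∀ x y w, IsLinearMap ℝ fun z => r x y z w) ∧
    (∀ x y z w, r x y z w = -r y x z w) ∧ (∀ x y z w, r x y z w = -r x y w z) ∧
    ∀ x y z w, r x y z w + r y z x w + r z x y w = 0}
  zero_mem' := ⟨fun _ _ _ => ⟨by simp, by simp⟩, fun _ _ _ => ⟨by simp, by simp⟩, by simp,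
    by simp, by simp⟩
  add_mem' := by
    rintro a b ⟨ha, ha2, ha3, ha4, ha5⟩ ⟨hb, hb2, hb3, hb4, hb5⟩
    refine ⟨fun y z w => ⟨fun x x' => ?_, fun c x => ?_⟩,
      fun x y w => ⟨fun z z' => ?_, fun c z => ?_⟩, fun x y z w => ?_, fun x y z w => ?_,
      fun x y z w => ?_⟩
    · simp only [Pi.add_apply, (ha y z w).map_add, (hb y z w).map_add]; ring
    · simp only [Pi.add_apply, (ha y z w).map_smul, (hb y z w).map_smul, smul_add]
    · simp only [Pi.add_apply, (ha2 x y w).map_add, (hb2 x y w).map_add]; ring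
    · simp only [Pi.add_apply, (ha2 x y w).map_smul, (hb2 x y w).map_smul, smul_add]
    · simp only [Pi.add_apply, ha3 x y z w, hb3 x y z w]; ring
    · simp only [Pi.add_apply, ha4 x y z w, hb4 x y z w]; ring
    · simp only [Pi.add_apply]; linear_combination ha5 x y z w + hb5 x y z w
  smul_mem' := by
    rintro t a ⟨ha, ha2, ha3, ha4, ha5⟩
    refine ⟨fun y z w => ⟨fun x x' => ?_, fun c x => ?_⟩,
      fun x y w => ⟨fun z z' => ?_, fun c z => ?_⟩, fun x y z w => ?_, fun x y z w => ?_,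
      fun x y z w => ?_⟩
    · simp only [Pi.smul_apply, (ha y z w).map_add, smul_add]
    · simp only [Pi.smul_apply, (ha y z w).map_smul, smul_comm t c]
    · simp only [Pi.smul_apply, (ha2 x y w).map_add, smul_add]
    · simp only [Pi.smul_apply, (ha2 x y w).map_smul, smul_comm t c]
    · simp only [Pi.smul_apply, ha3 x y z w, smul_neg]
    · simp only [Pi.smul_apply, ha4 x y z w, smul_neg]
    · simp only [Pi.smul_apply, smul_eq_mul]; linear_combination t * ha5 x y z w

/-- The Ricci contraction `c^g(r)(u, v) = ∑ r(u, eᵢ, eᵢ, v)`. -/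
noncomputable def ric (g : V → V → ℝ) (r : V → V → V → V → ℝ) : V → V → ℝ :=
  fun u v => ∑ i, r u (frame g i) (frame g i) v

/-- The scalar curvature, the trace of the Ricci contraction. -/
noncomputable def scal (g : V → V → ℝ) (r : V → V → V → V → ℝ) : ℝ := trace g (ric g r)

/-- The `φ`-Ricci contraction `c^φ(r)(u, v) = 4 r(u ⌟ φ, v ⌟ φ)`. Here `u ⌟ φ` is the bivector
`½ ∑ φ(u, eᵢ, eⱼ) eᵢ ∧ eⱼ` and `r` is regarded as a bilinear form on bivectors through
`r(x ∧ y, z ∧ w) = r(x, y, z, w)`. -/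
noncomputable def ricPhi (g : V → V → ℝ) (φ : V → V → V → ℝ) (r : V → V → V → V → ℝ) :
    V → V → ℝ :=
  fun u v => 4 * ∑ i, ∑ j, ∑ k, ∑ l, (1 / 2 * φ u (frame g i) (frame g j)) *
    (1 / 2 * φ v (frame g k) (frame g l)) * r (frame g i) (frame g j) (frame g k) (frame g l)

/-- The W-Ricci tensor `(4 Ric₀ - 5 Ric₀^φ) / 20`. -/
noncomputable def ricW (g : V → V → ℝ) (φ : V → V → V → ℝ) (r : V → V → V → V → ℝ) :
    V → V → ℝ :=
  (1 / 20 : ℝ) • ((4 : ℝ) • traceless g (ric g r) - (5 : ℝ) • traceless g (ricPhi g φ r))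

/-- The Kulkarni–Nomizu map `r_g(h) = h ⊙ g`. -/
def rg (g : V → V → ℝ) (h : V → V → ℝ) : V → V → V → V → ℝ :=
  fun x y z w => h y z * g x w - h x z * g y w + h x w * g y z - h y w * g x z

/-- The Bianchi map, summing cyclically over the first three variables. -/
def bianchi (r : V → V → V → V → ℝ) : V → V → V → V → ℝ :=
  fun x y z w => r x y z w + r y z x w + r z x y w

/-- The linear map `r_φ` on symmetric 2-tensors with
`r_φ(a₁ ⊙ a₂) = q - b(q)/3`, `q = (a₁ ⌟ φ) ⊙ (a₂ ⌟ φ)`, where `a ⊙ b = a ⊗ b + b ⊗ a` and `b` is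
the Bianchi map. -/
noncomputable def rphi (g : V → V → ℝ) (φ : V → V → V → ℝ) (h : V → V → ℝ) :
    V → V → V → V → ℝ :=
  let q : V → V → V → V → ℝ := fun x y z w =>
    ∑ a, ∑ b, h (frame g a) (frame g b) * (φ (frame g a) x y * φ (frame g b) z w)
  q - (1 / 3 : ℝ) • bianchi q

/-- The 2-forms `α` orthogonal to all `u ⌟ φ`: the Lie algebra `𝔤₂ ⊂ 𝔰𝔬(7) = Λ²V*`. Its orthogonal
complement `𝔤₂^⊥` is the set `Set.range φ` of all `u ⌟ φ = φ u`. -/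
def lieG2 (g : V → V → ℝ) (φ : V → V → V → ℝ) : Set (V → V → ℝ) :=
  {α | α ∈ twoForms V ∧ ∀ u, inner₂ g (φ u) α = 0}

/-- The span of all `α ⊗ β + β ⊗ α` with `α ∈ A`, `β ∈ B`. It is `S²(A)` for `B = A`, and
`A ⊙ B` in general. -/
def symProd (A B : Set (V → V → ℝ)) : Submodule ℝ (V → V → V → V → ℝ) :=
  Submodule.span ℝ {t | ∃ α ∈ A, ∃ β ∈ B, t = fun x y z w => α x y * β z w + β x y * α z w}

/-- The algebraic Weyl tensors `𝒲`: the algebraic curvature tensors with vanishing Ricci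
contraction. -/
def weylTensors (g : V → V → ℝ) : Submodule ℝ (V → V → V → V → ℝ) where
  carrier := {r | r ∈ curvatureTensors V ∧ ric g r = 0}
  zero_mem' := ⟨zero_mem _, by ext; simp [ric]⟩
  add_mem' := by
    rintro a b ⟨ha, ha'⟩ ⟨hb, hb'⟩
    refine ⟨add_mem ha hb, ?_⟩
    have : ric g (a + b) = ric g a + ric g b := by
      ext; simp [ric, Finset.sum_add_distrib]
    rw [this, ha', hb', add_zero]
  smul_mem' := by
    rintro t a ⟨ha, ha'⟩
    refine ⟨Submodule.smul_mem _ t ha, ?_⟩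
    have : ric g (t • a) = t • ric g a := by
      ext; simp [ric, Finset.mul_sum]
    rw [this, ha', smul_zero]

/-- `𝒲₇₇ = 𝒦 ∩ S²(𝔤₂)`. -/
def W77 (g : V → V → ℝ) (φ : V → V → V → ℝ) : Submodule ℝ (V → V → V → V → ℝ) :=
  curvatureTensors V ⊓ symProd (lieG2 g φ) (lieG2 g φ)

/-- `𝒲₆₄ = 𝒦 ∩ (𝔤₂ ⊙ 𝔤₂^⊥)`. -/
def W64 (g : V → V → ℝ) (φ : V → V → V → ℝ) : Submodule ℝ (V → V → V → V → ℝ) :=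
  curvatureTensors V ⊓ symProd (lieG2 g φ) (Set.range φ)

/-- `𝒲₂₇`, the orthogonal complement of `𝒲₇₇ + 𝒲₆₄` in `𝒲`. -/
def W27 (g : V → V → ℝ) (φ : V → V → V → ℝ) : Submodule ℝ (V → V → V → V → ℝ) where
  carrier := {r | r ∈ weylTensors g ∧ ∀ t ∈ W77 g φ ⊔ W64 g φ, inner₄ g r t = 0}
  zero_mem' := ⟨zero_mem _, fun t _ => by simp [inner₄]⟩
  add_mem' := by
    rintro a b ⟨ha, ha'⟩ ⟨hb, hb'⟩
    refine ⟨add_mem ha hb, fun t ht => ?_⟩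
    have : inner₄ g (a + b) t = inner₄ g a t + inner₄ g b t := by
      simp [inner₄, add_mul, Finset.sum_add_distrib]
    rw [this, ha' t ht, hb' t ht, add_zero]
  smul_mem' := by
    rintro c a ⟨ha, ha'⟩
    refine ⟨Submodule.smul_mem _ c ha, fun t ht => ?_⟩
    have : inner₄ g (c • a) t = c * inner₄ g a t := by
      simp [inner₄, Finset.mul_sum, mul_assoc]
    rw [this, ha' t ht, mul_zero]

/-- `ℛ₀ = {r_g(h) : h ∈ S₀²V*}` (the set is already a subspace). -/
def R0 (g : V → V → ℝ) : Submodule ℝ (V → V → V → V → ℝ) :=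
  Submodule.span ℝ {t | ∃ h, IsTracelessSymm g h ∧ t = rg g h}

/-- `𝒮 = ℝ r_g(g)`. -/
def S (g : V → V → ℝ) : Submodule ℝ (V → V → V → V → ℝ) := Submodule.span ℝ {rg g g}

/-- The subspaces `A` and `B` of 4-tensors are orthogonal. -/
def Perp (g : V → V → ℝ) (A B : Submodule ℝ (V → V → V → V → ℝ)) : Prop :=
  ∀ a ∈ A, ∀ b ∈ B, inner₄ g a b = 0

/-- `p` is the orthogonal projection of `r` to the subspace `U`. -/
def IsOrthProj (g : V → V → ℝ) (U : Submodule ℝ (V → V → V → V → ℝ))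
    (r p : V → V → V → V → ℝ) : Prop :=
  p ∈ U ∧ ∀ t ∈ U, inner₄ g (r - p) t = 0

/-- The orthogonal projection of `r` to the subspace `U`. -/
noncomputable def orthProj (g : V → V → ℝ) (U : Submodule ℝ (V → V → V → V → ℝ))
    (r : V → V → V → V → ℝ) : V → V → V → V → ℝ :=
  Classical.epsilon (IsOrthProj g U r)

/-- The orthogonal projection `p₇²` of `Λ²V*` to `𝔤₂^⊥ = {u ⌟ φ}` (note that the `e_a ⌟ φ` are
pairwise orthogonal of square tensor norm 6). -/
noncomputable def p7 (g : V → V → ℝ) (φ : V → V → V → ℝ) (α : V → V → ℝ) : V → V → ℝ :=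
  (1 / 6 : ℝ) • ∑ a, inner₂ g (φ (frame g a)) α • φ (frame g a)

/-- The orthogonal projection `p₁₄²` of `Λ²V*` to `𝔤₂`. -/
noncomputable def p14 (g : V → V → ℝ) (φ : V → V → V → ℝ) (α : V → V → ℝ) : V → V → ℝ :=
  α - p7 g φ α

/-- The map `p ⊗ q` on `Λ²V* ⊗ Λ²V*`. -/
def onPairs (p q : (V → V → ℝ) → V → V → ℝ) (r : V → V → V → V → ℝ) : V → V → V → V → ℝ :=
  fun x y z w => p (fun x' y' => q (fun z' w' => r x' y' z' w') z w) x y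

/-- The projection `P^{𝔤₂} : S²(𝔰𝔬(7)) → S²(𝔤₂)`. -/
noncomputable def projG2 (g : V → V → ℝ) (φ : V → V → V → ℝ) (r : V → V → V → V → ℝ) :
    V → V → V → V → ℝ :=
  onPairs (p14 g φ) (p14 g φ) r

/-- The projection `P^⊙ : S²(𝔰𝔬(7)) → 𝔤₂ ⊙ 𝔤₂^⊥`. -/
noncomputable def projMixed (g : V → V → ℝ) (φ : V → V → V → ℝ) (r : V → V → V → V → ℝ) :
    V → V → V → V → ℝ :=
  onPairs (p14 g φ) (p7 g φ) r + onPairs (p7 g φ) (p14 g φ) r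

end Algebra

/-! ## `G₂` manifolds and their Riemannian curvature -/

/-- The model space `ℝ⁷`. -/
abbrev E7 : Type := EuclideanSpace ℝ (Fin 7)

section Manifold

variable {M : Type*} [TopologicalSpace M] [ChartedSpace E7 M] [IsManifold (𝓡 7) ∞ M]

/-- The coordinate vector field `∂ᵢ` of the preferred chart at `x₀` (zero off the domain of this
chart). -/
noncomputable def coordField (x₀ : M) (i : Fin 7) (y : M) : TangentSpace (𝓡 7) y :=
  (trivializationAt E7 (TangentSpace (𝓡 7)) x₀).localFrame
    (EuclideanSpace.basisFun (Fin 7) ℝ).toBasis i y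

variable (M) in
/-- A `G₂` structure on a 7-manifold: a smooth three-form together with its associated smooth
Riemannian metric. -/
structure G2Structure where
  /-- the associated metric -/
  metric : ContMDiffRiemannianMetric (𝓡 7) ∞ E7 (fun x : M => TangentSpace (𝓡 7) x)
  /-- the fundamental three-form -/
  form : ∀ x : M, TangentSpace (𝓡 7) x [⋀^Fin 3]→ₗ[ℝ] ℝ
  smooth_form : ∀ (x₀ : M) (i j k : Fin 7), ContMDiffOn (𝓡 7) 𝓘(ℝ) ∞
    (fun y => form y ![coordField x₀ i y, coordField x₀ j y, coordField x₀ k y])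
    (chartAt E7 x₀).source
  isG2Form : ∀ x, IsG2Form (fun u v => metric.inner x u v) (fun u v w => form x ![u, v, w])

namespace G2Structure

variable (G : G2Structure M)

/-- The metric on `T_xM`. -/
noncomputable def g (x : M) : TangentSpace (𝓡 7) x → TangentSpace (𝓡 7) x → ℝ :=
  fun u v => G.metric.inner x u v

/-- The three-form on `T_xM`. -/
noncomputable def φ (x : M) : TangentSpace (𝓡 7) x → TangentSpace (𝓡 7) x → TangentSpace (𝓡 7) x → ℝ :=
  fun u v w => G.form x ![u, v, w]

/-- The matrix `g(∂ᵢ, ∂ⱼ)` of the metric in the chart at `x₀`, as a function on `ℝ⁷`. -/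
noncomputable def metricMatrix (x₀ : M) (p : E7) : Matrix (Fin 7) (Fin 7) ℝ :=
  Matrix.of fun i j => G.g ((extChartAt (𝓡 7) x₀).symm p)
    (coordField x₀ i _) (coordField x₀ j _)

/-- The partial derivative `∂ᵢ` on `ℝ⁷`. -/
noncomputable def partialDeriv (i : Fin 7) (f : E7 → ℝ) (p : E7) : ℝ :=
  fderiv ℝ f p (EuclideanSpace.single i 1)

/-- The Christoffel symbols `Γᵏᵢⱼ` of the Levi-Civita connection in the chart at `x₀`. -/
noncomputable def christoffel (x₀ : M) (k i j : Fin 7) (p : E7) : ℝ :=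
  1 / 2 * ∑ l, (G.metricMatrix x₀ p)⁻¹ k l *
    (partialDeriv i (fun q => G.metricMatrix x₀ q j l) p +
      partialDeriv j (fun q => G.metricMatrix x₀ q i l) p -
      partialDeriv l (fun q => G.metricMatrix x₀ q i j) p)

/-- The `∂_m`-component of `R(∂ᵢ, ∂ⱼ)∂ₖ = ∇ᵢ∇ⱼ∂ₖ - ∇ⱼ∇ᵢ∂ₖ` in the chart at `x₀`. -/
noncomputable def curvatureCoord (x₀ : M) (i j k m : Fin 7) (p : E7) : ℝ :=
  partialDeriv i (G.christoffel x₀ m j k) p - partialDeriv j (G.christoffel x₀ m i k) p +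
    ∑ n, (G.christoffel x₀ m i n p * G.christoffel x₀ n j k p -
      G.christoffel x₀ m j n p * G.christoffel x₀ n i k p)

/-- The Riemannian curvature tensor `R^g(u, v, w, z) = g(R(u, v)w, z)` on `T_xM`, computed in the
preferred chart at `x`. -/
noncomputable def riem (x : M) : TangentSpace (𝓡 7) x → TangentSpace (𝓡 7) x →
    TangentSpace (𝓡 7) x → TangentSpace (𝓡 7) x → ℝ :=
  let c (i : Fin 7) (u : TangentSpace (𝓡 7) x) : ℝ :=
    (trivializationAt E7 (TangentSpace (𝓡 7)) x).localFrameCoeff (𝓡 7)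
      (EuclideanSpace.basisFun (Fin 7) ℝ).toBasis i x u
  fun u v w z => ∑ i, ∑ j, ∑ k, ∑ m, c i u * c j v * c k w *
    G.curvatureCoord x i j k m (extChartAt (𝓡 7) x x) * G.g x (coordField x m x) z

end G2Structure

end Manifold

end G2

/-!
The proof has an algebraic part, at one point, and a differential part, which is only needed for
the curvature tensor itself.

*Algebra.* Write `ψ` for the four-form dual to `φ`. In an adapted orthonormal basis `φ` and `ψ` are
explicit integer arrays, and everything follows from a handful of contraction identities between
them (`IsG2Array`), such as `6 p₇ = 2 + ψ` on two-forms. Let `Ric` and `Ric^φ` be the two Ricci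
contractions. The contraction identities yield `Ric`, `Ric^φ` and the inner products with curvature
tensors of `r_g(h)` and `r_φ(h)` (`ric_rg`, `ricPhi_rg`, `ric_rphi`, `ricPhi_rphi`, `inner₄_rg`,
`inner₄_rphi`): they are multiples of `h`, `tr h · g`, and pairings of `h` with `Ric` and `Ric^φ`.
Hence the maps `r ↦ S`, `R₀`, `W₂₇` of the theorem are the orthogonal projections to the ranges of
`r_g` and of `r_g - 5 r_φ` (on traceless tensors), and these are orthogonal to `𝒲₇₇` and `𝒲₆₄`,
because the elements of the latter have `Ric = Ric^φ = 0`.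

What remains is a Weyl tensor `r` with `Ric^φ = 0`, and it has to lie in `𝒲₇₇ + 𝒲₆₄`. Its component
in `S²(𝔤₂^⊥)` is essentially `Ric^φ`, so it vanishes and `r = D + C` with `D ∈ S²(𝔤₂)` and
`C ∈ 𝔤₂ ⊙ 𝔤₂^⊥`; the point is that `D` and `C` satisfy the Bianchi identity separately. The Bianchi
map sends symmetric elements of `Λ² ⊗ Λ²` to four-forms, and a four-form is zero if its contraction
with `ψ` on three indices vanishes (`four_form_eq_zero`). By `6 p₇ = 2 + ψ`, this contraction of the
Bianchi image of `C` is a combination of the Ricci contractions of `(p₇ ⊗ 1) r` and `C`, which are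
multiples of `Ric(r) = 0` (`mixedPart_mem`).

*Geometry.* Lowering the index in the coordinate formula for `R(∂ᵢ, ∂ⱼ)∂ₖ` and differentiating the
defining identity `Γᵐⱼₖ g_{mz} = Γ_{jk,z}` of the Christoffel symbols of the first kind, one gets
`R_{ijkz}` as a second-order part, linear in `∂∂g`, plus a quadratic part
(`IsMetricNear.sum_matrixCurvature_mul`). In this shape the symmetries of the curvature tensor are
visible. The same formula for `e^{2f} g` shows that the curvature becomes `e^{2f} (R + r_g(h))` for
a symmetric `h` (`riem_conformal`). The spaces `𝒲_d` do not change under the conformal change of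
`(φ, g)`, and they are orthogonal to the range of `r_g`; this is the conformal invariance.
-/

namespace G2

/-! ### Contraction identities for the components of a `G₂` form -/

/-- The components `φ i j k` of a `G₂` three-form in some orthonormal frame, with the components
`ψ i j k l` of the four-form which is (up to sign) Hodge dual to it. Instead of using the Hodge
star, `ψ` is characterised by the contraction identity `contr`; that it is alternating is the
content of the structure. -/
structure IsG2Array (φ : Fin 7 → Fin 7 → Fin 7 → ℝ) (ψ : Fin 7 → Fin 7 → Fin 7 → Fin 7 → ℝ) :
    Prop where
  skew₁ : ∀ i j k, φ i j k = -φ j i k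
  skew₂ : ∀ i j k, φ i j k = -φ i k j
  contr : ∀ i j k l, ∑ a, φ a i j * φ a k l =
    (if i = k then 1 else 0) * (if j = l then 1 else 0) -
      (if i = l then 1 else 0) * (if j = k then 1 else 0) + ψ i j k l
  psi_skew₁ : ∀ i j k l, ψ i j k l = -ψ j i k l
  psi_skew₂ : ∀ i j k l, ψ i j k l = -ψ i k j l
  psi_skew₃ : ∀ i j k l, ψ i j k l = -ψ i j l k

theorem sum_four_comm (F : Fin 7 → Fin 7 → Fin 7 → Fin 7 → Fin 7 → ℝ) :
    ∑ i, ∑ j, ∑ k, ∑ l, ∑ c, F i j k l c = ∑ c, ∑ i, ∑ j, ∑ k, ∑ l, F i j k l c := by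
  have (i j : Fin 7) : ∑ k, ∑ l, ∑ c, F i j k l c = ∑ c, ∑ k, ∑ l, F i j k l c :=
    Finset.sum_comm_cycle
  simp only [this]
  exact Finset.sum_comm_cycle

theorem sum_four_mul_sum_two (A : Fin 7 → Fin 7 → Fin 7 → Fin 7 → ℝ)
    (B : Fin 7 → Fin 7 → Fin 7 → Fin 7 → Fin 7 → Fin 7 → ℝ) :
    ∑ i, ∑ j, ∑ k, ∑ l, A i j k l * ∑ c, ∑ d, B i j k l c d =
      ∑ c, ∑ d, ∑ i, ∑ j, ∑ k, ∑ l, A i j k l * B i j k l c d := by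
  simp only [Finset.mul_sum]
  rw [sum_four_comm]
  exact Finset.sum_congr rfl fun c _ => sum_four_comm _

theorem eq_zero_of_eq_neg {a : ℝ} (h : a = -a) : a = 0 := by linarith

namespace IsG2Array

variable {φ : Fin 7 → Fin 7 → Fin 7 → ℝ} {ψ : Fin 7 → Fin 7 → Fin 7 → Fin 7 → ℝ}

theorem cyc (H : IsG2Array φ ψ) (i j k : Fin 7) : φ i j k = φ j k i := by
  rw [H.skew₁, H.skew₂ j i k, neg_neg]

theorem psi_pair (H : IsG2Array φ ψ) (i j k l : Fin 7) : ψ i j k l = ψ k l i j := by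
  rw [H.psi_skew₂ i j k l, H.psi_skew₁ i k j l, H.psi_skew₃ k i j l, H.psi_skew₂ k i l j]; ring

theorem psi_self₁₂ (H : IsG2Array φ ψ) (i k l : Fin 7) : ψ i i k l = 0 :=
  eq_zero_of_eq_neg (H.psi_skew₁ i i k l)

theorem psi_self₂₃ (H : IsG2Array φ ψ) (i k l : Fin 7) : ψ k i i l = 0 :=
  eq_zero_of_eq_neg (H.psi_skew₂ k i i l)

theorem psi_self₂₄ (H : IsG2Array φ ψ) (i k l : Fin 7) : ψ k i l i = 0 := by
  rw [H.psi_skew₃, H.psi_self₂₃, neg_zero]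

/-- `contr` with the summation index in the middle position. -/
theorem contr₂ (H : IsG2Array φ ψ) (i j k l : Fin 7) : ∑ a, φ i a j * φ k a l =
    (if i = k then 1 else 0) * (if j = l then 1 else 0) -
      (if i = l then 1 else 0) * (if j = k then 1 else 0) + ψ i j k l := by
  rw [← H.contr]
  exact Finset.sum_congr rfl fun a _ => by rw [H.skew₁ i, H.skew₁ k, neg_mul_neg]

/-- `contr` with the summation index last. -/
theorem contr₃ (H : IsG2Array φ ψ) (i j k l : Fin 7) : ∑ a, φ i j a * φ k l a =
    (if i = k then 1 else 0) * (if j = l then 1 else 0) -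
      (if i = l then 1 else 0) * (if j = k then 1 else 0) + ψ i j k l := by
  rw [← H.contr]
  exact Finset.sum_congr rfl fun a _ => by rw [H.cyc a, H.cyc a]

theorem contr_two (H : IsG2Array φ ψ) (a b : Fin 7) :
    ∑ i, ∑ j, φ a i j * φ b i j = 6 * if a = b then 1 else 0 := by
  simp only [H.contr₃, Finset.sum_add_distrib, Finset.sum_sub_distrib]
  simp only [H.psi_self₂₄]
  simp
  by_cases h : a = b
  · simp [h]; norm_num
  · simp [h]

/-- The four-form kills algebraic curvature tensors, by the first Bianchi identity. -/
theorem psi_contr_bianchi (H : IsG2Array φ ψ) (r : Fin 7 → Fin 7 → Fin 7 → ℝ)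
    (hr : ∀ x y z, r x y z + r y z x + r z x y = 0) (x : Fin 7) :
    ∑ y, ∑ i, ∑ j, ψ x y i j * r i j y = 0 := by
  have hc (y i j : Fin 7) : ψ x y i j = ψ x i j y := by
    rw [H.psi_skew₂, H.psi_skew₃, neg_neg]
  have e1 : ∑ y, ∑ i, ∑ j, ψ x y i j * r i j y = ∑ y, ∑ i, ∑ j, ψ x y i j * r j y i := by
    rw [Finset.sum_comm_cycle]
    exact Finset.sum_congr rfl fun j _ => Finset.sum_congr rfl fun y _ =>
      Finset.sum_congr rfl fun i _ => by rw [hc j y i]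
  have e2 : ∑ y, ∑ i, ∑ j, ψ x y i j * r j y i = ∑ y, ∑ i, ∑ j, ψ x y i j * r y i j := by
    rw [Finset.sum_comm_cycle]
    exact Finset.sum_congr rfl fun j _ => Finset.sum_congr rfl fun y _ =>
      Finset.sum_congr rfl fun i _ => by rw [hc j y i]
  have e3 : ∑ y, ∑ i, ∑ j, ψ x y i j * r i j y + ∑ y, ∑ i, ∑ j, ψ x y i j * r j y i +
      ∑ y, ∑ i, ∑ j, ψ x y i j * r y i j = 0 := by
    simp only [← Finset.sum_add_distrib, ← mul_add]
    refine Finset.sum_eq_zero fun y _ => Finset.sum_eq_zero fun i _ =>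
      Finset.sum_eq_zero fun j _ => ?_
    rw [hr, mul_zero]
  linarith

/-- The projection to `𝔤₂^⊥` in terms of the four-form: `6 p₇ = 2 + ψ`. -/
theorem six_p7 (H : IsG2Array φ ψ) (α : Fin 7 → Fin 7 → ℝ) (hα : ∀ i j, α i j = -α j i)
    (x y : Fin 7) : ∑ a, (∑ i, ∑ j, φ a i j * α i j) * φ a x y =
      2 * α x y + ∑ i, ∑ j, ψ x y i j * α i j := by
  have h1 : ∑ a, (∑ i, ∑ j, φ a i j * α i j) * φ a x y =
      ∑ i, ∑ j, (∑ a, φ a x y * φ a i j) * α i j := by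
    simp only [Finset.sum_mul]
    rw [Finset.sum_comm]
    refine Finset.sum_congr rfl fun i _ => ?_
    rw [Finset.sum_comm]
    exact Finset.sum_congr rfl fun j _ => Finset.sum_congr rfl fun a _ => by ring
  rw [h1]
  simp only [H.contr, add_mul, sub_mul, Finset.sum_add_distrib, Finset.sum_sub_distrib]
  simp
  rw [hα y x]; ring

/-- For a curvature tensor `r`, the Ricci contraction of `(p₇ ⊗ 1) r` is a third of that of `r`. -/
theorem ric_p7_left (H : IsG2Array φ ψ) (r : Fin 7 → Fin 7 → Fin 7 → ℝ)
    (hs : ∀ i j y, r i j y = -r j i y)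
    (hr : ∀ x y z, r x y z + r y z x + r z x y = 0) (x : Fin 7) :
    ∑ y, ∑ a, (∑ i, ∑ j, φ a i j * r i j y) * φ a x y = 2 * ∑ y, r x y y := by
  have : ∀ y, ∑ a, (∑ i, ∑ j, φ a i j * r i j y) * φ a x y =
      2 * r x y y + ∑ i, ∑ j, ψ x y i j * r i j y :=
    fun y => H.six_p7 (fun i j => r i j y) (fun i j => hs i j y) x y
  simp only [this, Finset.sum_add_distrib, H.psi_contr_bianchi r hr, Finset.mul_sum, add_zero]

theorem psi_symm_contr (H : IsG2Array φ ψ) (h : Fin 7 → Fin 7 → ℝ) (hh : ∀ a b, h a b = h b a)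
    (x w : Fin 7) : ∑ a, ∑ b, h a b * ψ a x b w = 0 := by
  refine eq_zero_of_eq_neg ?_
  conv_lhs => rw [Finset.sum_comm]
  rw [← Finset.sum_neg_distrib]
  refine Finset.sum_congr rfl fun a _ => ?_
  rw [← Finset.sum_neg_distrib]
  refine Finset.sum_congr rfl fun b _ => ?_
  rw [hh b a, H.psi_pair b x a w, H.psi_skew₂ a w b x, H.psi_skew₃ a b w x, H.psi_skew₂ a b x w]
  ring

/-- The Ricci contraction of `∑ h(e_a, e_b) (e_a ⌟ φ) ⊗ (e_b ⌟ φ)`. -/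
theorem ric_phi_sq (H : IsG2Array φ ψ) (h : Fin 7 → Fin 7 → ℝ) (hh : ∀ a b, h a b = h b a)
    (x w : Fin 7) : ∑ y, ∑ a, ∑ b, h a b * (φ a x y * φ b y w) =
      h x w - (∑ a, h a a) * if x = w then 1 else 0 := by
  have h1 : ∑ y, ∑ a, ∑ b, h a b * (φ a x y * φ b y w) =
      ∑ a, ∑ b, h a b * (-∑ y, φ a x y * φ b w y) := by
    rw [Finset.sum_comm]
    refine Finset.sum_congr rfl fun a _ => ?_
    rw [Finset.sum_comm]
    refine Finset.sum_congr rfl fun b _ => ?_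
    rw [← Finset.sum_neg_distrib, Finset.mul_sum]
    refine Finset.sum_congr rfl fun y _ => ?_
    rw [H.skew₂ b y w]; ring
  rw [h1]
  simp only [H.contr₃, mul_neg, mul_add, mul_sub, Finset.sum_add_distrib, Finset.sum_sub_distrib,
    Finset.sum_neg_distrib, H.psi_symm_contr h hh]
  simp [hh w x]

/-- The `φ`-Ricci contraction of `r_g(h)`. -/
theorem ricPhi_rg (H : IsG2Array φ ψ) (h : Fin 7 → Fin 7 → ℝ) (hh : ∀ a b, h a b = h b a)
    (a b : Fin 7) : ∑ i, ∑ j, ∑ k, ∑ l, φ a i j * φ b k l *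
      (h j k * (if i = l then 1 else 0) - h i k * (if j = l then 1 else 0) +
        h i l * (if j = k then 1 else 0) - h j l * (if i = k then 1 else 0)) =
      4 * (h a b - (∑ i, h i i) * if a = b then 1 else 0) := by
  have key : ∑ i, ∑ j, ∑ k, h j k * (φ a i j * φ b i k) =
      (∑ i, h i i) * (if a = b then 1 else 0) - h a b := by
    have : ∑ i, ∑ j, ∑ k, h j k * (φ a i j * φ b i k) =
        ∑ j, ∑ k, h j k * ∑ i, φ a i j * φ b i k := by
      rw [Finset.sum_comm]
      refine Finset.sum_congr rfl fun j _ => ?_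
      rw [Finset.sum_comm]
      exact Finset.sum_congr rfl fun k _ => by rw [Finset.mul_sum]
    rw [this]
    have hp : ∑ j, ∑ k, h j k * ψ a j b k = 0 := by
      rw [← H.psi_symm_contr h hh a b]
      refine Finset.sum_congr rfl fun j _ => Finset.sum_congr rfl fun k _ => ?_
      rw [H.psi_skew₁, H.psi_skew₃]; ring
    simp only [H.contr₂, mul_add, mul_sub, Finset.sum_add_distrib, Finset.sum_sub_distrib, hp]
    simp [hh b a]
  have t1 : ∑ i, ∑ j, ∑ k, ∑ l, φ a i j * φ b k l * (h j k * (if i = l then 1 else 0)) =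
      -∑ i, ∑ j, ∑ k, h j k * (φ a i j * φ b i k) := by
    simp only [← Finset.sum_neg_distrib]
    refine Finset.sum_congr rfl fun i _ => Finset.sum_congr rfl fun j _ =>
      Finset.sum_congr rfl fun k _ => ?_
    simp
    rw [H.skew₂ b k i]; ring
  have t2 : ∑ i, ∑ j, ∑ k, ∑ l, φ a i j * φ b k l * (h i k * (if j = l then 1 else 0)) =
      ∑ i, ∑ j, ∑ k, h j k * (φ a i j * φ b i k) := by
    rw [Finset.sum_comm]
    refine Finset.sum_congr rfl fun i _ => Finset.sum_congr rfl fun j _ =>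
      Finset.sum_congr rfl fun k _ => ?_
    simp
    rw [H.skew₂ b k i, H.skew₂ a j i]; ring
  have t3 : ∑ i, ∑ j, ∑ k, ∑ l, φ a i j * φ b k l * (h i l * (if j = k then 1 else 0)) =
      -∑ i, ∑ j, ∑ k, h j k * (φ a i j * φ b i k) := by
    rw [Finset.sum_comm]
    simp only [← Finset.sum_neg_distrib]
    refine Finset.sum_congr rfl fun i _ => Finset.sum_congr rfl fun j _ => ?_
    rw [Finset.sum_comm]
    refine Finset.sum_congr rfl fun k _ => ?_
    simp
    rw [H.skew₂ a j i]; ring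
  have t4 : ∑ i, ∑ j, ∑ k, ∑ l, φ a i j * φ b k l * (h j l * (if i = k then 1 else 0)) =
      ∑ i, ∑ j, ∑ k, h j k * (φ a i j * φ b i k) := by
    refine Finset.sum_congr rfl fun i _ => Finset.sum_congr rfl fun j _ => ?_
    rw [Finset.sum_comm]
    refine Finset.sum_congr rfl fun k _ => ?_
    simp
    ring
  simp only [mul_add, mul_sub, Finset.sum_add_distrib, Finset.sum_sub_distrib] at t1 t2 t3 t4 key ⊢
  rw [t1, t2, t3, t4, key]; ring

theorem psi_contr_two (H : IsG2Array φ ψ) (a c b d : Fin 7) :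
    ∑ i, ∑ k, ψ i k a c * ψ i k b d =
      4 * ((if a = b then 1 else 0) * (if c = d then 1 else 0) -
        (if a = d then 1 else 0) * (if c = b then 1 else 0)) + 2 * ψ a c b d := by
  have hψ (i k a c : Fin 7) : ψ i k a c = ∑ p, φ p i k * φ p a c -
      ((if i = a then 1 else 0) * (if k = c then 1 else 0) -
      (if i = c then 1 else 0) * (if k = a then 1 else 0)) := by rw [H.contr]; ring
  have h1 : ∑ i, ∑ k, ψ i k a c * ψ i k b d =
      ∑ i, ∑ k, (∑ p, φ p i k * φ p a c) * ψ i k b d - ψ a c b d + ψ c a b d := by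
    simp only [hψ _ _ a c, sub_mul, Finset.sum_sub_distrib]
    simp
    ring
  have h2 : ∑ i, ∑ k, (∑ p, φ p i k * φ p a c) * ψ i k b d =
      ∑ p, φ p a c * ∑ i, ∑ k, φ p i k * ψ i k b d := by
    simp only [Finset.sum_mul, Finset.mul_sum]
    rw [Finset.sum_comm_cycle]
    exact Finset.sum_congr rfl fun i _ => Finset.sum_congr rfl fun j _ =>
      Finset.sum_congr rfl fun k _ => by ring
  have h3 (p : Fin 7) : ∑ i, ∑ k, φ p i k * ψ i k b d = 4 * φ p b d := by
    simp only [hψ _ _ b d, mul_sub, Finset.sum_sub_distrib]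
    have : ∑ i, ∑ k, φ p i k * ∑ q, φ q i k * φ q b d =
        ∑ q, (∑ i, ∑ k, φ p i k * φ q i k) * φ q b d := by
      simp only [Finset.sum_mul, Finset.mul_sum]
      rw [Finset.sum_comm_cycle]
      exact Finset.sum_congr rfl fun i _ => Finset.sum_congr rfl fun j _ =>
        Finset.sum_congr rfl fun k _ => by ring
    rw [this]
    simp only [H.contr_two]
    simp
    rw [H.skew₂ p d b]; ring
  rw [h1, h2]
  simp only [h3]
  have : ∑ p, φ p a c * (4 * φ p b d) = 4 * ∑ p, φ p a c * φ p b d := by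
    rw [Finset.mul_sum]; exact Finset.sum_congr rfl fun _ _ => by ring
  rw [this, H.contr, H.psi_skew₁ c a]; ring

/-- The `φ`-Ricci contraction of `q = ∑ h(e_a, e_b) (e_a ⌟ φ) ⊗ (e_b ⌟ φ)`. -/
theorem ricPhi_phi_sq (H : IsG2Array φ ψ) (h : Fin 7 → Fin 7 → ℝ) (a b : Fin 7) :
    ∑ i, ∑ j, ∑ k, ∑ l, φ a i j * φ b k l * ∑ c, ∑ d, h c d * (φ c i j * φ d k l) =
      36 * h a b := by
  have h1 : ∑ i, ∑ j, ∑ k, ∑ l, φ a i j * φ b k l * ∑ c, ∑ d, h c d * (φ c i j * φ d k l) =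
      ∑ c, ∑ d, h c d * ((∑ i, ∑ j, φ a i j * φ c i j) * ∑ k, ∑ l, φ b k l * φ d k l) := by
    rw [sum_four_mul_sum_two]
    refine Finset.sum_congr rfl fun c _ => Finset.sum_congr rfl fun d _ => ?_
    simp only [Finset.sum_mul]
    simp only [Finset.mul_sum]
    exact Finset.sum_congr rfl fun i _ => Finset.sum_congr rfl fun j _ =>
      Finset.sum_congr rfl fun k _ => Finset.sum_congr rfl fun l _ => by ring
  rw [h1]
  simp only [H.contr_two]
  simp
  ring

/-- The `φ`-Ricci contraction of a cyclic rotation of `∑ h(e_a, e_b) (e_a ⌟ φ) ⊗ (e_b ⌟ φ)`. -/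
theorem ricPhi_phi_sq_cyc (H : IsG2Array φ ψ) (h : Fin 7 → Fin 7 → ℝ)
    (hh : ∀ a b, h a b = h b a) (ht : ∑ i, h i i = 0) (a b : Fin 7) :
    ∑ i, ∑ j, ∑ k, ∑ l, φ a i j * φ b k l * ∑ c, ∑ d, h c d * (φ c j k * φ d i l) =
      -10 * h a b := by
  have h1 : ∑ i, ∑ j, ∑ k, ∑ l, φ a i j * φ b k l * ∑ c, ∑ d, h c d * (φ c j k * φ d i l) =
      ∑ c, ∑ d, h c d * ∑ i, ∑ k, (∑ j, φ a i j * φ c j k) * ∑ l, φ b k l * φ d i l := by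
    rw [sum_four_mul_sum_two]
    refine Finset.sum_congr rfl fun c _ => Finset.sum_congr rfl fun d _ => ?_
    simp only [Finset.sum_mul]
    simp only [Finset.mul_sum]
    refine Finset.sum_congr rfl fun i _ => ?_
    rw [Finset.sum_comm]
    exact Finset.sum_congr rfl fun k _ => Finset.sum_congr rfl fun j _ =>
      Finset.sum_congr rfl fun l _ => by ring
  have h2 (c d : Fin 7) : ∑ i, ∑ k, (∑ j, φ a i j * φ c j k) * ∑ l, φ b k l * φ d i l =
      -5 * ((if a = c then 1 else 0) * (if b = d then 1 else 0)) -
        5 * ((if a = d then 1 else 0) * (if b = c then 1 else 0)) +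
        4 * ((if a = b then 1 else 0) * (if c = d then 1 else 0)) := by
    have e (i k : Fin 7) : ∑ j, φ a i j * φ c j k =
        -((if a = c then 1 else 0) * (if i = k then 1 else 0) -
          (if a = k then 1 else 0) * (if i = c then 1 else 0) - ψ i k a c) := by
      have : ψ a i c k = -ψ i k a c := by
        rw [H.psi_skew₁, H.psi_skew₃, H.psi_skew₂ i a k c]; ring
      rw [sub_eq_add_neg _ (ψ i k a c), ← this, ← H.contr₃, ← Finset.sum_neg_distrib]
      exact Finset.sum_congr rfl fun j _ => by rw [H.skew₂ c j k]; ring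
    have e' (i k : Fin 7) : ∑ l, φ b k l * φ d i l =
        (if b = d then 1 else 0) * (if k = i then 1 else 0) -
          (if b = i then 1 else 0) * (if k = d then 1 else 0) + ψ i k b d := by
      have : ψ i k b d = ψ b k d i := by
        rw [H.psi_skew₁ i, H.psi_skew₂ k, H.psi_skew₁ k, H.psi_skew₃ b k i d]; ring
      rw [this, ← H.contr₃]
    simp only [e, e']
    -- Expand; the only term that is not a contraction with a Kronecker delta is `psi_contr_two`.
    have hp : ∑ i, ∑ k, ψ i k a c * ψ i k b d = _ := H.psi_contr_two a c b d
    simp only [neg_mul, sub_mul, mul_add, mul_sub, Finset.sum_add_distrib,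
      Finset.sum_sub_distrib, Finset.sum_neg_distrib, hp]
    simp [H.psi_self₁₂]
    rw [H.psi_pair b d a c, H.psi_skew₁ c a b d]
    simp only [@eq_comm _ c b]
    split_ifs <;> ring
  rw [h1]
  simp only [h2, mul_add, mul_sub, Finset.sum_add_distrib, Finset.sum_sub_distrib]
  simp [hh b a, ← Finset.sum_mul, ht]
  ring

end IsG2Array
/-! ### The standard `G₂` form -/

/-- The integer components `det (δ_{ai}, …)` of `eᵃ ∧ eᵇ ∧ eᶜ`. -/
def tripleInt (a b c i j k : Fin 7) : ℤ :=
  let d (p q : Fin 7) : ℤ := if p = q then 1 else 0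
  d a i * d b j * d c k - d a i * d b k * d c j - d a j * d b i * d c k +
    d a j * d b k * d c i + d a k * d b i * d c j - d a k * d b j * d c i

/-- The cross product of `ℝ⁷` defined by the standard `G₂` form: `e_i × e_j` is `± e_k` for an
entry `± (k + 1)`. -/
def crossTable (i j : Fin 7) : ℤ :=
  (![![0, 7, 5, -6, -3, 4, -2], ![-7, 0, -6, -5, 4, 3, 1], ![-5, 6, 0, 7, 1, -2, -4],
    ![6, 5, -7, 0, -2, -1, 3], ![3, -4, -1, 2, 0, 7, -6], ![-4, -3, 2, 1, -7, 0, 5],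
    ![2, -1, 4, -3, 6, -5, 0]] : Fin 7 → Fin 7 → ℤ) i j

/-- The integer components of the standard `G₂` form, read off from the cross product. -/
def phiInt (i j k : Fin 7) : ℤ :=
  if crossTable i j = (k : ℕ) + 1 then 1 else if crossTable i j = -((k : ℕ) + 1) then -1 else 0

/-- The integer components of the four-form `ψ` of the standard `G₂` form: the inner product of
`e_i × e_j` and `e_k × e_l`, minus that of `e_i ∧ e_j` and `e_k ∧ e_l`. -/
def psiInt (i j k l : Fin 7) : ℤ :=
  (if crossTable i j = 0 then 0 else if crossTable i j = crossTable k l then 1 else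
    if crossTable i j = -crossTable k l then -1 else 0) -
  ((if i = k then 1 else 0) * (if j = l then 1 else 0) -
    (if i = l then 1 else 0) * (if j = k then 1 else 0))

theorem phiInt_eq : ∀ i j k : Fin 7, phiInt i j k =
    tripleInt 0 1 6 i j k + tripleInt 2 3 6 i j k + tripleInt 4 5 6 i j k +
      tripleInt 0 2 4 i j k - tripleInt 1 3 4 i j k - tripleInt 0 3 5 i j k -
      tripleInt 1 2 5 i j k := by
  decide +kernel

theorem stdForm_eq (i j k : Fin 7) : stdForm i j k = phiInt i j k := by
  have h (a b c : Fin 7) : Matrix.det (Matrix.of fun p q : Fin 3 =>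
      if ![a, b, c] p = ![i, j, k] q then (1 : ℝ) else 0) = tripleInt a b c i j k := by
    rw [Matrix.det_fin_three]
    simp only [tripleInt]
    push_cast
    rfl
  simp only [stdForm, phiInt_eq, h]
  push_cast
  rfl

theorem phiInt_contr : ∀ i j k l : Fin 7, ∑ a, phiInt a i j * phiInt a k l =
    (if i = k then 1 else 0) * (if j = l then 1 else 0) -
      (if i = l then 1 else 0) * (if j = k then 1 else 0) + psiInt i j k l := by
  simp only [Fin.sum_univ_seven]
  decide +kernel

theorem isG2Array_std :
    IsG2Array (fun i j k => (phiInt i j k : ℝ)) (fun i j k l => (psiInt i j k l : ℝ)) where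
  skew₁ := by exact_mod_cast (by decide +kernel : ∀ i j k, phiInt i j k = -phiInt j i k)
  skew₂ := by exact_mod_cast (by decide +kernel : ∀ i j k, phiInt i j k = -phiInt i k j)
  contr := by exact_mod_cast phiInt_contr
  psi_skew₁ := by
    exact_mod_cast (by decide +kernel : ∀ i j k l, psiInt i j k l = -psiInt j i k l)
  psi_skew₂ := by
    exact_mod_cast (by decide +kernel : ∀ i j k l, psiInt i j k l = -psiInt i k j l)
  psi_skew₃ := by
    exact_mod_cast (by decide +kernel : ∀ i j k l, psiInt i j k l = -psiInt i j l k)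

/-- The four triples `(a, b, c)`, `a < b < c`, with `ψ i a b c ≠ 0`. -/
def psiTriples : Fin 7 → Fin 4 → Fin 7 × Fin 7 × Fin 7 :=
  ![
    ![(1, 2, 3), (1, 4, 5), (2, 5, 6), (3, 4, 6)],
    ![(0, 2, 3), (0, 4, 5), (2, 4, 6), (3, 5, 6)],
    ![(0, 1, 3), (0, 5, 6), (1, 4, 6), (3, 4, 5)],
    ![(0, 1, 2), (0, 4, 6), (1, 5, 6), (2, 4, 5)],
    ![(0, 1, 5), (0, 3, 6), (1, 2, 6), (2, 3, 5)],
    ![(0, 1, 4), (0, 2, 6), (1, 3, 6), (2, 3, 4)],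
    ![(0, 2, 5), (0, 3, 4), (1, 2, 4), (1, 3, 5)]]

/-- The values of `ψ i a b c` on the triples of `psiTriples`. -/
def psiSigns : Fin 7 → Fin 4 → ℤ :=
  ![![1, 1, 1, 1], ![-1, -1, 1, -1], ![1, -1, -1, 1], ![-1, -1, 1, -1],
    ![1, 1, 1, 1], ![-1, 1, -1, -1], ![-1, -1, -1, 1]]

theorem psiInt_eq_sum : ∀ i j k l : Fin 7, psiInt i j k l = ∑ t, psiSigns i t *
    tripleInt (psiTriples i t).1 (psiTriples i t).2.1 (psiTriples i t).2.2 j k l := by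
  simp only [Fin.sum_univ_four]
  decide +kernel

theorem sum_tripleInt (a b c : Fin 7) (η : Fin 7 → Fin 7 → Fin 7 → ℝ)
    (h₁ : ∀ i j k, η i j k = -η j i k) (h₂ : ∀ i j k, η i j k = -η i k j) :
    ∑ i, ∑ j, ∑ k, (tripleInt a b c i j k : ℝ) * η i j k = 6 * η a b c := by
  simp only [tripleInt]
  push_cast
  simp only [add_mul, sub_mul, Finset.sum_add_distrib, Finset.sum_sub_distrib]
  simp
  rw [h₂ a c b, h₁ b a c, h₁ c a b, h₂ a c b, h₂ b c a, h₁ b a c, h₁ c b a, h₂ b c a, h₁ b a c]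
  ring

/-- An alternating array vanishes if its entries with increasing indices do. -/
theorem alternating_eq_zero (σ : Fin 7 → Fin 7 → Fin 7 → Fin 7 → ℝ)
    (h₁ : ∀ i j k l, σ i j k l = -σ j i k l) (h₂ : ∀ i j k l, σ i j k l = -σ i k j l)
    (h₃ : ∀ i j k l, σ i j k l = -σ i j l k)
    (h : ∀ i j k l, i < j → j < k → k < l → σ i j k l = 0) (i j k l : Fin 7) :
    σ i j k l = 0 := by
  have z₁ (i k l) : σ i i k l = 0 := eq_zero_of_eq_neg (h₁ i i k l)
  have z₂ (i k l) : σ k i i l = 0 := eq_zero_of_eq_neg (h₂ k i i l)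
  have z₃ (i k l) : σ k l i i = 0 := eq_zero_of_eq_neg (h₃ k l i i)
  have s₁ (i j k l) (hij : i < j) (hjk : j < k) : σ i j k l = 0 := by
    rcases lt_trichotomy k l with hl | rfl | hl
    · exact h i j k l hij hjk hl
    · exact z₃ _ _ _
    rw [h₃, neg_eq_zero]
    rcases lt_trichotomy j l with hl' | rfl | hl'
    · exact h i j l k hij hl' hl
    · exact z₂ _ _ _
    rw [h₂, neg_eq_zero]
    rcases lt_trichotomy i l with hl'' | rfl | hl''
    · exact h i l j k hl'' hl' hjk
    · exact z₁ _ _ _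
    rw [h₁, neg_eq_zero]
    exact h l i j k hl'' hij hjk
  have s₂ (i j k l) (hij : i < j) : σ i j k l = 0 := by
    rcases lt_trichotomy j k with hl | rfl | hl
    · exact s₁ i j k l hij hl
    · exact z₂ _ _ _
    rw [h₂, neg_eq_zero]
    rcases lt_trichotomy i k with hl' | rfl | hl'
    · exact s₁ i k j l hl' hl
    · exact z₁ _ _ _
    rw [h₁, neg_eq_zero]
    exact s₁ k i j l hl' hij
  rcases lt_trichotomy i j with hl | rfl | hl
  · exact s₂ i j k l hl
  · exact z₁ _ _ _
  · rw [h₁, neg_eq_zero]; exact s₂ j i k l hl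

theorem forall_fin_seven (p : Fin 7 → Prop) :
    (∀ i, p i) ↔ p 0 ∧ p 1 ∧ p 2 ∧ p 3 ∧ p 4 ∧ p 5 ∧ p 6 := by
  refine ⟨fun h => ⟨h 0, h 1, h 2, h 3, h 4, h 5, h 6⟩, fun ⟨h0, h1, h2, h3, h4, h5, h6⟩ i => ?_⟩
  match i with
  | 0 => exact h0
  | 1 => exact h1
  | 2 => exact h2
  | 3 => exact h3
  | 4 => exact h4
  | 5 => exact h5
  | 6 => exact h6

/-- The increasing quadruples in `Fin 7`. -/
def quadruples : List (Fin 7 × Fin 7 × Fin 7 × Fin 7) :=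
  [(0, 1, 2, 3), (0, 1, 2, 4), (0, 1, 2, 5), (0, 1, 2, 6), (0, 1, 3, 4), (0, 1, 3, 5),
      (0, 1, 3, 6), (0, 1, 4, 5), (0, 1, 4, 6), (0, 1, 5, 6), (0, 2, 3, 4), (0, 2, 3, 5),
      (0, 2, 3, 6), (0, 2, 4, 5), (0, 2, 4, 6), (0, 2, 5, 6), (0, 3, 4, 5), (0, 3, 4, 6),
      (0, 3, 5, 6), (0, 4, 5, 6), (1, 2, 3, 4), (1, 2, 3, 5), (1, 2, 3, 6), (1, 2, 4, 5),
      (1, 2, 4, 6), (1, 2, 5, 6), (1, 3, 4, 5), (1, 3, 4, 6), (1, 3, 5, 6), (1, 4, 5, 6),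
      (2, 3, 4, 5), (2, 3, 4, 6), (2, 3, 5, 6), (2, 4, 5, 6), (3, 4, 5, 6)]

theorem mem_quadruples : ∀ i j k l : Fin 7, i < j → j < k → k < l →
    (i, j, k, l) ∈ quadruples := by
  decide +kernel

/-- A four-form on `ℝ⁷` is determined by its contraction with `ψ` on three indices. The
contraction corresponds to the decomposition `Λ⁴ = Λ⁴₁ ⊕ Λ⁴₇ ⊕ Λ⁴₂₇`, all of which
embed into `V* ⊗ V*`. Off the diagonal it consists of equations with two terms, in groups of six
equations for four unknowns. -/
theorem four_form_eq_zero_std (σ : Fin 7 → Fin 7 → Fin 7 → Fin 7 → ℝ)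
    (h₁ : ∀ i j k l, σ i j k l = -σ j i k l) (h₂ : ∀ i j k l, σ i j k l = -σ i k j l)
    (h₃ : ∀ i j k l, σ i j k l = -σ i j l k)
    (hT : ∀ i m, ∑ j, ∑ k, ∑ l, (psiInt i j k l : ℝ) * σ j k l m = 0) (i j k l : Fin 7) :
    σ i j k l = 0 := by
  have e : ∀ i m, ∑ t, (psiSigns i t : ℝ) *
      σ (psiTriples i t).1 (psiTriples i t).2.1 (psiTriples i t).2.2 m = 0 := by
    intro i m
    have := hT i m
    simp only [psiInt_eq_sum, Int.cast_sum, Finset.sum_mul] at this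
    have hc (j : Fin 7) (F : Fin 7 → Fin 7 → Fin 4 → ℝ) :
        ∑ k, ∑ l, ∑ t, F k l t = ∑ t, ∑ k, ∑ l, F k l t := Finset.sum_comm_cycle
    simp only [hc 0] at this
    rw [Finset.sum_comm] at this
    have h6 : 6 * ∑ t, (psiSigns i t : ℝ) *
        σ (psiTriples i t).1 (psiTriples i t).2.1 (psiTriples i t).2.2 m = 0 := by
      rw [← this, Finset.mul_sum]
      refine Finset.sum_congr rfl fun t _ => ?_
      rw [mul_left_comm, ← sum_tripleInt _ _ _ (fun j k l => σ j k l m) (fun _ _ _ => h₁ _ _ _ _)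
        (fun _ _ _ => h₂ _ _ _ _)]
      simp only [Finset.mul_sum]
      push_cast
      simp only [mul_assoc]
    simpa using h6
  have z₁ (i k l) : σ i i k l = 0 := eq_zero_of_eq_neg (h₁ i i k l)
  have z₂ (i k l) : σ k i i l = 0 := eq_zero_of_eq_neg (h₂ k i i l)
  have z₃ (i k l) : σ k l i i = 0 := eq_zero_of_eq_neg (h₃ k l i i)
  have s₁ (i j k l) (_ : j < i) : σ i j k l = -σ j i k l := h₁ i j k l
  have s₂ (i j k l) (_ : k < j) : σ i j k l = -σ i k j l := h₂ i j k l
  have s₃ (i j k l) (_ : l < k) : σ i j k l = -σ i j l k := h₃ i j k l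
  simp only [Fin.sum_univ_four, forall_fin_seven] at e
  simp [psiTriples, psiSigns, z₁, z₂, z₃, s₁, s₂, s₃] at e
  have Z : ∀ q ∈ quadruples, σ q.1 q.2.1 q.2.2.1 q.2.2.2 = 0 := by
    simp only [quadruples, List.forall_mem_cons]
    casesm* _ ∧ _
    and_intros <;> first | linarith | simp
  exact alternating_eq_zero σ h₁ h₂ h₃
    (fun i j k l hij hjk hkl => Z _ (mem_quadruples i j k l hij hjk hkl)) i j k l

/-! ### Multilinear functions and orthonormal frames -/

section Frames

variable {V : Type*} [AddCommGroup V] [Module ℝ V]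

theorem isLinearMap_sum {ι : Type*} {s : Finset ι} {F : ι → V → ℝ}
    (h : ∀ a, IsLinearMap ℝ (F a)) : IsLinearMap ℝ fun u => ∑ a ∈ s, F a u :=
  ⟨fun x y => by simp [(h _).map_add, Finset.sum_add_distrib],
    fun c x => by simp [(h _).map_smul, Finset.mul_sum]⟩

theorem isLinearMap_add {F G : V → ℝ} (hF : IsLinearMap ℝ F) (hG : IsLinearMap ℝ G) :
    IsLinearMap ℝ fun u => F u + G u :=
  ⟨fun x y => by rw [hF.map_add, hG.map_add]; ring,
    fun c x => by rw [hF.map_smul, hG.map_smul, smul_add]⟩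

theorem isLinearMap_neg_fun {F : V → ℝ} (hF : IsLinearMap ℝ F) : IsLinearMap ℝ fun u => -F u :=
  ⟨fun x y => by rw [hF.map_add]; ring, fun c x => by rw [hF.map_smul, smul_neg]⟩

theorem isLinearMap_sub {F G : V → ℝ} (hF : IsLinearMap ℝ F) (hG : IsLinearMap ℝ G) :
    IsLinearMap ℝ fun u => F u - G u := by
  simpa only [sub_eq_add_neg] using isLinearMap_add hF (isLinearMap_neg_fun hG)

theorem isLinearMap_mul_const {F : V → ℝ} (c : ℝ) (hF : IsLinearMap ℝ F) :
    IsLinearMap ℝ fun u => F u * c :=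
  ⟨fun x y => by rw [hF.map_add]; ring, fun a x => by rw [hF.map_smul, smul_mul_assoc]⟩

theorem isLinearMap_const_mul {F : V → ℝ} (c : ℝ) (hF : IsLinearMap ℝ F) :
    IsLinearMap ℝ fun u => c * F u :=
  ⟨fun x y => by rw [hF.map_add]; ring, fun a x => by rw [hF.map_smul, mul_smul_comm]⟩

theorem isLinearMap_apply_sum {L : V → ℝ} (hL : IsLinearMap ℝ L) (c : Fin 7 → ℝ) (e : Fin 7 → V) :
    L (∑ i, c i • e i) = ∑ i, c i * L (e i) := by
  have := map_sum (IsLinearMap.mk' L hL) (fun j => c j • e j) Finset.univ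
  simpa only [IsLinearMap.mk'_apply, hL.map_smul, smul_eq_mul] using this

/-- A bilinear function. -/
structure IsBilin (h : V → V → ℝ) : Prop where
  left : ∀ v, IsLinearMap ℝ fun u => h u v
  right : ∀ u, IsLinearMap ℝ fun v => h u v

/-- A function of four vectors that is linear in each of them. -/
structure IsQuadrilin (r : V → V → V → V → ℝ) : Prop where
  fst : ∀ y z w, IsLinearMap ℝ fun x => r x y z w
  snd : ∀ x z w, IsLinearMap ℝ fun y => r x y z w
  trd : ∀ x y w, IsLinearMap ℝ fun z => r x y z w
  fth : ∀ x y z, IsLinearMap ℝ fun w => r x y z w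

theorem isBilin_of_symm {h : V → V → ℝ} (hl : ∀ v, IsLinearMap ℝ fun u => h u v)
    (hs : ∀ u v, h u v = h v u) : IsBilin h :=
  ⟨hl, fun u => by simpa only [hs u] using hl u⟩

theorem isBilin_of_skew {h : V → V → ℝ} (hl : ∀ v, IsLinearMap ℝ fun u => h u v)
    (hs : ∀ u v, h u v = -h v u) : IsBilin h :=
  ⟨hl, fun u => by simpa only [hs u] using isLinearMap_neg_fun (hl u)⟩

namespace IsOrthonormalFrame

variable {g : V → V → ℝ} {e f : Fin 7 → V}

theorem expand_vec (he : IsOrthonormalFrame g e) (hg : IsBilin g) (x : V) :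
    x = ∑ i, g x (e i) • e i := by
  have hx : x ∈ Submodule.span ℝ (Set.range e) := he.2 ▸ Submodule.mem_top
  obtain ⟨c, rfl⟩ := (Submodule.mem_span_range_iff_exists_fun ℝ).1 hx
  refine Finset.sum_congr rfl fun i _ => ?_
  congr 1
  rw [isLinearMap_apply_sum (hg.left (e i))]
  simp [he.1]

/-- The value of a linear function is determined by its values on an orthonormal frame. -/
theorem expand (he : IsOrthonormalFrame g e) (hg : IsBilin g) {L : V → ℝ}
    (hL : IsLinearMap ℝ L) (x : V) : L x = ∑ i, g x (e i) * L (e i) := by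
  conv_lhs => rw [he.expand_vec hg x]
  exact isLinearMap_apply_sum hL _ _

theorem expand' (he : IsOrthonormalFrame g e) (hg : IsBilin g) (hs : ∀ u v, g u v = g v u)
    {L : V → ℝ} (hL : IsLinearMap ℝ L) (x : V) : ∑ i, g (e i) x * L (e i) = L x := by
  rw [he.expand hg hL x]
  exact Finset.sum_congr rfl fun i _ => by rw [hs]

/-- Metric contractions do not depend on the orthonormal frame. -/
theorem sum_eq (he : IsOrthonormalFrame g e) (hf : IsOrthonormalFrame g f) (hg : IsBilin g)
    (hs : ∀ u v, g u v = g v u) {B : V → V → ℝ} (hB : IsBilin B) :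
    ∑ i, B (f i) (f i) = ∑ i, B (e i) (e i) := by
  have h1 (i : Fin 7) : B (f i) (f i) =
      ∑ a, ∑ b, g (f i) (e a) * (g (f i) (e b) * B (e a) (e b)) := by
    rw [he.expand hg (hB.left (f i)) (f i)]
    refine Finset.sum_congr rfl fun a _ => ?_
    rw [he.expand hg (hB.right (e a)) (f i), Finset.mul_sum]
  simp only [h1]
  rw [Finset.sum_comm]
  refine Finset.sum_congr rfl fun a _ => ?_
  rw [Finset.sum_comm]
  have h2 (b : Fin 7) : ∑ i, g (f i) (e a) * (g (f i) (e b) * B (e a) (e b)) =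
      (if a = b then 1 else 0) * B (e a) (e b) := by
    rw [← he.1, ← hf.expand' hg hs (hg.left (e b)) (e a), Finset.sum_mul]
    exact Finset.sum_congr rfl fun i _ => by ring
  simp only [h2]
  simp

theorem linear_ext (he : IsOrthonormalFrame g e) (hg : IsBilin g) {L : V → ℝ}
    (hL : IsLinearMap ℝ L) (h : ∀ i, L (e i) = 0) (x : V) : L x = 0 := by
  rw [he.expand hg hL]; simp [h]

theorem bilin_ext (he : IsOrthonormalFrame g e) (hg : IsBilin g) {a b : V → V → ℝ}
    (ha : IsBilin a) (hb : IsBilin b) (h : ∀ i j, a (e i) (e j) = b (e i) (e j)) : a = b := by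
  funext x y
  rw [← sub_eq_zero]
  refine he.linear_ext hg (L := fun x => a x y - b x y)
    (isLinearMap_sub (ha.left y) (hb.left y)) (fun i => ?_) x
  refine he.linear_ext hg (L := fun y => a (e i) y - b (e i) y)
    (isLinearMap_sub (ha.right _) (hb.right _)) (fun j => ?_) y
  rw [h, sub_self]

theorem quadrilin_ext (he : IsOrthonormalFrame g e) (hg : IsBilin g) {a b : V → V → V → V → ℝ}
    (ha : IsQuadrilin a) (hb : IsQuadrilin b)
    (h : ∀ i j k l, a (e i) (e j) (e k) (e l) = b (e i) (e j) (e k) (e l)) : a = b := by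
  funext x y
  refine he.bilin_ext hg ⟨fun w => ha.trd x y w, fun z => ha.fth x y z⟩
    ⟨fun w => hb.trd x y w, fun z => hb.fth x y z⟩ fun k l => ?_
  refine congrFun (congrFun (he.bilin_ext hg (a := fun x y => a x y (e k) (e l))
    (b := fun x y => b x y (e k) (e l)) ⟨fun y => ha.fst y _ _, fun x => ha.snd x _ _⟩
    ⟨fun y => hb.fst y _ _, fun x => hb.snd x _ _⟩ fun i j => h i j k l) x) y

theorem inner₂_eq (he : IsOrthonormalFrame g e) (hf : IsOrthonormalFrame g f) (hg : IsBilin g)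
    (hs : ∀ u v, g u v = g v u) {a b : V → V → ℝ} (ha : IsBilin a) (hb : IsBilin b) :
    ∑ i, ∑ j, a (f i) (f j) * b (f i) (f j) = ∑ i, ∑ j, a (e i) (e j) * b (e i) (e j) := by
  have h1 (i : Fin 7) : ∑ j, a (f i) (f j) * b (f i) (f j) =
      ∑ j, a (f i) (e j) * b (f i) (e j) :=
    he.sum_eq hf hg hs (B := fun x y => a (f i) x * b (f i) y)
      ⟨fun v => isLinearMap_mul_const _ (ha.right _), fun v => isLinearMap_const_mul _ (hb.right _)⟩
  simp only [h1]
  exact he.sum_eq hf hg hs (B := fun x y => ∑ j, a x (e j) * b y (e j))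
    ⟨fun v => isLinearMap_sum fun j => isLinearMap_mul_const _ (ha.left _),
      fun v => isLinearMap_sum fun j => isLinearMap_const_mul _ (hb.left _)⟩

theorem inner₄_eq (he : IsOrthonormalFrame g e) (hf : IsOrthonormalFrame g f) (hg : IsBilin g)
    (hs : ∀ u v, g u v = g v u) {a b : V → V → V → V → ℝ} (ha : IsQuadrilin a)
    (hb : IsQuadrilin b) :
    ∑ i, ∑ j, ∑ k, ∑ l, a (f i) (f j) (f k) (f l) * b (f i) (f j) (f k) (f l) =
      ∑ i, ∑ j, ∑ k, ∑ l, a (e i) (e j) (e k) (e l) * b (e i) (e j) (e k) (e l) := by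
  have h1 (i j : Fin 7) : ∑ k, ∑ l, a (f i) (f j) (f k) (f l) * b (f i) (f j) (f k) (f l) =
      ∑ k, ∑ l, a (f i) (f j) (e k) (e l) * b (f i) (f j) (e k) (e l) :=
    he.inner₂_eq hf hg hs (a := fun z w => a (f i) (f j) z w) (b := fun z w => b (f i) (f j) z w)
      ⟨fun w => ha.trd _ _ w, fun z => ha.fth _ _ z⟩ ⟨fun w => hb.trd _ _ w, fun z => hb.fth _ _ z⟩
  simp only [h1]
  have h2 (i : Fin 7) : ∑ j, ∑ k, ∑ l, a (f i) (f j) (e k) (e l) * b (f i) (f j) (e k) (e l) =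
      ∑ j, ∑ k, ∑ l, a (f i) (e j) (e k) (e l) * b (f i) (e j) (e k) (e l) :=
    he.sum_eq hf hg hs
      (B := fun x y => ∑ k, ∑ l, a (f i) x (e k) (e l) * b (f i) y (e k) (e l))
      ⟨fun v => isLinearMap_sum fun k => isLinearMap_sum fun l =>
        isLinearMap_mul_const _ (ha.snd _ _ _), fun v => isLinearMap_sum fun k =>
        isLinearMap_sum fun l => isLinearMap_const_mul _ (hb.snd _ _ _)⟩
  simp only [h2]
  exact he.sum_eq hf hg hs
      (B := fun x y => ∑ j, ∑ k, ∑ l, a x (e j) (e k) (e l) * b y (e j) (e k) (e l))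
      ⟨fun v => isLinearMap_sum fun j => isLinearMap_sum fun k => isLinearMap_sum fun l =>
        isLinearMap_mul_const _ (ha.fst _ _ _), fun v => isLinearMap_sum fun j =>
        isLinearMap_sum fun k => isLinearMap_sum fun l => isLinearMap_const_mul _ (hb.fst _ _ _)⟩

end IsOrthonormalFrame

/-- A seven-dimensional Euclidean vector space with a `G₂` form. -/
structure IsG2Space (g : V → V → ℝ) (φ : V → V → V → ℝ) : Prop where
  bilin : IsBilin g
  symm : ∀ u v, g u v = g v u
  phi_lin : ∀ v w, IsLinearMap ℝ fun u => φ u v w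
  phi_skew₁ : ∀ u v w, φ u v w = -φ v u w
  phi_skew₂ : ∀ u v w, φ u v w = -φ u w v
  isG2Form : IsG2Form g φ

/-- The four-form `ψ` of a `G₂` form: the inner product of the cross products `u × v` and `w × z`,
minus that of the bivectors `u ∧ v` and `w ∧ z`. -/
noncomputable def fourForm (g : V → V → ℝ) (φ : V → V → V → ℝ) (e : Fin 7 → V) (u v w z : V) :
    ℝ :=
  ∑ a, φ (e a) u v * φ (e a) w z - (g u w * g v z - g u z * g v w)

namespace IsG2Space

variable {g : V → V → ℝ} {φ : V → V → V → ℝ}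

theorem frame_spec (H : IsG2Space g φ) : IsOrthonormalFrame g (frame g) :=
  let ⟨e, he, _⟩ := H.isG2Form
  Classical.epsilon_spec ⟨e, he⟩

theorem phi_snd (H : IsG2Space g φ) (u w : V) : IsLinearMap ℝ fun v => φ u v w := by
  simpa only [H.phi_skew₁ u] using isLinearMap_neg_fun (H.phi_lin u w)

theorem phi_trd (H : IsG2Space g φ) (u v : V) : IsLinearMap ℝ fun w => φ u v w := by
  simpa only [H.phi_skew₂ u v] using isLinearMap_neg_fun (H.phi_snd u v)

theorem phi_bilin (H : IsG2Space g φ) (u : V) : IsBilin (φ u) :=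
  ⟨fun v => H.phi_snd u v, fun v => H.phi_trd u v⟩

theorem fourForm_quadrilin (H : IsG2Space g φ) (e : Fin 7 → V) :
    IsQuadrilin (fourForm g φ e) := by
  have l := H.bilin.left
  have r := H.bilin.right
  have p2 := H.phi_snd
  have p3 := H.phi_trd
  constructor <;> intros <;> refine isLinearMap_sub (isLinearMap_sum fun a => ?_)
    (isLinearMap_sub ?_ ?_) <;>
  first
  | exact isLinearMap_mul_const _ (p2 _ _)
  | exact isLinearMap_mul_const _ (p3 _ _)
  | exact isLinearMap_const_mul _ (p2 _ _)
  | exact isLinearMap_const_mul _ (p3 _ _)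
  | exact isLinearMap_mul_const _ (l _)
  | exact isLinearMap_mul_const _ (r _)
  | exact isLinearMap_const_mul _ (l _)
  | exact isLinearMap_const_mul _ (r _)

theorem fourForm_eq (H : IsG2Space g φ) {e f : Fin 7 → V} (he : IsOrthonormalFrame g e)
    (hf : IsOrthonormalFrame g f) : fourForm g φ f = fourForm g φ e := by
  funext u v w z
  rw [fourForm, fourForm, he.sum_eq hf H.bilin H.symm (B := fun x y => φ x u v * φ y w z)
    ⟨fun _ => isLinearMap_mul_const _ (H.phi_lin _ _),
      fun _ => isLinearMap_const_mul _ (H.phi_lin _ _)⟩]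

/-- In an adapted frame, `φ` and `ψ` have the standard components. -/
theorem exists_adapted (H : IsG2Space g φ) : ∃ e : Fin 7 → V, IsOrthonormalFrame g e ∧
    (∀ i j k, φ (e i) (e j) (e k) = phiInt i j k) ∧
    ∀ i j k l, fourForm g φ e (e i) (e j) (e k) (e l) = psiInt i j k l := by
  obtain ⟨e, he, h⟩ := H.isG2Form
  have h' : ∀ i j k, φ (e i) (e j) (e k) = phiInt i j k := fun i j k => by rw [h, stdForm_eq]
  refine ⟨e, he, h', fun i j k l => ?_⟩
  simp only [fourForm, h', isG2Array_std.contr, he.1]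
  ring

theorem fourForm_skew₂ (H : IsG2Space g φ) {f : Fin 7 → V} (hf : IsOrthonormalFrame g f)
    (u v w z : V) : fourForm g φ f u v w z = -fourForm g φ f u w v z := by
  obtain ⟨e, he, -, hψ⟩ := H.exists_adapted
  rw [H.fourForm_eq he hf]
  have q := H.fourForm_quadrilin e
  have := he.quadrilin_ext H.bilin q (b := fun u v w z => -fourForm g φ e u w v z)
    ⟨fun _ _ _ => isLinearMap_neg_fun (q.fst _ _ _), fun _ _ _ => isLinearMap_neg_fun (q.trd _ _ _),
      fun _ _ _ => isLinearMap_neg_fun (q.snd _ _ _),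
      fun _ _ _ => isLinearMap_neg_fun (q.fth _ _ _)⟩
    fun i j k l => by rw [hψ, hψ]; exact isG2Array_std.psi_skew₂ i j k l
  exact congrFun (congrFun (congrFun (congrFun this u) v) w) z

/-- The contraction identities hold in every orthonormal frame, not only in adapted ones. -/
theorem isG2Array (H : IsG2Space g φ) {f : Fin 7 → V} (hf : IsOrthonormalFrame g f) :
    IsG2Array (fun i j k => φ (f i) (f j) (f k))
      (fun i j k l => fourForm g φ f (f i) (f j) (f k) (f l)) where
  skew₁ _ _ _ := H.phi_skew₁ _ _ _
  skew₂ _ _ _ := H.phi_skew₂ _ _ _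
  contr i j k l := by simp only [fourForm, hf.1]; ring
  psi_skew₁ i j k l := by
    simp only [fourForm, H.phi_skew₂ _ (f i) (f j), neg_mul, Finset.sum_neg_distrib]; ring
  psi_skew₂ i j k l := H.fourForm_skew₂ hf _ _ _ _
  psi_skew₃ i j k l := by
    simp only [fourForm, H.phi_skew₂ _ (f k) (f l), mul_neg, Finset.sum_neg_distrib]; ring

/-- A four-form is determined by its contraction with `ψ` on three indices. -/
theorem four_form_eq_zero (H : IsG2Space g φ) {f : Fin 7 → V} (hf : IsOrthonormalFrame g f)
    {σ : V → V → V → V → ℝ} (hσ : IsQuadrilin σ)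
    (h₁ : ∀ x y z w, σ x y z w = -σ y x z w) (h₂ : ∀ x y z w, σ x y z w = -σ x z y w)
    (h₃ : ∀ x y z w, σ x y z w = -σ x y w z)
    (hT : ∀ i m, ∑ j, ∑ k, ∑ l, fourForm g φ f (f i) (f j) (f k) (f l) *
      σ (f j) (f k) (f l) (f m) = 0) : σ = 0 := by
  obtain ⟨e, he, -, hψ⟩ := H.exists_adapted
  rw [H.fourForm_eq he hf] at hT
  have q := H.fourForm_quadrilin e
  have hT' (u v : V) : ∑ j, ∑ k, ∑ l, fourForm g φ e u (e j) (e k) (e l) *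
      σ (e j) (e k) (e l) v = 0 := by
    have h1 : ∀ u v, ∑ j, ∑ k, ∑ l, fourForm g φ e u (f j) (f k) (f l) *
        σ (f j) (f k) (f l) v = 0 := by
      intro u v
      refine hf.linear_ext H.bilin (L := fun u => ∑ j, ∑ k, ∑ l,
        fourForm g φ e u (f j) (f k) (f l) * σ (f j) (f k) (f l) v)
        (isLinearMap_sum fun _ => isLinearMap_sum fun _ => isLinearMap_sum fun _ =>
          isLinearMap_mul_const _ (q.fst _ _ _)) (fun i => ?_) u
      exact hf.linear_ext H.bilin (L := fun v => ∑ j, ∑ k, ∑ l,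
        fourForm g φ e (f i) (f j) (f k) (f l) * σ (f j) (f k) (f l) v)
        (isLinearMap_sum fun _ => isLinearMap_sum fun _ => isLinearMap_sum fun _ =>
          isLinearMap_const_mul _ (hσ.fth _ _ _)) (fun m => hT i m) v
    rw [← h1 u v]
    symm
    have h2 (j : Fin 7) : ∑ k, ∑ l, fourForm g φ e u (f j) (f k) (f l) * σ (f j) (f k) (f l) v =
        ∑ k, ∑ l, fourForm g φ e u (f j) (e k) (e l) * σ (f j) (e k) (e l) v :=
      he.inner₂_eq hf H.bilin H.symm (a := fun z w => fourForm g φ e u (f j) z w)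
        (b := fun z w => σ (f j) z w v)
        ⟨fun _ => q.trd _ _ _, fun _ => q.fth _ _ _⟩ ⟨fun _ => hσ.snd _ _ _, fun _ => hσ.trd _ _ _⟩
    simp only [h2]
    exact he.sum_eq hf H.bilin H.symm
      (B := fun x y => ∑ k, ∑ l, fourForm g φ e u x (e k) (e l) * σ y (e k) (e l) v)
      ⟨fun _ => isLinearMap_sum fun _ => isLinearMap_sum fun _ =>
        isLinearMap_mul_const _ (q.snd _ _ _), fun _ => isLinearMap_sum fun _ =>
        isLinearMap_sum fun _ => isLinearMap_const_mul _ (hσ.fst _ _ _)⟩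
  refine he.quadrilin_ext H.bilin hσ (b := 0)
    ⟨fun _ _ _ => ⟨by simp, by simp⟩, fun _ _ _ => ⟨by simp, by simp⟩,
      fun _ _ _ => ⟨by simp, by simp⟩, fun _ _ _ => ⟨by simp, by simp⟩⟩ fun i j k l => ?_
  exact four_form_eq_zero_std (fun i j k l => σ (e i) (e j) (e k) (e l))
    (fun _ _ _ _ => h₁ _ _ _ _) (fun _ _ _ _ => h₂ _ _ _ _) (fun _ _ _ _ => h₃ _ _ _ _)
    (fun i m => by simpa only [hψ] using hT' (e i) (e m)) i j k l

end IsG2Space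

end Frames

/-! ### Tensor inner products and Ricci contractions -/

section Tensors

variable {V : Type*} [AddCommGroup V] [Module ℝ V]

theorem isQuadrilin_of_mem {r : V → V → V → V → ℝ} (hr : r ∈ curvatureTensors V) :
    IsQuadrilin r := by
  obtain ⟨h1, h2, h3, h4, -⟩ := hr
  refine ⟨h1, fun x z w => ?_, h2, fun x y z => ?_⟩
  · simpa only [h3 x] using isLinearMap_neg_fun (h1 x z w)
  · simpa only [h4 x y z] using isLinearMap_neg_fun (h2 x y z)

theorem pair_symm {r : V → V → V → V → ℝ} (hr : r ∈ curvatureTensors V) (x y z w : V) :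
    r x y z w = r z w x y := by
  obtain ⟨-, -, h3, h4, h5⟩ := hr
  linarith [h5 x y z w, h5 y z w x, h5 z w x y, h5 w x y z, h3 x y z w, h3 y z x w, h3 z x y w,
    h4 x y z w, h4 y z x w, h4 z x y w, h3 w x z y, h4 w x y z, h3 w y z x, h4 y z w x, h4 z w x y,
    h3 y z w x, h3 z w y x, h4 w y z x, h3 z w x y, h4 w x z y, h3 x z w y, h4 x z w y, h3 w x y z,
    h3 x y w z, h3 y w x z, h4 y w x z, h4 x y w z, h3 z w y x, h4 z x w y, h3 y w z x]

theorem ric_symm (g : V → V → ℝ) {r : V → V → V → V → ℝ} (hr : r ∈ curvatureTensors V) (u v : V) :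
    ric g r u v = ric g r v u :=
  Finset.sum_congr rfl fun i _ => by
    rw [pair_symm hr, hr.2.2.1, hr.2.2.2.1, neg_neg]

theorem isBilin_ric (g : V → V → ℝ) {r : V → V → V → V → ℝ} (hr : IsQuadrilin r) :
    IsBilin (ric g r) :=
  ⟨fun _ => isLinearMap_sum fun _ => hr.fst _ _ _, fun _ => isLinearMap_sum fun _ => hr.fth _ _ _⟩

theorem ricPhi_eq (g : V → V → ℝ) (φ : V → V → V → ℝ) (r : V → V → V → V → ℝ) (u v : V) :
    ricPhi g φ r u v = ∑ i, ∑ j, ∑ k, ∑ l, φ u (frame g i) (frame g j) *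
      φ v (frame g k) (frame g l) * r (frame g i) (frame g j) (frame g k) (frame g l) := by
  simp only [ricPhi, Finset.mul_sum]
  exact Finset.sum_congr rfl fun _ _ => Finset.sum_congr rfl fun _ _ =>
    Finset.sum_congr rfl fun _ _ => Finset.sum_congr rfl fun _ _ => by ring

theorem ricPhi_eq_inner₂ (g : V → V → ℝ) (φ : V → V → V → ℝ) (r : V → V → V → V → ℝ) (u v : V) :
    ricPhi g φ r u v = inner₂ g (φ v) fun z w => inner₂ g (φ u) fun x y => r x y z w := by
  rw [ricPhi_eq]
  simp only [inner₂, Finset.mul_sum]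
  rw [Finset.sum_comm_cycle]
  refine Finset.sum_congr rfl fun k _ => ?_
  rw [Finset.sum_comm_cycle]
  exact Finset.sum_congr rfl fun l _ => Finset.sum_congr rfl fun i _ =>
    Finset.sum_congr rfl fun j _ => by ring

section Linear

variable (g : V → V → ℝ) (φ : V → V → V → ℝ)

theorem inner₂_comm (a b : V → V → ℝ) : inner₂ g a b = inner₂ g b a := by
  simp only [inner₂, mul_comm]

theorem inner₂_add_right (a b c : V → V → ℝ) :
    inner₂ g a (b + c) = inner₂ g a b + inner₂ g a c := by
  simp [inner₂, mul_add, Finset.sum_add_distrib]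

theorem inner₂_smul_right (t : ℝ) (a b : V → V → ℝ) : inner₂ g a (t • b) = t * inner₂ g a b := by
  simp [inner₂, Finset.mul_sum, mul_left_comm]

theorem inner₂_sub_right (a b c : V → V → ℝ) :
    inner₂ g a (b - c) = inner₂ g a b - inner₂ g a c := by
  simp [inner₂, mul_sub, Finset.sum_sub_distrib]

theorem inner₂_sum_right {ι : Type*} (s : Finset ι) (a : V → V → ℝ) (b : ι → V → V → ℝ) :
    inner₂ g a (∑ i ∈ s, b i) = ∑ i ∈ s, inner₂ g a (b i) := by
  classical
  induction s using Finset.induction_on with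
  | empty => simp [inner₂]
  | insert i s hi ih => rw [Finset.sum_insert hi, Finset.sum_insert hi, inner₂_add_right, ih]

theorem inner₄_comm (a b : V → V → V → V → ℝ) : inner₄ g a b = inner₄ g b a := by
  simp only [inner₄, mul_comm]

theorem inner₄_add_left (a b c : V → V → V → V → ℝ) :
    inner₄ g (a + b) c = inner₄ g a c + inner₄ g b c := by
  simp [inner₄, add_mul, Finset.sum_add_distrib]

theorem inner₄_sub_left (a b c : V → V → V → V → ℝ) :
    inner₄ g (a - b) c = inner₄ g a c - inner₄ g b c := by
  simp [inner₄, sub_mul, Finset.sum_sub_distrib]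

theorem inner₄_smul_left (t : ℝ) (a b : V → V → V → V → ℝ) :
    inner₄ g (t • a) b = t * inner₄ g a b := by
  simp [inner₄, Finset.mul_sum, mul_assoc]

theorem inner₄_zero_left (a : V → V → V → V → ℝ) : inner₄ g 0 a = 0 := by
  simp [inner₄]

theorem inner₄_add_right (a b c : V → V → V → V → ℝ) :
    inner₄ g c (a + b) = inner₄ g c a + inner₄ g c b := by
  simp only [inner₄_comm g c, inner₄_add_left]

theorem inner₄_smul_right (t : ℝ) (a b : V → V → V → V → ℝ) :
    inner₄ g b (t • a) = t * inner₄ g b a := by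
  simp only [inner₄_comm g b, inner₄_smul_left]

theorem ric_sub (a b : V → V → V → V → ℝ) : ric g (a - b) = ric g a - ric g b := by
  ext; simp [ric, Finset.sum_sub_distrib]

theorem ric_smul (t : ℝ) (a : V → V → V → V → ℝ) : ric g (t • a) = t • ric g a := by
  ext; simp [ric, Finset.mul_sum]

theorem ricPhi_add (a b : V → V → V → V → ℝ) :
    ricPhi g φ (a + b) = ricPhi g φ a + ricPhi g φ b := by
  ext u v; simp [ricPhi_eq, mul_add, Finset.sum_add_distrib]

theorem ricPhi_sub (a b : V → V → V → V → ℝ) :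
    ricPhi g φ (a - b) = ricPhi g φ a - ricPhi g φ b := by
  ext u v; simp [ricPhi_eq, mul_sub, Finset.sum_sub_distrib]

theorem ricPhi_smul (t : ℝ) (a : V → V → V → V → ℝ) :
    ricPhi g φ (t • a) = t • ricPhi g φ a := by
  ext u v; simp [ricPhi_eq, Finset.mul_sum, mul_left_comm]

theorem trace_sub (a b : V → V → ℝ) : trace g (a - b) = trace g a - trace g b := by
  simp [trace, Finset.sum_sub_distrib]

theorem trace_smul (t : ℝ) (a : V → V → ℝ) : trace g (t • a) = t * trace g a := by
  simp [trace, Finset.mul_sum]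

end Linear

omit [AddCommGroup V] [Module ℝ V] in
theorem mem_symProd_swap {A B : Set (V → V → ℝ)} {t : V → V → V → V → ℝ} (ht : t ∈ symProd A B)
    (x y z w : V) : t x y z w = t z w x y := by
  refine Submodule.span_induction (p := fun t _ => t x y z w = t z w x y) ?_ rfl ?_ ?_ ht
  · rintro _ ⟨α, -, β, -, rfl⟩; ring
  · intro a b _ _ ha hb; simp [ha, hb]
  · intro c a _ ha; simp [ha]

namespace IsG2Space

variable {g : V → V → ℝ} {φ : V → V → V → ℝ} (H : IsG2Space g φ)

include H

theorem trace_self : trace g g = 7 := by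
  simp [trace, H.frame_spec.1]

theorem trace_traceless (h : V → V → ℝ) : trace g (traceless g h) = 0 := by
  rw [traceless, trace_sub, trace_smul, H.trace_self]; ring

theorem traceless_bilin {h : V → V → ℝ} (hh : IsBilin h) : IsBilin (traceless g h) :=
  ⟨fun v => isLinearMap_sub (hh.left v) (isLinearMap_const_mul _ (H.bilin.left v)),
    fun v => isLinearMap_sub (hh.right v) (isLinearMap_const_mul _ (H.bilin.right v))⟩

theorem traceless_symm {h : V → V → ℝ} (hh : ∀ u v, h u v = h v u) (u v : V) :
    traceless g h u v = traceless g h v u := by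
  simp [traceless, hh u v, H.symm u v]

theorem isBilin_ricPhi (r : V → V → V → V → ℝ) : IsBilin (ricPhi g φ r) := by
  constructor <;> intro v <;> simp only [ricPhi_eq] <;>
    refine isLinearMap_sum fun i => isLinearMap_sum fun j => isLinearMap_sum fun k =>
      isLinearMap_sum fun l => isLinearMap_mul_const _ ?_
  · exact isLinearMap_mul_const _ (H.phi_lin _ _)
  · exact isLinearMap_const_mul _ (H.phi_lin _ _)

omit H in
theorem ricPhi_symm {r : V → V → V → V → ℝ} (hr : r ∈ curvatureTensors V) (u v : V) :
    ricPhi g φ r u v = ricPhi g φ r v u := by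
  rw [ricPhi_eq, ricPhi_eq_inner₂]
  simp only [inner₂, Finset.mul_sum]
  exact Finset.sum_congr rfl fun k _ => Finset.sum_congr rfl fun l _ =>
    Finset.sum_congr rfl fun i _ => Finset.sum_congr rfl fun j _ => by
      rw [pair_symm hr (frame g k)]; ring

/-- The inner product of 4-tensors is positive definite. -/
theorem eq_zero_of_inner₄ {a : V → V → V → V → ℝ} (ha : IsQuadrilin a) (h : inner₄ g a a = 0) :
    a = 0 := by
  refine H.frame_spec.quadrilin_ext H.bilin ha (b := 0)
    ⟨fun _ _ _ => ⟨by simp, by simp⟩, fun _ _ _ => ⟨by simp, by simp⟩,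
      fun _ _ _ => ⟨by simp, by simp⟩, fun _ _ _ => ⟨by simp, by simp⟩⟩ fun i j k l => ?_
  have n (i j k l : Fin 7) : 0 ≤ a (frame g i) (frame g j) (frame g k) (frame g l) *
      a (frame g i) (frame g j) (frame g k) (frame g l) := mul_self_nonneg _
  rw [inner₄, Finset.sum_eq_zero_iff_of_nonneg fun i _ => Finset.sum_nonneg fun j _ =>
    Finset.sum_nonneg fun k _ => Finset.sum_nonneg fun l _ => n i j k l] at h
  have h := h i (Finset.mem_univ _)
  rw [Finset.sum_eq_zero_iff_of_nonneg fun j _ =>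
    Finset.sum_nonneg fun k _ => Finset.sum_nonneg fun l _ => n i j k l] at h
  have h := h j (Finset.mem_univ _)
  rw [Finset.sum_eq_zero_iff_of_nonneg fun k _ => Finset.sum_nonneg fun l _ => n i j k l] at h
  have h := h k (Finset.mem_univ _)
  rw [Finset.sum_eq_zero_iff_of_nonneg fun l _ => n i j k l] at h
  exact mul_self_eq_zero.1 (h l (Finset.mem_univ _))

theorem inner₂_phi (u v : V) : inner₂ g (φ u) (φ v) = 6 * g u v := by
  have hf := H.frame_spec
  have b1 : IsBilin fun u v => inner₂ g (φ u) (φ v) :=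
    ⟨fun _ => isLinearMap_sum fun _ => isLinearMap_sum fun _ =>
      isLinearMap_mul_const _ (H.phi_lin _ _), fun _ => isLinearMap_sum fun _ =>
      isLinearMap_sum fun _ => isLinearMap_const_mul _ (H.phi_lin _ _)⟩
  have b2 : IsBilin fun u v => 6 * g u v :=
    ⟨fun _ => isLinearMap_const_mul _ (H.bilin.left _),
      fun _ => isLinearMap_const_mul _ (H.bilin.right _)⟩
  exact congrFun (congrFun (hf.bilin_ext H.bilin b1 b2 fun i j => by
    rw [hf.1]; exact (H.isG2Array hf).contr_two i j) u) v

/-! ### The Kulkarni–Nomizu map `r_g` -/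

theorem ric_rg {h : V → V → ℝ} (hh : IsBilin h) :
    ric g (rg g h) = trace g h • g + (5 : ℝ) • h := by
  have hf := H.frame_spec
  funext u v
  simp only [ric, rg, Finset.sum_add_distrib, Finset.sum_sub_distrib, ← Finset.sum_mul,
    hf.1]
  have e1 : ∑ i, h u (frame g i) * g (frame g i) v = h u v := by
    rw [← hf.expand' H.bilin H.symm (hh.right u) v]
    exact Finset.sum_congr rfl fun i _ => by ring
  have e2 : ∑ i, h (frame g i) v * g u (frame g i) = h u v := by
    rw [← hf.expand' H.bilin H.symm (hh.left v) u]
    exact Finset.sum_congr rfl fun i _ => by rw [H.symm u]; ring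
  rw [e1, e2]
  simp [trace]
  ring

theorem rg_mem {h : V → V → ℝ} (hh : IsBilin h) (hs : ∀ u v, h u v = h v u) :
    rg g h ∈ curvatureTensors V := by
  have l := H.bilin.left
  refine ⟨fun y z w => ?_, fun x y w => ?_, fun x y z w => ?_, fun x y z w => ?_,
    fun x y z w => ?_⟩
  · exact isLinearMap_sub (isLinearMap_add (isLinearMap_sub (isLinearMap_const_mul _ (l _))
      (isLinearMap_mul_const _ (hh.left _))) (isLinearMap_mul_const _ (hh.left _)))
      (isLinearMap_const_mul _ (l _))
  · exact isLinearMap_sub (isLinearMap_add (isLinearMap_sub (isLinearMap_mul_const _ (hh.right _))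
      (isLinearMap_mul_const _ (hh.right _))) (isLinearMap_const_mul _ (H.bilin.right _)))
      (isLinearMap_const_mul _ (H.bilin.right _))
  · simp only [rg]; ring
  · simp only [rg]; ring
  · simp only [rg, hs z x, hs y x, hs z y, H.symm z x, H.symm y x, H.symm z y]; ring

theorem inner₄_rg (h : V → V → ℝ) {t : V → V → V → V → ℝ} (ht : t ∈ curvatureTensors V) :
    inner₄ g (rg g h) t = 4 * inner₂ g h (ric g t) := by
  have hf := H.frame_spec
  have r1 (j k i : Fin 7) : t (frame g i) (frame g j) (frame g k) (frame g i) =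
      t (frame g j) (frame g i) (frame g i) (frame g k) := by
    rw [ht.2.2.1, ht.2.2.2.1, neg_neg]
  have r2 (j k i : Fin 7) : t (frame g j) (frame g i) (frame g k) (frame g i) =
      -t (frame g j) (frame g i) (frame g i) (frame g k) := ht.2.2.2.1 _ _ _ _
  have r3 (j k i : Fin 7) : t (frame g i) (frame g j) (frame g i) (frame g k) =
      -t (frame g j) (frame g i) (frame g i) (frame g k) := ht.2.2.1 _ _ _ _
  have t1 : ∑ i, ∑ j, ∑ k, ∑ l, h (frame g j) (frame g k) * g (frame g i) (frame g l) *
      t (frame g i) (frame g j) (frame g k) (frame g l) = inner₂ g h (ric g t) := by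
    simp only [hf.1, inner₂, ric, Finset.mul_sum]
    simp
    rw [Finset.sum_comm]
    refine Finset.sum_congr rfl fun j _ => ?_
    rw [Finset.sum_comm]
    exact Finset.sum_congr rfl fun k _ => Finset.sum_congr rfl fun i _ => by rw [r1]
  have t2 : ∑ i, ∑ j, ∑ k, ∑ l, h (frame g i) (frame g k) * g (frame g j) (frame g l) *
      t (frame g i) (frame g j) (frame g k) (frame g l) = -inner₂ g h (ric g t) := by
    simp only [hf.1, inner₂, ric, Finset.mul_sum, ← Finset.sum_neg_distrib]
    simp [r2]
    exact Finset.sum_congr rfl fun _ _ => Finset.sum_comm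
  have t3 : ∑ i, ∑ j, ∑ k, ∑ l, h (frame g i) (frame g l) * g (frame g j) (frame g k) *
      t (frame g i) (frame g j) (frame g k) (frame g l) = inner₂ g h (ric g t) := by
    simp only [hf.1, inner₂, ric, Finset.mul_sum]
    simp
    exact Finset.sum_congr rfl fun _ _ => Finset.sum_comm
  have t4 : ∑ i, ∑ j, ∑ k, ∑ l, h (frame g j) (frame g l) * g (frame g i) (frame g k) *
      t (frame g i) (frame g j) (frame g k) (frame g l) = -inner₂ g h (ric g t) := by
    simp only [hf.1, inner₂, ric, Finset.mul_sum, ← Finset.sum_neg_distrib]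
    simp [r3]
    rw [Finset.sum_comm]
    exact Finset.sum_congr rfl fun _ _ => Finset.sum_comm
  simp only [inner₄, rg, add_mul, sub_mul, Finset.sum_add_distrib, Finset.sum_sub_distrib]
  rw [t1, t2, t3, t4]; ring

theorem ricPhi_rg {h : V → V → ℝ} (hh : IsBilin h) (hs : ∀ u v, h u v = h v u) :
    ricPhi g φ (rg g h) = (4 : ℝ) • (h - trace g h • g) := by
  have hf := H.frame_spec
  refine hf.bilin_ext H.bilin (H.isBilin_ricPhi _)
    ⟨fun v => isLinearMap_const_mul _ (isLinearMap_sub (hh.left v)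
      (isLinearMap_const_mul _ (H.bilin.left v))),
      fun v => isLinearMap_const_mul _ (isLinearMap_sub (hh.right v)
      (isLinearMap_const_mul _ (H.bilin.right v)))⟩ fun a b => ?_
  have := (H.isG2Array hf).ricPhi_rg (fun a b => h (frame g a) (frame g b)) (fun _ _ => hs _ _) a b
  simp only [ricPhi_eq, rg, hf.1, Pi.smul_apply, Pi.sub_apply, smul_eq_mul, trace] at this ⊢
  exact this

end IsG2Space

end Tensors

section Decomposition

variable {V : Type*} [AddCommGroup V] [Module ℝ V]

/-! ### The map `r_φ` -/

/-- The tensor `∑ h(e_a, e_b) (e_a ⌟ φ) ⊗ (e_b ⌟ φ)`, of which `r_φ(h)` is the Bianchi-free part. -/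
noncomputable def phiSq (g : V → V → ℝ) (φ : V → V → V → ℝ) (h : V → V → ℝ) : V → V → V → V → ℝ :=
  fun x y z w => ∑ a, ∑ b, h (frame g a) (frame g b) * (φ (frame g a) x y * φ (frame g b) z w)

theorem rphi_eq (g : V → V → ℝ) (φ : V → V → V → ℝ) (h : V → V → ℝ) :
    rphi g φ h = phiSq g φ h - (1 / 3 : ℝ) • bianchi (phiSq g φ h) := rfl

theorem isQuadrilin_bianchi {q : V → V → V → V → ℝ} (hq : IsQuadrilin q) :
    IsQuadrilin (bianchi q) :=
  ⟨fun _ _ _ => isLinearMap_add (isLinearMap_add (hq.fst _ _ _) (hq.trd _ _ _)) (hq.snd _ _ _),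
    fun _ _ _ => isLinearMap_add (isLinearMap_add (hq.snd _ _ _) (hq.fst _ _ _)) (hq.trd _ _ _),
    fun _ _ _ => isLinearMap_add (isLinearMap_add (hq.trd _ _ _) (hq.snd _ _ _)) (hq.fst _ _ _),
    fun _ _ _ => isLinearMap_add (isLinearMap_add (hq.fth _ _ _) (hq.fth _ _ _)) (hq.fth _ _ _)⟩

section Bianchi

variable {q : V → V → V → V → ℝ} (h₁ : ∀ x y z w, q x y z w = -q y x z w)
  (h₃ : ∀ x y z w, q x y z w = -q x y w z) (hp : ∀ x y z w, q x y z w = q z w x y)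

omit [AddCommGroup V] [Module ℝ V]

include h₁ in
theorem bianchi_skew₁ (x y z w : V) : bianchi q x y z w = -bianchi q y x z w := by
  simp only [bianchi, h₁ x y z w, h₁ y z x w, h₁ z x y w]; ring

include h₁ in
theorem bianchi_skew₂ (x y z w : V) : bianchi q x y z w = -bianchi q x z y w := by
  simp only [bianchi, h₁ x y z w, h₁ y z x w, h₁ z x y w]; ring

include h₁ h₃ hp in
theorem bianchi_skew₃ (x y z w : V) : bianchi q x y z w = -bianchi q x y w z := by
  simp only [bianchi]
  rw [hp y z x w, hp z x y w, h₃ x y z w, h₁ x w y z, h₃ y w z x]; ring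

end Bianchi

/-- The image of the Bianchi map is orthogonal to the algebraic curvature tensors. -/
theorem inner₄_bianchi (g : V → V → ℝ) (q : V → V → V → V → ℝ)
    {t : V → V → V → V → ℝ} (ht : t ∈ curvatureTensors V) : inner₄ g (bianchi q) t = 0 := by
  have c1 (F : Fin 7 → Fin 7 → Fin 7 → Fin 7 → ℝ) :
      ∑ i, ∑ j, ∑ k, ∑ l, F j k i l = ∑ i, ∑ j, ∑ k, ∑ l, F i j k l := by
    rw [Finset.sum_comm]
    exact Finset.sum_congr rfl fun _ _ => Finset.sum_comm
  have e1 := c1 fun i j k l => q (frame g i) (frame g j) (frame g k) (frame g l) *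
    t (frame g k) (frame g i) (frame g j) (frame g l)
  have e2 := c1 fun i j k l => q (frame g k) (frame g i) (frame g j) (frame g l) *
    t (frame g i) (frame g j) (frame g k) (frame g l)
  simp only [inner₄, bianchi, add_mul, Finset.sum_add_distrib]
  rw [e1, ← e2]
  simp only [← Finset.sum_add_distrib, ← mul_add]
  refine Finset.sum_eq_zero fun i _ => Finset.sum_eq_zero fun j _ => Finset.sum_eq_zero fun k _ =>
    Finset.sum_eq_zero fun l _ => ?_
  have := ht.2.2.2.2 (frame g i) (frame g j) (frame g k) (frame g l)
  linear_combination q (frame g i) (frame g j) (frame g k) (frame g l) * this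

namespace IsG2Space

variable {g : V → V → ℝ} {φ : V → V → V → ℝ} (H : IsG2Space g φ)

include H

theorem phiSq_quadrilin (h : V → V → ℝ) : IsQuadrilin (phiSq g φ h) := by
  constructor <;> intros <;> refine isLinearMap_sum fun a => isLinearMap_sum fun b =>
    isLinearMap_const_mul _ ?_
  · exact isLinearMap_mul_const _ (H.phi_snd _ _)
  · exact isLinearMap_mul_const _ (H.phi_trd _ _)
  · exact isLinearMap_const_mul _ (H.phi_snd _ _)
  · exact isLinearMap_const_mul _ (H.phi_trd _ _)

theorem phiSq_skew₁ (h : V → V → ℝ) (x y z w : V) : phiSq g φ h x y z w = -phiSq g φ h y x z w := by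
  simp only [phiSq, H.phi_skew₂ _ x y, neg_mul, mul_neg, Finset.sum_neg_distrib]

theorem phiSq_skew₃ (h : V → V → ℝ) (x y z w : V) : phiSq g φ h x y z w = -phiSq g φ h x y w z := by
  simp only [phiSq, H.phi_skew₂ _ z w, mul_neg, Finset.sum_neg_distrib]

omit H in
theorem phiSq_pair {h : V → V → ℝ} (hs : ∀ u v, h u v = h v u) (x y z w : V) :
    phiSq g φ h x y z w = phiSq g φ h z w x y := by
  simp only [phiSq]
  rw [Finset.sum_comm]
  exact Finset.sum_congr rfl fun a _ => Finset.sum_congr rfl fun b _ => by rw [hs]; ring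

theorem rphi_mem {h : V → V → ℝ} (hs : ∀ u v, h u v = h v u) :
    rphi g φ h ∈ curvatureTensors V := by
  have q := H.phiSq_quadrilin h
  have b := isQuadrilin_bianchi q
  have b₁ := bianchi_skew₁ (H.phiSq_skew₁ h)
  have b₃ := bianchi_skew₃ (H.phiSq_skew₁ h) (H.phiSq_skew₃ h) (phiSq_pair hs)
  rw [rphi_eq]
  refine ⟨fun y z w => isLinearMap_sub (q.fst _ _ _) (isLinearMap_const_mul _ (b.fst _ _ _)),
    fun x y w => isLinearMap_sub (q.trd _ _ _) (isLinearMap_const_mul _ (b.trd _ _ _)),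
    fun x y z w => ?_, fun x y z w => ?_, fun x y z w => ?_⟩
  · simp only [Pi.sub_apply, Pi.smul_apply, smul_eq_mul, H.phiSq_skew₁ h x y, b₁ x y]; ring
  · simp only [Pi.sub_apply, Pi.smul_apply, smul_eq_mul, H.phiSq_skew₃ h x y z w, b₃ x y z w]; ring
  · simp only [Pi.sub_apply, Pi.smul_apply, smul_eq_mul, bianchi]; ring

theorem ric_rphi {h : V → V → ℝ} (hh : IsBilin h) (hs : ∀ u v, h u v = h v u) :
    ric g (rphi g φ h) = h - trace g h • g := by
  have hf := H.frame_spec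
  have hb : ric g (bianchi (phiSq g φ h)) = 0 := by
    funext u v
    exact Finset.sum_eq_zero fun i _ =>
      eq_zero_of_eq_neg (bianchi_skew₂ (H.phiSq_skew₁ h) _ _ _ _)
  rw [rphi_eq, ric_sub, ric_smul, hb, smul_zero, sub_zero]
  refine hf.bilin_ext H.bilin (isBilin_ric g (H.phiSq_quadrilin h))
    ⟨fun v => isLinearMap_sub (hh.left v) (isLinearMap_const_mul _ (H.bilin.left v)),
      fun v => isLinearMap_sub (hh.right v) (isLinearMap_const_mul _ (H.bilin.right v))⟩
    fun x w => ?_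
  have := (H.isG2Array hf).ric_phi_sq (fun a b => h (frame g a) (frame g b)) (fun _ _ => hs _ _) x w
  simpa only [ric, phiSq, Pi.sub_apply, Pi.smul_apply, smul_eq_mul, hf.1, trace] using this

theorem ricPhi_rphi {h : V → V → ℝ} (hh : IsBilin h) (hs : ∀ u v, h u v = h v u)
    (ht : trace g h = 0) : ricPhi g φ (rphi g φ h) = (92 / 3 : ℝ) • h := by
  have hf := H.frame_spec
  have A := H.isG2Array hf
  refine hf.bilin_ext H.bilin (H.isBilin_ricPhi _) ⟨fun v => isLinearMap_const_mul _ (hh.left v),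
    fun v => isLinearMap_const_mul _ (hh.right v)⟩ fun a b => ?_
  have e1 := A.ricPhi_phi_sq (fun a b => h (frame g a) (frame g b)) a b
  have e2 := A.ricPhi_phi_sq_cyc (fun a b => h (frame g a) (frame g b)) (fun _ _ => hs _ _) ht a b
  -- The two cyclic rotations contribute equally, by the antisymmetry of `φ a i j`.
  have e3 : ∑ i, ∑ j, ∑ k, ∑ l, φ (frame g a) (frame g i) (frame g j) *
      φ (frame g b) (frame g k) (frame g l) *
        phiSq g φ h (frame g k) (frame g i) (frame g j) (frame g l) =
          -10 * h (frame g a) (frame g b) := by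
    rw [← e2, Finset.sum_comm]
    refine Finset.sum_congr rfl fun i _ => Finset.sum_congr rfl fun j _ =>
      Finset.sum_congr rfl fun k _ => Finset.sum_congr rfl fun l _ => ?_
    rw [H.phiSq_skew₁, H.phi_skew₂ _ (frame g j)]
    simp only [phiSq]
    ring
  rw [rphi_eq, ricPhi_sub, ricPhi_smul]
  have e4 : ricPhi g φ (phiSq g φ h) (frame g a) (frame g b) = 36 * h (frame g a) (frame g b) := by
    rw [ricPhi_eq]; exact e1
  have e5 : ricPhi g φ (bianchi (phiSq g φ h)) (frame g a) (frame g b) =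
      16 * h (frame g a) (frame g b) := by
    rw [ricPhi_eq]
    simp only [bianchi, mul_add, Finset.sum_add_distrib]
    rw [e3, ← ricPhi_eq, e4]
    simp only [phiSq]
    rw [e2]
    ring
  simp only [Pi.sub_apply, Pi.smul_apply, smul_eq_mul, e4, e5]
  ring

omit H in
theorem inner₄_rphi (h : V → V → ℝ) {t : V → V → V → V → ℝ} (ht : t ∈ curvatureTensors V) :
    inner₄ g (rphi g φ h) t = inner₂ g h (ricPhi g φ t) := by
  rw [rphi_eq, inner₄_sub_left, inner₄_smul_left, inner₄_bianchi g _ ht, mul_zero, sub_zero]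
  have e : inner₄ g (phiSq g φ h) t = inner₄ g t (phiSq g φ h) := inner₄_comm _ _ _
  rw [e]
  simp only [inner₄, phiSq, inner₂, ricPhi_eq]
  rw [sum_four_mul_sum_two]
  refine Finset.sum_congr rfl fun a _ => Finset.sum_congr rfl fun b _ => ?_
  simp only [Finset.mul_sum]
  exact Finset.sum_congr rfl fun i _ => Finset.sum_congr rfl fun j _ =>
    Finset.sum_congr rfl fun k _ => Finset.sum_congr rfl fun l _ => by ring

end IsG2Space

end Decomposition

section Splitting

variable {V : Type*} [AddCommGroup V] [Module ℝ V]

/-! ### Contraction of the first pair of indices with `φ` -/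

/-- The contraction `∑ φ(u, eᵢ, eⱼ) r(eᵢ, eⱼ, z, w)` of the first pair of indices of `r`. -/
noncomputable def phiContr (g : V → V → ℝ) (φ : V → V → V → ℝ) (r : V → V → V → V → ℝ) (u z w : V) :
    ℝ :=
  inner₂ g (φ u) fun x y => r x y z w

section

variable (g : V → V → ℝ) (φ : V → V → V → ℝ) (r : V → V → V → V → ℝ)

theorem ricPhi_eq_phiContr (u v : V) :
    ricPhi g φ r u v = inner₂ g (φ v) (phiContr g φ r u) :=
  ricPhi_eq_inner₂ g φ r u v

theorem phiContr_swap {r : V → V → V → V → ℝ} (hp : ∀ x y z w, r x y z w = r z w x y) (u x y : V) :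
    (inner₂ g (φ u) fun z w => r x y z w) = phiContr g φ r u x y := by
  simp only [phiContr, inner₂, hp x y]

end

theorem isBilin_phiContr (g : V → V → ℝ) (φ : V → V → V → ℝ) {r : V → V → V → V → ℝ}
    (hr : IsQuadrilin r) (u : V) : IsBilin (phiContr g φ r u) := by
  constructor <;> intro v <;> simp only [phiContr, inner₂] <;>
    refine isLinearMap_sum fun _ => isLinearMap_sum fun _ => isLinearMap_const_mul _ ?_
  · exact hr.trd _ _ _
  · exact hr.fth _ _ _

namespace IsG2Space

variable {g : V → V → ℝ} {φ : V → V → V → ℝ} (H : IsG2Space g φ)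

include H

/-- The Ricci contraction of `6 (p₇ ⊗ 1) r` is `2 Ric`. -/
theorem sum_phiContr {r : V → V → V → V → ℝ} (hr : r ∈ curvatureTensors V) (x w : V) :
    ∑ y, ∑ a, phiContr g φ r (frame g a) (frame g y) w * φ (frame g a) x (frame g y) =
      2 * ric g r x w := by
  have hf := H.frame_spec
  have q := isQuadrilin_of_mem hr
  rw [← sub_eq_zero]
  refine hf.linear_ext H.bilin (L := fun x => ∑ y, ∑ a, phiContr g φ r (frame g a) (frame g y) w *
    φ (frame g a) x (frame g y) - 2 * ric g r x w) (isLinearMap_sub (isLinearMap_sum fun _ =>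
    isLinearMap_sum fun _ => isLinearMap_const_mul _ (H.phi_snd _ _))
    (isLinearMap_const_mul _ ((isBilin_ric g q).left w))) (fun i => ?_) x
  rw [sub_eq_zero]
  exact (H.isG2Array hf).ric_p7_left (fun i j y => r (frame g i) (frame g j) (frame g y) w)
    (fun _ _ _ => hr.2.2.1 _ _ _ _) (fun _ _ _ => hr.2.2.2.2 _ _ _ _) i

theorem trace_ricPhi {r : V → V → V → V → ℝ} (hr : r ∈ curvatureTensors V) :
    trace g (ricPhi g φ r) = -2 * scal g r := by
  have h1 (x : Fin 7) := H.sum_phiContr hr (frame g x) (frame g x)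
  have h2 : ∑ x, ∑ y, ∑ a, phiContr g φ r (frame g a) (frame g y) (frame g x) *
      φ (frame g a) (frame g x) (frame g y) = -trace g (ricPhi g φ r) := by
    simp only [trace, ricPhi_eq_phiContr, ← Finset.sum_neg_distrib]
    rw [Finset.sum_comm_cycle]
    refine Finset.sum_congr rfl fun a _ => ?_
    rw [Finset.sum_comm, inner₂, ← Finset.sum_neg_distrib]
    refine Finset.sum_congr rfl fun y _ => ?_
    rw [← Finset.sum_neg_distrib]
    refine Finset.sum_congr rfl fun x _ => ?_
    rw [H.phi_skew₂ _ (frame g x)]; ring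
  have h3 : ∑ x, 2 * ric g r (frame g x) (frame g x) = 2 * scal g r := by
    rw [scal, trace, Finset.mul_sum]
  rw [← Finset.sum_congr rfl fun x _ => h1 x, h2] at h3
  linarith

/-! ### The Ricci contractions of `𝒲₇₇` and `𝒲₆₄` vanish -/

theorem phi_mem_twoForms (u : V) : φ u ∈ twoForms V :=
  ⟨fun v => H.phi_snd u v, fun v w => H.phi_skew₂ u v w⟩

omit H in
theorem phiContr_eq_zero_of_mem {B : Set (V → V → ℝ)} {r : V → V → V → V → ℝ}
    (hB : B ⊆ lieG2 g φ) (hr : r ∈ symProd (lieG2 g φ) B) (u z w : V) :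
    phiContr g φ r u z w = 0 := by
  refine Submodule.span_induction (p := fun r _ => phiContr g φ r u z w = 0) ?_ ?_ ?_ ?_ hr
  · rintro _ ⟨α, hα, β, hβ, rfl⟩
    have e : (fun x y => α x y * β z w + β x y * α z w) = β z w • α + α z w • β := by
      funext x y; simp; ring
    rw [phiContr, e, inner₂_add_right, inner₂_smul_right, inner₂_smul_right, hα.2, (hB hβ).2]
    ring
  · simp [phiContr, inner₂]
  · intro a b _ _ ha hb
    have : (fun x y => (a + b) x y z w) = (fun x y => a x y z w) + fun x y => b x y z w := rfl
    rw [phiContr, this, inner₂_add_right]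
    exact (congrArg₂ (· + ·) ha hb).trans (add_zero 0)
  · intro c a _ ha
    have : (fun x y => (c • a) x y z w) = c • fun x y => a x y z w := rfl
    rw [phiContr, this, inner₂_smul_right]
    exact (congrArg (c * ·) ha).trans (mul_zero c)

theorem W77_le : W77 g φ ≤ weylTensors g := by
  rintro r ⟨hr, hs⟩
  refine ⟨hr, ?_⟩
  funext x w
  have := H.sum_phiContr hr x w
  simp only [phiContr_eq_zero_of_mem subset_rfl hs, zero_mul, Finset.sum_const_zero] at this
  simpa using this.symm

omit H in
theorem ricPhi_W77 {r : V → V → V → V → ℝ} (hr : r ∈ W77 g φ) : ricPhi g φ r = 0 := by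
  funext u v
  rw [ricPhi_eq_phiContr]
  simp [inner₂, phiContr_eq_zero_of_mem subset_rfl hr.2]

/-- On `𝔤₂ ⊙ 𝔤₂^⊥` the identity is `p₇ ⊗ 1 + 1 ⊗ p₇`. -/
theorem six_mul_of_mem_mixed {r : V → V → V → V → ℝ}
    (hr : r ∈ symProd (lieG2 g φ) (Set.range φ)) (x y z w : V) :
    6 * r x y z w = ∑ a, (phiContr g φ r (frame g a) z w * φ (frame g a) x y +
      phiContr g φ r (frame g a) x y * φ (frame g a) z w) := by
  refine Submodule.span_induction (p := fun r _ => 6 * r x y z w =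
    ∑ a, (phiContr g φ r (frame g a) z w * φ (frame g a) x y +
      phiContr g φ r (frame g a) x y * φ (frame g a) z w)) ?_ ?_ ?_ ?_ hr
  · rintro _ ⟨α, hα, _, ⟨u, rfl⟩, rfl⟩
    have e (a : Fin 7) (z w : V) : phiContr g φ (fun x y z w => α x y * φ u z w + φ u x y * α z w)
        (frame g a) z w = 6 * g (frame g a) u * α z w := by
      have e : (fun x y => α x y * φ u z w + φ u x y * α z w) = φ u z w • α + α z w • φ u := by
        funext x y; simp; ring
      rw [phiContr, e, inner₂_add_right, inner₂_smul_right, inner₂_smul_right, hα.2, H.inner₂_phi]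
      ring
    simp only [e, Finset.sum_add_distrib]
    have s (x y z w : V) : ∑ a, 6 * g (frame g a) u * α z w * φ (frame g a) x y =
        6 * α z w * φ u x y := by
      rw [← H.frame_spec.expand' H.bilin H.symm (H.phi_lin x y) u, Finset.mul_sum]
      exact Finset.sum_congr rfl fun a _ => by ring
    rw [s, s]; ring
  · simp [phiContr, inner₂]
  · intro a b _ _ ha hb
    have e (u z w : V) : phiContr g φ (a + b) u z w = phiContr g φ a u z w + phiContr g φ b u z w :=
      inner₂_add_right g (φ u) (fun x y => a x y z w) fun x y => b x y z w
    simp only [e, Pi.add_apply, mul_add]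
    rw [ha, hb, ← Finset.sum_add_distrib]
    exact Finset.sum_congr rfl fun _ _ => by ring
  · intro c a _ ha
    have e (u z w : V) : phiContr g φ (c • a) u z w = c * phiContr g φ a u z w :=
      inner₂_smul_right g c (φ u) fun x y => a x y z w
    simp only [e, Pi.smul_apply, smul_eq_mul]
    rw [mul_left_comm, ha, Finset.mul_sum]
    exact Finset.sum_congr rfl fun _ _ => by ring

/-- The contraction of `(1 ⊗ p₇) r` is the transpose of that of `(p₇ ⊗ 1) r`. -/
theorem sum_phiContr' {r : V → V → V → V → ℝ} (hr : r ∈ curvatureTensors V) (x w : V) :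
    ∑ y, ∑ a, phiContr g φ r (frame g a) x (frame g y) * φ (frame g a) (frame g y) w =
      2 * ric g r x w := by
  rw [ric_symm g hr, ← H.sum_phiContr hr w x]
  refine Finset.sum_congr rfl fun y _ => Finset.sum_congr rfl fun a _ => ?_
  have : phiContr g φ r (frame g a) x (frame g y) = -phiContr g φ r (frame g a) (frame g y) x := by
    simp only [phiContr, inner₂, hr.2.2.2.1 _ _ x, mul_neg, Finset.sum_neg_distrib]
  rw [this, H.phi_skew₂ _ w]; ring

theorem W64_le : W64 g φ ≤ weylTensors g := by
  rintro r ⟨hr, hs⟩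
  refine ⟨hr, ?_⟩
  funext x w
  have h : 6 * ric g r x w = 2 * ric g r x w + 2 * ric g r x w := by
    conv_rhs => rw [← H.sum_phiContr hr x w]
    rw [H.sum_phiContr hr x w]
    conv_rhs => enter [1]; rw [← H.sum_phiContr hr x w]
    conv_rhs => enter [2]; rw [← H.sum_phiContr' hr x w]
    rw [ric, Finset.mul_sum, ← Finset.sum_add_distrib]
    refine Finset.sum_congr rfl fun y _ => ?_
    rw [H.six_mul_of_mem_mixed hs, Finset.sum_add_distrib]
  have : ric g r x w = 0 := by linarith
  simpa using this

theorem ricPhi_W64 {r : V → V → V → V → ℝ} (hr : r ∈ W64 g φ) : ricPhi g φ r = 0 := by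
  refine Submodule.span_induction (p := fun r _ => ricPhi g φ r = 0) ?_ ?_ ?_ ?_ hr.2
  · rintro _ ⟨α, hα, _, ⟨u, rfl⟩, rfl⟩
    funext v w
    have e : phiContr g φ (fun x y z w => α x y * φ u z w + φ u x y * α z w) v =
        (6 * g v u) • α := by
      funext z w
      have e : (fun x y => α x y * φ u z w + φ u x y * α z w) = φ u z w • α + α z w • φ u := by
        funext x y; simp; ring
      rw [phiContr, e, inner₂_add_right, inner₂_smul_right, inner₂_smul_right, hα.2, H.inner₂_phi]
      simp; ring
    rw [ricPhi_eq_phiContr, e, inner₂_smul_right, hα.2]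
    simp
  · funext u v; simp [ricPhi_eq]
  · intro a b _ _ ha hb; rw [ricPhi_add, ha, hb, add_zero]
  · intro c a _ ha; rw [ricPhi_smul, ha, smul_zero]

/-! ### The projections to `𝔤₂` and `𝔤₂^⊥` -/

omit H in
theorem p7_eq_zero {α : V → V → ℝ} (hα : ∀ u, inner₂ g (φ u) α = 0) : p7 g φ α = 0 := by
  simp [p7, hα]

omit H in
theorem p7_sub (α β : V → V → ℝ) : p7 g φ (α - β) = p7 g φ α - p7 g φ β := by
  simp [p7, inner₂_sub_right, sub_smul, Finset.sum_sub_distrib, smul_sub]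

theorem p14_mem {α : V → V → ℝ} (hα : α ∈ twoForms V) : p14 g φ α ∈ lieG2 g φ := by
  refine ⟨Submodule.sub_mem _ hα (Submodule.smul_mem _ _ (Submodule.sum_mem _ fun a _ =>
    Submodule.smul_mem _ _ (H.phi_mem_twoForms _))), fun u => ?_⟩
  rw [p14, inner₂_sub_right, p7, inner₂_smul_right, inner₂_sum_right]
  have : ∑ a, inner₂ g (φ u) (inner₂ g (φ (frame g a)) α • φ (frame g a)) =
      6 * inner₂ g (φ u) α := by
    have hl : IsLinearMap ℝ fun u => inner₂ g (φ u) α := isLinearMap_sum fun _ =>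
      isLinearMap_sum fun _ => isLinearMap_mul_const _ (H.phi_lin _ _)
    rw [← H.frame_spec.expand' H.bilin H.symm hl u, Finset.mul_sum]
    refine Finset.sum_congr rfl fun a _ => ?_
    rw [inner₂_smul_right, H.inner₂_phi, H.symm u]; ring
  rw [this]; ring

/-- The forms `p₁₄(eⁱ ∧ eʲ) / 2`, which span `𝔤₂`. -/
theorem exists_lieG2_span : ∃ τ : Fin 7 → Fin 7 → V → V → ℝ, (∀ i j, τ i j ∈ lieG2 g φ) ∧
    ∀ α ∈ lieG2 g φ, ∀ x y, α x y = ∑ i, ∑ j, α (frame g i) (frame g j) * τ i j x y := by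
  have hf := H.frame_spec
  let ε : Fin 7 → Fin 7 → V → V → ℝ := fun i j x y =>
    1 / 2 * (g x (frame g i) * g y (frame g j) - g x (frame g j) * g y (frame g i))
  have hε (i j) : ε i j ∈ twoForms V :=
    ⟨fun v => isLinearMap_const_mul _ (isLinearMap_sub (isLinearMap_mul_const _ (H.bilin.left _))
      (isLinearMap_mul_const _ (H.bilin.left _))), fun u v => by simp only [ε]; ring⟩
  refine ⟨fun i j => p14 g φ (ε i j), fun i j => H.p14_mem (hε i j), fun α hα => ?_⟩
  have hb : IsBilin α := isBilin_of_skew hα.1.1 hα.1.2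
  have e1 : α = ∑ i, ∑ j, α (frame g i) (frame g j) • ε i j := by
    funext x y
    have e : α x y = ∑ i, ∑ j, α (frame g i) (frame g j) * (g x (frame g i) * g y (frame g j)) := by
      rw [hf.expand H.bilin (hb.left y) x]
      refine Finset.sum_congr rfl fun i _ => ?_
      rw [hf.expand H.bilin (hb.right (frame g i)) y, Finset.mul_sum]
      exact Finset.sum_congr rfl fun j _ => by ring
    have e' : α x y = -∑ i, ∑ j, α (frame g i) (frame g j) *
        (g x (frame g j) * g y (frame g i)) := by
      rw [e, Finset.sum_comm, ← Finset.sum_neg_distrib]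
      refine Finset.sum_congr rfl fun i _ => ?_
      rw [← Finset.sum_neg_distrib]
      exact Finset.sum_congr rfl fun j _ => by rw [hα.1.2]; ring
    have e2 : α x y = 1 / 2 * (α x y + α x y) := by ring
    rw [e2]
    conv_lhs => enter [2, 1]; rw [e]
    conv_lhs => enter [2, 2]; rw [e']
    simp only [Finset.sum_apply, Pi.smul_apply, smul_eq_mul, ε, ← sub_eq_add_neg,
      ← Finset.sum_sub_distrib, Finset.mul_sum]
    exact Finset.sum_congr rfl fun i _ => Finset.sum_congr rfl fun j _ => by ring
  have e2 : p7 g φ α = ∑ i, ∑ j, α (frame g i) (frame g j) • p7 g φ (ε i j) := by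
    conv_lhs => rw [e1]
    simp only [p7, inner₂_sum_right, inner₂_smul_right, Finset.sum_smul, Finset.smul_sum, smul_smul]
    rw [Finset.sum_comm]
    refine Finset.sum_congr rfl fun i _ => ?_
    rw [Finset.sum_comm]
    exact Finset.sum_congr rfl fun j _ => Finset.sum_congr rfl fun a _ => by
      rw [mul_left_comm]
  intro x y
  have e3 : α x y = (α - p7 g φ α) x y := by rw [p7_eq_zero hα.2, sub_zero]
  have e4 := congrArg₂ (· - ·) e1 e2
  rw [e3, e4]
  simp only [Pi.sub_apply, Finset.sum_apply, Pi.smul_apply, smul_eq_mul, ← Finset.sum_sub_distrib,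
    p14, mul_sub]

/-- A tensor with the symmetries of `S²(Λ²)`, both of whose factors are in `𝔤₂`, is in `S²(𝔤₂)`. -/
theorem mem_symProd_lieG2 {r : V → V → V → V → ℝ} (hp : ∀ x y z w, r x y z w = r z w x y)
    (hr : ∀ z w, (fun x y => r x y z w) ∈ lieG2 g φ) : r ∈ symProd (lieG2 g φ) (lieG2 g φ) := by
  obtain ⟨τ, hτ, he⟩ := H.exists_lieG2_span
  have e (x y z w : V) : r x y z w = ∑ i, ∑ j, ∑ k, ∑ l,
      r (frame g i) (frame g j) (frame g k) (frame g l) * (τ i j x y * τ k l z w) := by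
    rw [he _ (hr z w) x y]
    refine Finset.sum_congr rfl fun i _ => Finset.sum_congr rfl fun j _ => ?_
    rw [hp, he _ (hr _ _) z w, Finset.sum_mul]
    refine Finset.sum_congr rfl fun k _ => ?_
    rw [Finset.sum_mul]
    exact Finset.sum_congr rfl fun l _ => by rw [hp]; ring
  have e' : r = ∑ i, ∑ j, ∑ k, ∑ l,
      (1 / 2 * r (frame g i) (frame g j) (frame g k) (frame g l)) •
        fun x y z w => τ i j x y * τ k l z w + τ k l x y * τ i j z w := by
    funext x y z w
    have e2 : r x y z w = 1 / 2 * (r x y z w + r z w x y) := by rw [← hp]; ring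
    rw [e2]
    conv_lhs => enter [2, 1]; rw [e]
    conv_lhs => enter [2, 2]; rw [e]
    simp only [Finset.sum_apply, Pi.smul_apply, smul_eq_mul, ← Finset.sum_add_distrib,
      Finset.mul_sum]
    exact Finset.sum_congr rfl fun i _ => Finset.sum_congr rfl fun j _ =>
      Finset.sum_congr rfl fun k _ => Finset.sum_congr rfl fun l _ => by ring
  rw [e']
  exact Submodule.sum_mem _ fun i _ => Submodule.sum_mem _ fun j _ => Submodule.sum_mem _ fun k _ =>
    Submodule.sum_mem _ fun l _ => Submodule.smul_mem _ _
      (Submodule.subset_span ⟨_, hτ i j, _, hτ k l, rfl⟩)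

end IsG2Space

end Splitting

section Splitting

variable {V : Type*} [AddCommGroup V] [Module ℝ V]

/-! ### Weyl tensors with vanishing `φ`-Ricci contraction -/

/-- The contraction of the Bianchi map with an alternating array on the first three indices. -/
theorem IsG2Array.psi_contr_cyc {φ : Fin 7 → Fin 7 → Fin 7 → ℝ}
    {ψ : Fin 7 → Fin 7 → Fin 7 → Fin 7 → ℝ} (A : IsG2Array φ ψ) (q : Fin 7 → Fin 7 → Fin 7 → ℝ)
    (i : Fin 7) : ∑ j, ∑ k, ∑ l, ψ i j k l * (q j k l + q k l j + q l j k) =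
      3 * ∑ l, ∑ j, ∑ k, ψ i l j k * q j k l := by
  have hc (y i j x : Fin 7) : ψ x y i j = ψ x i j y := by
    rw [A.psi_skew₂, A.psi_skew₃, neg_neg]
  have e1 : ∑ j, ∑ k, ∑ l, ψ i j k l * q j k l = ∑ l, ∑ j, ∑ k, ψ i l j k * q j k l := by
    rw [Finset.sum_comm_cycle]
    exact Finset.sum_congr rfl fun l _ => Finset.sum_congr rfl fun j _ =>
      Finset.sum_congr rfl fun k _ => by rw [hc l j k]
  have e2 : ∑ j, ∑ k, ∑ l, ψ i j k l * q k l j = ∑ l, ∑ j, ∑ k, ψ i l j k * q j k l := rfl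
  have e3 : ∑ j, ∑ k, ∑ l, ψ i j k l * q l j k = ∑ l, ∑ j, ∑ k, ψ i l j k * q j k l := by
    rw [← Finset.sum_comm_cycle]
    rw [← e1]
    rw [Finset.sum_comm_cycle]
    rw [Finset.sum_comm_cycle]
    exact Finset.sum_congr rfl fun l _ => Finset.sum_congr rfl fun j _ =>
      Finset.sum_congr rfl fun k _ => by rw [hc l j k]
  simp only [mul_add, Finset.sum_add_distrib]
  rw [e1, e2, e3]; ring

/-- The tensor `(p₇ ⊗ 1 + 1 ⊗ p₇) r`, for `r` symmetric in pairs. -/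
noncomputable def mixedPart (g : V → V → ℝ) (φ : V → V → V → ℝ) (r : V → V → V → V → ℝ) :
    V → V → V → V → ℝ :=
  fun x y z w => 1 / 6 * ∑ a, (phiContr g φ r (frame g a) x y * φ (frame g a) z w +
    φ (frame g a) x y * phiContr g φ r (frame g a) z w)

namespace IsG2Space

variable {g : V → V → ℝ} {φ : V → V → V → ℝ} (H : IsG2Space g φ)

include H

omit H in
theorem inner₂_phiContr {r : V → V → V → V → ℝ} (hφ : ricPhi g φ r = 0) (u v : V) :
    inner₂ g (φ u) (phiContr g φ r v) = 0 := by
  rw [← ricPhi_eq_phiContr, hφ]; rfl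

omit H in
theorem phiContr_mem {r : V → V → V → V → ℝ} (hr : r ∈ curvatureTensors V)
    (hφ : ricPhi g φ r = 0) (u : V) : phiContr g φ r u ∈ lieG2 g φ := by
  refine ⟨⟨(isBilin_phiContr g φ (isQuadrilin_of_mem hr) u).left, fun z w => ?_⟩,
    fun v => inner₂_phiContr hφ v u⟩
  simp only [phiContr, inner₂, hr.2.2.2.1 _ _ z w, mul_neg, Finset.sum_neg_distrib]

omit H in
theorem mixedPart_mem_symProd {r : V → V → V → V → ℝ} (hr : r ∈ curvatureTensors V)
    (hφ : ricPhi g φ r = 0) : mixedPart g φ r ∈ symProd (lieG2 g φ) (Set.range φ) := by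
  have : mixedPart g φ r = (1 / 6 : ℝ) • ∑ a, fun x y z w =>
      phiContr g φ r (frame g a) x y * φ (frame g a) z w +
        φ (frame g a) x y * phiContr g φ r (frame g a) z w := by
    funext x y z w
    simp [mixedPart, Finset.sum_apply]
  rw [this]
  exact Submodule.smul_mem _ _ (Submodule.sum_mem _ fun a _ =>
    Submodule.subset_span ⟨_, phiContr_mem hr hφ _, _, ⟨_, rfl⟩, rfl⟩)

theorem phiContr_mixedPart {r : V → V → V → V → ℝ} (hφ : ricPhi g φ r = 0) (u : V) :
    phiContr g φ (mixedPart g φ r) u = phiContr g φ r u := by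
  funext z w
  have e : (fun x y => mixedPart g φ r x y z w) = (1 / 6 : ℝ) • ∑ a,
      (φ (frame g a) z w • phiContr g φ r (frame g a) +
        phiContr g φ r (frame g a) z w • φ (frame g a)) := by
    funext x y
    simp only [mixedPart, Pi.smul_apply, Finset.sum_apply, Pi.add_apply, smul_eq_mul]
    congr 1
    exact Finset.sum_congr rfl fun a _ => by ring
  rw [phiContr, e, inner₂_smul_right, inner₂_sum_right]
  simp only [inner₂_add_right, inner₂_smul_right, inner₂_phiContr hφ, H.inner₂_phi]
  have hl : IsLinearMap ℝ fun u => phiContr g φ r u z w := by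
    simp only [phiContr, inner₂]
    exact isLinearMap_sum fun _ => isLinearMap_sum fun _ => isLinearMap_mul_const _ (H.phi_lin _ _)
  rw [← H.frame_spec.expand' H.bilin H.symm hl u, Finset.mul_sum]
  exact Finset.sum_congr rfl fun a _ => by rw [H.symm u]; ring

/-- For a Weyl tensor `r` with vanishing `φ`-Ricci contraction, `(p₇ ⊗ 1 + 1 ⊗ p₇) r` satisfies the
Bianchi identity: its Bianchi image is a four-form whose contraction with `ψ` is a combination
of the Ricci contractions of `(p₇ ⊗ 1) r` and `(1 ⊗ p₇) r`, which both vanish. -/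
theorem mixedPart_mem {r : V → V → V → V → ℝ} (hr : r ∈ weylTensors g)
    (hφ : ricPhi g φ r = 0) : mixedPart g φ r ∈ W64 g φ := by
  have hf := H.frame_spec
  have A := H.isG2Array hf
  have hs := mixedPart_mem_symProd hr.1 hφ
  have hp : ∀ x y z w, mixedPart g φ r x y z w = mixedPart g φ r z w x y := mem_symProd_swap hs
  have hk (u z w) : phiContr g φ r u z w = -phiContr g φ r u w z :=
    (phiContr_mem hr.1 hφ u).1.2 z w
  have hb (u) := isBilin_phiContr g φ (isQuadrilin_of_mem hr.1) u
  have q : IsQuadrilin (mixedPart g φ r) := by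
    constructor <;> intros <;> refine isLinearMap_const_mul _ (isLinearMap_sum fun a =>
      isLinearMap_add ?_ ?_)
    · exact isLinearMap_mul_const _ ((hb _).left _)
    · exact isLinearMap_mul_const _ (H.phi_snd _ _)
    · exact isLinearMap_mul_const _ ((hb _).right _)
    · exact isLinearMap_mul_const _ (H.phi_trd _ _)
    · exact isLinearMap_const_mul _ (H.phi_snd _ _)
    · exact isLinearMap_const_mul _ ((hb _).left _)
    · exact isLinearMap_const_mul _ (H.phi_trd _ _)
    · exact isLinearMap_const_mul _ ((hb _).right _)
  have h₁ (x y z w) : mixedPart g φ r x y z w = -mixedPart g φ r y x z w := by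
    simp only [mixedPart, hk _ x y, H.phi_skew₂ _ x y, neg_mul, ← neg_add, Finset.sum_neg_distrib,
      mul_neg]
  have h₃ (x y z w) : mixedPart g φ r x y z w = -mixedPart g φ r x y w z := by
    rw [hp, h₁, hp]
  refine ⟨⟨q.fst, q.trd, h₁, h₃, ?_⟩, hs⟩
  suffices bianchi (mixedPart g φ r) = 0 from fun x y z w =>
    congrFun (congrFun (congrFun (congrFun this x) y) z) w
  refine H.four_form_eq_zero hf (isQuadrilin_bianchi q) (bianchi_skew₁ h₁) (bianchi_skew₂ h₁)
    (bianchi_skew₃ h₁ h₃ hp) fun i m => ?_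
  have e1 := A.psi_contr_cyc (fun j k l =>
    mixedPart g φ r (frame g j) (frame g k) (frame g l) (frame g m)) i
  refine e1.trans ?_
  have e2 (l : Fin 7) := A.six_p7 (fun j k =>
    mixedPart g φ r (frame g j) (frame g k) (frame g l) (frame g m)) (fun _ _ => h₁ _ _ _ _) i l
  have e3 (a l : Fin 7) : ∑ j, ∑ k, φ (frame g a) (frame g j) (frame g k) *
      mixedPart g φ r (frame g j) (frame g k) (frame g l) (frame g m) =
      phiContr g φ r (frame g a) (frame g l) (frame g m) :=
    congrFun (congrFun (H.phiContr_mixedPart hφ (frame g a)) (frame g l)) (frame g m)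
  have e4 : ∑ l, mixedPart g φ r (frame g i) (frame g l) (frame g l) (frame g m) = 0 := by
    simp only [mixedPart, ← Finset.mul_sum, Finset.sum_add_distrib]
    rw [H.sum_phiContr' hr.1]
    have := H.sum_phiContr hr.1 (frame g i) (frame g m)
    simp only [mul_comm (phiContr _ _ _ _ _ _)] at this
    rw [this, hr.2]
    simp
  simp only [e3] at e2
  have e5 := Finset.sum_congr rfl fun l (_ : l ∈ Finset.univ) => e2 l
  rw [Finset.sum_add_distrib, H.sum_phiContr hr.1, ← Finset.mul_sum, e4, hr.2] at e5
  simp at e5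
  rw [← e5, mul_zero]

theorem sub_mixedPart_mem {r : V → V → V → V → ℝ} (hr : r ∈ weylTensors g)
    (hφ : ricPhi g φ r = 0) : r - mixedPart g φ r ∈ W77 g φ := by
  have hm := H.mixedPart_mem hr hφ
  have hk := Submodule.sub_mem _ hr.1 hm.1
  refine ⟨hk, H.mem_symProd_lieG2 (pair_symm hk) fun z w =>
    ⟨⟨fun y => hk.1 y z w, fun x y => hk.2.2.1 x y z w⟩, fun u => ?_⟩⟩
  have e : (fun x y => (r - mixedPart g φ r) x y z w) =
      (fun x y => r x y z w) - fun x y => mixedPart g φ r x y z w := rfl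
  rw [e, inner₂_sub_right]
  exact sub_eq_zero.2 (congrFun (congrFun (H.phiContr_mixedPart hφ u) z) w).symm

omit H in
/-- For `φ`-Ricci flat `r` the component `(p₇ ⊗ p₇) r` vanishes, so the mixed projection is
`p₇ ⊗ 1 + 1 ⊗ p₇`. -/
theorem projections_eq {r : V → V → V → V → ℝ} (hr : r ∈ curvatureTensors V)
    (hφ : ricPhi g φ r = 0) : projMixed g φ r = mixedPart g φ r ∧
      projG2 g φ r = r - mixedPart g φ r := by
  -- `β z w` is the first factor of `(1 ⊗ p₇) r`.
  let β : V → V → V → V → ℝ := fun z w => (1 / 6 : ℝ) • ∑ a,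
    φ (frame g a) z w • phiContr g φ r (frame g a)
  have b1 (x y z w : V) : p7 g φ (fun z' w' => r x y z' w') z w = β z w x y := by
    simp only [p7, β, phiContr_swap g φ (pair_symm hr), Pi.smul_apply, Finset.sum_apply,
      smul_eq_mul]
    congr 1
    exact Finset.sum_congr rfl fun a _ => mul_comm _ _
  have b2 (z w : V) : p7 g φ (β z w) = 0 := by
    refine p7_eq_zero fun u => ?_
    simp [β, inner₂_smul_right, inner₂_sum_right, inner₂_phiContr hφ]
  have b3 (x y z w : V) : p7 g φ (fun x' y' => r x' y' z w) x y = β x y z w := by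
    simp only [p7, β, Pi.smul_apply, Finset.sum_apply, smul_eq_mul]
    congr 1
    exact Finset.sum_congr rfl fun a _ => mul_comm _ _
  have b4 (x y z w : V) : mixedPart g φ r x y z w = β z w x y + β x y z w := by
    simp only [mixedPart, β, Pi.smul_apply, Finset.sum_apply, smul_eq_mul, ← mul_add,
      ← Finset.sum_add_distrib]
    congr 1
    exact Finset.sum_congr rfl fun a _ => by ring
  have c1 (z w : V) : (fun x y => p7 g φ (fun z' w' => r x y z' w') z w) = β z w := by
    funext x y; exact b1 x y z w
  have c2 (z w : V) : (fun x y => p14 g φ (fun z' w' => r x y z' w') z w) =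
      (fun x y => r x y z w) - β z w := by
    funext x y; simp only [p14, Pi.sub_apply, b1]
  constructor
  · funext x y z w
    simp only [projMixed, onPairs, Pi.add_apply, c1, c2]
    simp only [p7_sub, b2, p14, sub_zero, b3, b4]
  · funext x y z w
    simp only [projG2, onPairs, c2]
    simp only [p14, p7_sub, b2, sub_zero, Pi.sub_apply, b3, b4]
    ring

/-! ### The component `𝒲₂₇` -/

/-- The component in `𝒲₂₇` of a curvature tensor with W-Ricci tensor `h`. -/
noncomputable def _root_.G2.weyl27 (g : V → V → ℝ) (φ : V → V → V → ℝ) (h : V → V → ℝ) :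
    V → V → V → V → ℝ :=
  (3 / 112 : ℝ) • (rg g h - (5 : ℝ) • rphi g φ h)

theorem weyl27_mem_weyl {h : V → V → ℝ} (hh : IsBilin h) (hs : ∀ u v, h u v = h v u)
    (ht : trace g h = 0) : weyl27 g φ h ∈ weylTensors g := by
  refine ⟨Submodule.smul_mem _ _ (Submodule.sub_mem _ (H.rg_mem hh hs)
    (Submodule.smul_mem _ _ (H.rphi_mem hs))), ?_⟩
  rw [weyl27, ric_smul, ric_sub, ric_smul, H.ric_rg hh, H.ric_rphi hh hs, ht]
  simp

theorem ricPhi_weyl27 {h : V → V → ℝ} (hh : IsBilin h) (hs : ∀ u v, h u v = h v u)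
    (ht : trace g h = 0) : ricPhi g φ (weyl27 g φ h) = (-4 : ℝ) • h := by
  rw [weyl27, ricPhi_smul, ricPhi_sub, ricPhi_smul, H.ricPhi_rg hh hs, H.ricPhi_rphi hh hs ht, ht]
  ext u v
  simp
  ring

theorem inner₄_weyl27 (h : V → V → ℝ) {t : V → V → V → V → ℝ} (ht : t ∈ curvatureTensors V) :
    inner₄ g (weyl27 g φ h) t =
      3 / 28 * inner₂ g h (ric g t) - 15 / 112 * inner₂ g h (ricPhi g φ t) := by
  rw [weyl27, inner₄_smul_left, inner₄_sub_left, inner₄_smul_left, H.inner₄_rg h ht,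
    inner₄_rphi h ht]
  ring

omit H in
theorem inner₂_zero (a : V → V → ℝ) : inner₂ g a 0 = 0 := by simp [inner₂]

theorem weyl27_mem {h : V → V → ℝ} (hh : IsBilin h) (hs : ∀ u v, h u v = h v u)
    (ht : trace g h = 0) : weyl27 g φ h ∈ W27 g φ := by
  refine ⟨H.weyl27_mem_weyl hh hs ht, fun t h' => ?_⟩
  obtain ⟨a, ha, b, hb, rfl⟩ := Submodule.mem_sup.1 h'
  rw [inner₄_add_right, H.inner₄_weyl27 h ha.1, H.inner₄_weyl27 h hb.1, (H.W77_le ha).2,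
    (H.W64_le hb).2, ricPhi_W77 ha, H.ricPhi_W64 hb, inner₂_zero]
  ring

theorem inner₄_weyl27_self {h : V → V → ℝ} (hh : IsBilin h) (hs : ∀ u v, h u v = h v u)
    (ht : trace g h = 0) : inner₄ g (weyl27 g φ h) (weyl27 g φ h) = 15 / 28 * inner₂ g h h := by
  have hm := H.weyl27_mem_weyl hh hs ht
  rw [H.inner₄_weyl27 h hm.1, hm.2, H.ricPhi_weyl27 hh hs ht, inner₂_zero, inner₂_smul_right]
  ring

end IsG2Space

end Splitting

section Main

variable {V : Type*} [AddCommGroup V] [Module ℝ V]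

/-! ### Orthogonality and the projections -/

theorem Perp.symm {g : V → V → ℝ} {A B : Submodule ℝ (V → V → V → V → ℝ)} (h : Perp g A B) :
    Perp g B A :=
  fun b hb a ha => by rw [inner₄_comm, h a ha b hb]

theorem perp_span {g : V → V → ℝ} {A : Submodule ℝ (V → V → V → V → ℝ)}
    {s : Set (V → V → V → V → ℝ)} (h : ∀ a ∈ A, ∀ b ∈ s, inner₄ g a b = 0) :
    Perp g A (Submodule.span ℝ s) := by
  intro a ha b hb
  refine Submodule.span_induction (p := fun b _ => inner₄ g a b = 0) (h a ha) ?_ ?_ ?_ hb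
  · rw [inner₄_comm, inner₄_zero_left]
  · intro x y _ _ hx hy; rw [inner₄_add_right, hx, hy, add_zero]
  · intro c x _ hx; rw [inner₄_smul_right, hx, mul_zero]

theorem inner₄_tensor (g : V → V → ℝ) (t : V → V → V → V → ℝ) (α β : V → V → ℝ) :
    inner₄ g t (fun x y z w => α x y * β z w) =
      inner₂ g β fun z w => inner₂ g α fun x y => t x y z w := by
  simp only [inner₄, inner₂, Finset.mul_sum]
  symm
  rw [Finset.sum_comm_cycle]
  refine Finset.sum_congr rfl fun k _ => ?_
  rw [Finset.sum_comm_cycle]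
  exact Finset.sum_congr rfl fun l _ => Finset.sum_congr rfl fun i _ =>
    Finset.sum_congr rfl fun j _ => by ring

theorem inner₄_tensor' (g : V → V → ℝ) (t : V → V → V → V → ℝ) (α β : V → V → ℝ) :
    inner₄ g t (fun x y z w => α x y * β z w) =
      inner₂ g α fun x y => inner₂ g β fun z w => t x y z w := by
  simp only [inner₄, inner₂, Finset.mul_sum]
  exact Finset.sum_congr rfl fun l _ => Finset.sum_congr rfl fun i _ =>
    Finset.sum_congr rfl fun k _ => Finset.sum_congr rfl fun j _ => by ring

theorem inner₂_metric (g h : V → V → ℝ) (hf : IsOrthonormalFrame g (frame g)) :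
    inner₂ g g h = trace g h := by
  simp [inner₂, hf.1, trace]

theorem inner₄_add_self {g : V → V → ℝ} {a b : V → V → V → V → ℝ} (h : inner₄ g a b = 0) :
    inner₄ g (a + b) (a + b) = inner₄ g a a + inner₄ g b b := by
  rw [inner₄_add_left, inner₄_add_right, inner₄_add_right, inner₄_comm g b a, h]; ring

namespace IsG2Space

variable {g : V → V → ℝ} {φ : V → V → V → ℝ} (H : IsG2Space g φ)

include H

/-- The orthogonal projection to a space of curvature tensors is unique. -/
theorem orthProj_eq {U : Submodule ℝ (V → V → V → V → ℝ)} (hU : U ≤ curvatureTensors V)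
    {r p : V → V → V → V → ℝ} (h : IsOrthProj g U r p) : orthProj g U r = p := by
  have h' : IsOrthProj g U r (orthProj g U r) := Classical.epsilon_spec ⟨p, h⟩
  set p' := orthProj g U r
  have hm := Submodule.sub_mem _ h'.1 h.1
  refine sub_eq_zero.1 (H.eq_zero_of_inner₄ (isQuadrilin_of_mem (hU hm)) ?_)
  have e : p' - p = (r - p) - (r - p') := by abel
  conv_lhs => enter [2]; rw [e]
  rw [inner₄_sub_left, h.2 _ hm, h'.2 _ hm, sub_zero]

theorem perp_rg {t : V → V → V → V → ℝ} (ht : t ∈ weylTensors g) (h : V → V → ℝ) :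
    inner₄ g t (rg g h) = 0 := by
  rw [inner₄_comm, H.inner₄_rg h ht.1, ht.2, inner₂_zero, mul_zero]

omit H in
theorem perp_W77_W64 : Perp g (W77 g φ) (W64 g φ) := by
  intro t ht s hs
  refine perp_span (A := W77 g φ) ?_ t ht s hs.2
  rintro t ht _ ⟨α, -, _, ⟨u, rfl⟩, rfl⟩
  have e : (fun x y z w => α x y * φ u z w + φ u x y * α z w) =
      (fun x y z w => α x y * φ u z w) + fun x y z w => φ u x y * α z w := rfl
  have z (z w : V) : phiContr g φ t u z w = 0 := phiContr_eq_zero_of_mem subset_rfl ht.2 u z w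
  rw [e, inner₄_add_right, inner₄_tensor', inner₄_tensor]
  simp only [phiContr_swap g φ (pair_symm ht.1)]
  have e2 : (fun z w => inner₂ g (φ u) fun x y => t x y z w) = phiContr g φ t u := rfl
  rw [e2]
  simp [inner₂, z]

omit H in
theorem perp_W77_W27 : Perp g (W77 g φ) (W27 g φ) := fun t ht s hs => by
  rw [inner₄_comm]; exact hs.2 t (Submodule.mem_sup_left ht)

omit H in
theorem perp_W64_W27 : Perp g (W64 g φ) (W27 g φ) := fun t ht s hs => by
  rw [inner₄_comm]; exact hs.2 t (Submodule.mem_sup_right ht)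

theorem perp_weyl_R0 : Perp g (weylTensors g) (R0 g) :=
  perp_span fun _ ha _ ⟨h, _, e⟩ => e ▸ H.perp_rg ha h

theorem perp_weyl_S : Perp g (weylTensors g) (S g) :=
  perp_span fun _ ha _ e => (Set.mem_singleton_iff.1 e) ▸ H.perp_rg ha g

omit H in
theorem isBilin_of_tracelessSymm {h : V → V → ℝ} (hh : IsTracelessSymm g h) : IsBilin h :=
  isBilin_of_symm hh.1 hh.2.1

theorem perp_R0_S : Perp g (R0 g) (S g) := by
  refine (perp_span (A := S g) ?_).symm
  rintro a ha _ ⟨h, hh, rfl⟩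
  obtain ⟨c, rfl⟩ := Submodule.mem_span_singleton.1 ha
  have hb := isBilin_of_tracelessSymm hh
  rw [inner₄_smul_left, H.inner₄_rg g (H.rg_mem hb hh.2.1), H.ric_rg hb, hh.2.2, zero_smul,
    zero_add, inner₂_smul_right, inner₂_metric g h H.frame_spec, hh.2.2]
  ring

omit H in
theorem W27_le : W27 g φ ≤ weylTensors g := fun _ h => h.1

omit H in
theorem weyl_le : weylTensors g ≤ curvatureTensors V := fun _ h => h.1

theorem R0_le : R0 g ≤ curvatureTensors V :=
  Submodule.span_le.2 fun _ ⟨_, hh, e⟩ => e ▸ H.rg_mem (isBilin_of_tracelessSymm hh) hh.2.1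

theorem S_le : S g ≤ curvatureTensors V :=
  Submodule.span_le.2 fun _ e => (Set.mem_singleton_iff.1 e) ▸ H.rg_mem H.bilin H.symm

theorem ric_rg_metric : ric g (rg g g) = (12 : ℝ) • g := by
  rw [H.ric_rg H.bilin, H.trace_self, ← add_smul]; norm_num

theorem ricW_bilin {r : V → V → V → V → ℝ} (hr : r ∈ curvatureTensors V) :
    IsBilin (ricW g φ r) := by
  have h1 := H.traceless_bilin (isBilin_ric g (isQuadrilin_of_mem hr))
  have h2 := H.traceless_bilin (H.isBilin_ricPhi r)
  exact ⟨fun v => isLinearMap_const_mul _ (isLinearMap_sub (isLinearMap_const_mul _ (h1.left v))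
    (isLinearMap_const_mul _ (h2.left v))), fun v => isLinearMap_const_mul _ (isLinearMap_sub
    (isLinearMap_const_mul _ (h1.right v)) (isLinearMap_const_mul _ (h2.right v)))⟩

theorem ricW_symm {r : V → V → V → V → ℝ} (hr : r ∈ curvatureTensors V) (u v : V) :
    ricW g φ r u v = ricW g φ r v u := by
  simp only [ricW, Pi.smul_apply, Pi.sub_apply, H.traceless_symm (ric_symm g hr) u v,
    H.traceless_symm (ricPhi_symm hr) u v]

theorem trace_ricW (r : V → V → V → V → ℝ) : trace g (ricW g φ r) = 0 := by
  rw [ricW, trace_smul, trace_sub, trace_smul, trace_smul, H.trace_traceless, H.trace_traceless]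
  ring

omit H in
theorem scal_mem {r : V → V → V → V → ℝ} : (1 / 84 * scal g r) • rg g g ∈ S g :=
  Submodule.smul_mem _ _ (Submodule.subset_span rfl)

theorem ric0_mem {r : V → V → V → V → ℝ} (hr : r ∈ curvatureTensors V) :
    (1 / 5 : ℝ) • rg g (traceless g (ric g r)) ∈ R0 g :=
  Submodule.smul_mem _ _ (Submodule.subset_span
    ⟨_, ⟨(H.traceless_bilin (isBilin_ric g (isQuadrilin_of_mem hr))).left,
      H.traceless_symm (ric_symm g hr), H.trace_traceless _⟩, rfl⟩)

/-- Removing the Ricci part from a curvature tensor leaves a Weyl tensor, whose `φ`-Ricci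
contraction is `-4` times the W-Ricci tensor. -/
theorem weyl_part {r : V → V → V → V → ℝ} (hr : r ∈ curvatureTensors V) :
    r - (1 / 84 * scal g r) • rg g g - (1 / 5 : ℝ) • rg g (traceless g (ric g r)) ∈
      weylTensors g ∧
    ricPhi g φ (r - (1 / 84 * scal g r) • rg g g - (1 / 5 : ℝ) • rg g (traceless g (ric g r))) =
      (-4 : ℝ) • ricW g φ r := by
  have hb := H.traceless_bilin (isBilin_ric g (isQuadrilin_of_mem hr))
  refine ⟨⟨Submodule.sub_mem _ (Submodule.sub_mem _ hr (H.S_le scal_mem))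
    (H.R0_le (H.ric0_mem hr)), ?_⟩, ?_⟩
  · rw [ric_sub, ric_sub, ric_smul, ric_smul, H.ric_rg_metric, H.ric_rg hb, H.trace_traceless]
    ext u v
    simp only [traceless, scal, Pi.sub_apply, Pi.smul_apply, Pi.add_apply, smul_eq_mul,
      Pi.zero_apply]
    ring
  · rw [ricPhi_sub, ricPhi_sub, ricPhi_smul, ricPhi_smul, H.ricPhi_rg H.bilin H.symm,
      H.ricPhi_rg hb (H.traceless_symm (ric_symm g hr)), H.trace_traceless, H.trace_self, ricW]
    ext u v
    simp only [traceless, H.trace_ricPhi hr, scal, Pi.sub_apply, Pi.smul_apply,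
      smul_eq_mul]
    ring

/-- The decomposition of the space of algebraic curvature tensors, together with the explicit
form of the components. -/
theorem splitting :
    curvatureTensors V = W77 g φ ⊔ W64 g φ ⊔ W27 g φ ⊔ R0 g ⊔ S g ∧
    [W77 g φ, W64 g φ, W27 g φ, R0 g, S g].Pairwise (Perp g) ∧
    weylTensors g = W77 g φ ⊔ W64 g φ ⊔ W27 g φ ∧
    ∀ r ∈ curvatureTensors V,
      let Ric₀ := traceless g (ric g r)
      let RicW := ricW g φ r
      let s := scal g r
      let W := orthProj g (weylTensors g) r
      let W₇₇ := orthProj g (W77 g φ) r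
      let W₆₄ := orthProj g (W64 g φ) r
      let W₂₇ := orthProj g (W27 g φ) r
      IsOrthProj g (S g) r ((1 / 84 * s) • rg g g) ∧
      IsOrthProj g (R0 g) r ((1 / 5 : ℝ) • rg g Ric₀) ∧
      IsOrthProj g (W27 g φ) r ((3 / 112 : ℝ) • (rg g RicW - (5 : ℝ) • rphi g φ RicW)) ∧
      IsOrthProj g (W64 g φ) r (projMixed g φ (W - W₂₇)) ∧
      IsOrthProj g (W77 g φ) r (projG2 g φ (W - W₂₇)) ∧
      (W₂₇ = 0 ↔ RicW = 0) ∧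
      inner₄ g r r = inner₄ g W₇₇ W₇₇ + inner₄ g W₆₄ W₆₄ +
        15 / 28 * inner₂ g RicW RicW + 4 / 5 * inner₂ g Ric₀ Ric₀ + 1 / 21 * s ^ 2 := by
  have p76 := perp_W77_W64 (g := g) (φ := φ)
  have p72 : Perp g (W77 g φ) (W27 g φ) := perp_W77_W27
  have p62 : Perp g (W64 g φ) (W27 g φ) := perp_W64_W27
  have p7R : Perp g (W77 g φ) (R0 g) := fun a ha => H.perp_weyl_R0 a (H.W77_le ha)
  have p6R : Perp g (W64 g φ) (R0 g) := fun a ha => H.perp_weyl_R0 a (H.W64_le ha)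
  have p2R : Perp g (W27 g φ) (R0 g) := fun a ha => H.perp_weyl_R0 a (W27_le ha)
  have p7S : Perp g (W77 g φ) (S g) := fun a ha => H.perp_weyl_S a (H.W77_le ha)
  have p6S : Perp g (W64 g φ) (S g) := fun a ha => H.perp_weyl_S a (H.W64_le ha)
  have p2S : Perp g (W27 g φ) (S g) := fun a ha => H.perp_weyl_S a (W27_le ha)
  have pRS := H.perp_R0_S
  -- the splitting of a Weyl tensor `w` whose `φ`-Ricci contraction is `-4 h`
  have hW (w : V → V → V → V → ℝ) (hw : w ∈ weylTensors g) (h : V → V → ℝ) (hb : IsBilin h)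
      (hs : ∀ u v, h u v = h v u) (ht : trace g h = 0) (hφ : ricPhi g φ w = (-4 : ℝ) • h) :
      w - weyl27 g φ h ∈ weylTensors g ∧ ricPhi g φ (w - weyl27 g φ h) = 0 :=
    ⟨Submodule.sub_mem _ hw (H.weyl27_mem_weyl hb hs ht), by
      rw [ricPhi_sub, hφ, H.ricPhi_weyl27 hb hs ht, sub_self]⟩
  refine ⟨le_antisymm ?_ ?_, ?_, le_antisymm ?_ ?_, ?_⟩
  · intro r hr
    obtain ⟨hw, hφ⟩ := H.weyl_part hr
    obtain ⟨hx, hx'⟩ := hW _ hw _ (H.ricW_bilin hr) (H.ricW_symm hr) (H.trace_ricW r) hφ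
    set w := r - (1 / 84 * scal g r) • rg g g - (1 / 5 : ℝ) • rg g (traceless g (ric g r))
      with hw_def
    set x := w - weyl27 g φ (ricW g φ r) with hx_def
    have e : r = (x - mixedPart g φ x) + mixedPart g φ x + weyl27 g φ (ricW g φ r) +
        (1 / 5 : ℝ) • rg g (traceless g (ric g r)) + (1 / 84 * scal g r) • rg g g := by
      rw [hx_def, hw_def]; abel
    rw [e]
    exact Submodule.add_mem_sup (Submodule.add_mem_sup (Submodule.add_mem_sup
      (Submodule.add_mem_sup (H.sub_mixedPart_mem hx hx') (H.mixedPart_mem hx hx'))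
      (H.weyl27_mem (H.ricW_bilin hr) (H.ricW_symm hr) (H.trace_ricW r))) (H.ric0_mem hr))
      scal_mem
  · exact sup_le (sup_le (sup_le (sup_le inf_le_left inf_le_left) (W27_le.trans weyl_le)) H.R0_le)
      H.S_le
  · simp only [List.pairwise_cons, List.mem_cons, List.not_mem_nil, or_false, forall_eq_or_imp,
      forall_eq, IsEmpty.forall_iff, implies_true, List.Pairwise.nil, and_true]
    exact ⟨⟨p76, p72, p7R, p7S⟩, ⟨p62, p6R, p6S⟩, ⟨p2R, p2S⟩, pRS⟩
  · intro w hw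
    obtain ⟨-, hφ⟩ := H.weyl_part hw.1
    have z : traceless g (0 : V → V → ℝ) = 0 := by ext; simp [traceless, trace]
    have z' : rg g (0 : V → V → ℝ) = 0 := by ext; simp [rg]
    have z'' : scal g w = 0 := by simp [scal, hw.2, trace]
    rw [hw.2, z, z', z'', mul_zero, zero_smul, smul_zero, sub_zero, sub_zero] at hφ
    obtain ⟨hx, hx'⟩ := hW _ hw _ (H.ricW_bilin hw.1) (H.ricW_symm hw.1) (H.trace_ricW w) hφ
    set x := w - weyl27 g φ (ricW g φ w) with hx_def
    have e : w = (x - mixedPart g φ x) + mixedPart g φ x + weyl27 g φ (ricW g φ w) := by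
      rw [hx_def]; abel
    rw [e]
    exact Submodule.add_mem_sup (Submodule.add_mem_sup (H.sub_mixedPart_mem hx hx')
      (H.mixedPart_mem hx hx')) (H.weyl27_mem (H.ricW_bilin hw.1) (H.ricW_symm hw.1)
      (H.trace_ricW w))
  · exact sup_le (sup_le H.W77_le H.W64_le) W27_le
  · intro r hr Ric₀ RicW s W W₇₇ W₆₄ W₂₇
    obtain ⟨hw, hφ⟩ := H.weyl_part hr
    obtain ⟨hx, hx'⟩ := hW _ hw _ (H.ricW_bilin hr) (H.ricW_symm hr) (H.trace_ricW r) hφ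
    set w := r - (1 / 84 * scal g r) • rg g g - (1 / 5 : ℝ) • rg g (traceless g (ric g r))
      with hw_def
    set x := w - weyl27 g φ (ricW g φ r) with hx_def
    set Sc := (1 / 84 * scal g r) • rg g g with hSc
    set Rc := (1 / 5 : ℝ) • rg g (traceless g (ric g r)) with hRc
    set P := weyl27 g φ (ricW g φ r) with hP
    set m := mixedPart g φ x with hm
    have mS : Sc ∈ S g := scal_mem
    have mR : Rc ∈ R0 g := H.ric0_mem hr
    have mP : P ∈ W27 g φ := H.weyl27_mem (H.ricW_bilin hr) (H.ricW_symm hr) (H.trace_ricW r)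
    have m6 : m ∈ W64 g φ := H.mixedPart_mem hx hx'
    have m7 : x - m ∈ W77 g φ := H.sub_mixedPart_mem hx hx'
    have e : r = (x - m) + m + P + Rc + Sc := by rw [hx_def, hw_def]; abel
    have oS : IsOrthProj g (S g) r Sc := ⟨mS, fun t ht => by
      have : r - Sc = (x - m) + m + P + Rc := by rw [e]; abel
      rw [this, inner₄_add_left, inner₄_add_left, inner₄_add_left, p7S _ m7 _ ht, p6S _ m6 _ ht,
        p2S _ mP _ ht, pRS _ mR _ ht]; ring⟩
    have oR : IsOrthProj g (R0 g) r Rc := ⟨mR, fun t ht => by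
      have : r - Rc = (x - m) + m + P + Sc := by rw [e]; abel
      rw [this, inner₄_add_left, inner₄_add_left, inner₄_add_left, p7R _ m7 _ ht, p6R _ m6 _ ht,
        p2R _ mP _ ht, pRS.symm _ mS _ ht]; ring⟩
    have oP : IsOrthProj g (W27 g φ) r P := ⟨mP, fun t ht => by
      have : r - P = (x - m) + m + Rc + Sc := by rw [e]; abel
      rw [this, inner₄_add_left, inner₄_add_left, inner₄_add_left, p72 _ m7 _ ht, p62 _ m6 _ ht,
        p2R.symm _ mR _ ht, p2S.symm _ mS _ ht]; ring⟩
    have o6 : IsOrthProj g (W64 g φ) r m := ⟨m6, fun t ht => by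
      have : r - m = (x - m) + P + Rc + Sc := by rw [e]; abel
      rw [this, inner₄_add_left, inner₄_add_left, inner₄_add_left, p76 _ m7 _ ht,
        p62.symm _ mP _ ht, p6R.symm _ mR _ ht, p6S.symm _ mS _ ht]; ring⟩
    have o7 : IsOrthProj g (W77 g φ) r (x - m) := ⟨m7, fun t ht => by
      have : r - (x - m) = m + P + Rc + Sc := by rw [e]; abel
      rw [this, inner₄_add_left, inner₄_add_left, inner₄_add_left, p76.symm _ m6 _ ht,
        p72.symm _ mP _ ht, p7R.symm _ mR _ ht, p7S.symm _ mS _ ht]; ring⟩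
    have oW : IsOrthProj g (weylTensors g) r w := ⟨hw, fun t ht => by
      have : r - w = Rc + Sc := by rw [hw_def]; abel
      rw [this, inner₄_add_left, H.perp_weyl_R0.symm _ mR _ ht, H.perp_weyl_S.symm _ mS _ ht,
        add_zero]⟩
    have eW : W = w := H.orthProj_eq weyl_le oW
    have e2 : W₂₇ = P := H.orthProj_eq (W27_le.trans weyl_le) oP
    have e6 : W₆₄ = m := H.orthProj_eq inf_le_left o6
    have e7 : W₇₇ = x - m := H.orthProj_eq inf_le_left o7
    obtain ⟨pm, pg⟩ := projections_eq hx.1 hx'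
    rw [eW, e2, e6, e7, pm, pg]
    refine ⟨oS, oR, oP, o6, o7, ⟨fun h0 => ?_, fun h0 => ?_⟩, ?_⟩
    · have h4 : ricPhi g φ P = (-4 : ℝ) • RicW :=
        H.ricPhi_weyl27 (H.ricW_bilin hr) (H.ricW_symm hr) (H.trace_ricW r)
      have h5 : ricPhi g φ 0 = 0 := by ext; simp [ricPhi_eq]
      rw [h0, h5] at h4
      simpa using h4.symm
    · have : P = (3 / 112 : ℝ) • (rg g RicW - (5 : ℝ) • rphi g φ RicW) := rfl
      rw [this, h0]
      funext x y z w
      simp [rg, rphi, bianchi]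
    · have nS : inner₄ g Sc Sc = 1 / 21 * s ^ 2 := by
        rw [hSc, inner₄_smul_left, inner₄_smul_right, H.inner₄_rg g (H.rg_mem H.bilin H.symm),
          H.ric_rg_metric, inner₂_smul_right, inner₂_metric g g H.frame_spec, H.trace_self]
        ring
      have nR : inner₄ g Rc Rc = 4 / 5 * inner₂ g Ric₀ Ric₀ := by
        have hb := H.traceless_bilin (isBilin_ric g (isQuadrilin_of_mem hr))
        rw [hRc, inner₄_smul_left, inner₄_smul_right,
          H.inner₄_rg _ (H.rg_mem hb (H.traceless_symm (ric_symm g hr))), H.ric_rg hb,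
          H.trace_traceless, zero_smul, zero_add, inner₂_smul_right]
        ring
      have nP : inner₄ g P P = 15 / 28 * inner₂ g RicW RicW :=
        H.inner₄_weyl27_self (H.ricW_bilin hr) (H.ricW_symm hr) (H.trace_ricW r)
      conv_lhs => rw [e]
      rw [inner₄_add_self, inner₄_add_self, inner₄_add_self, inner₄_add_self, nS, nR, nP]
      · exact p76 _ m7 _ m6
      · rw [inner₄_add_left, p72 _ m7 _ mP, p62 _ m6 _ mP, add_zero]
      · rw [inner₄_add_left, inner₄_add_left, p7R _ m7 _ mR, p6R _ m6 _ mR, p2R _ mP _ mR]; ring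
      · rw [inner₄_add_left, inner₄_add_left, inner₄_add_left, p7S _ m7 _ mS, p6S _ m6 _ mS,
          p2S _ mP _ mS, pRS _ mR _ mS]; ring

end IsG2Space

end Main

section Conformal

variable {V : Type*} [AddCommGroup V] [Module ℝ V]

/-! ### Conformal rescaling of a `G₂` form -/

namespace IsG2Space

variable {g g' : V → V → ℝ} {φ φ' : V → V → V → ℝ} {t : ℝ}

/-- Rescaling an orthonormal frame. -/
theorem frame_smul (H' : IsG2Space g' φ') (ht : 0 < t) (hg : g' = t ^ 2 • g) (H : IsG2Space g φ) :
    IsOrthonormalFrame g fun i => t • frame g' i := by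
  have hf := H'.frame_spec
  refine ⟨fun i j => ?_, ?_⟩
  · rw [(H.bilin.left _).map_smul, (H.bilin.right _).map_smul, ← hf.1 i j, hg]
    simp only [Pi.smul_apply, smul_eq_mul]
    ring
  · rw [eq_top_iff, ← hf.2, Submodule.span_le]
    rintro _ ⟨i, rfl⟩
    have : frame g' i = t⁻¹ • t • frame g' i := by rw [smul_smul, inv_mul_cancel₀ ht.ne', one_smul]
    rw [this]
    exact Submodule.smul_mem _ _ (Submodule.subset_span ⟨i, rfl⟩)

theorem inner₄_scale (H : IsG2Space g φ) (H' : IsG2Space g' φ') (ht : 0 < t) (hg : g' = t ^ 2 • g)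
    {a b : V → V → V → V → ℝ} (ha : IsQuadrilin a) (hb : IsQuadrilin b) :
    inner₄ g a b = t ^ 8 * inner₄ g' a b := by
  rw [inner₄, (H'.frame_smul ht hg H).inner₄_eq H.frame_spec H.bilin H.symm ha hb]
  simp only [inner₄, Finset.mul_sum, (ha.fst _ _ _).map_smul, (ha.snd _ _ _).map_smul,
    (ha.trd _ _ _).map_smul, (ha.fth _ _ _).map_smul, (hb.fst _ _ _).map_smul,
    (hb.snd _ _ _).map_smul, (hb.trd _ _ _).map_smul, (hb.fth _ _ _).map_smul, smul_eq_mul]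
  exact Finset.sum_congr rfl fun _ _ => Finset.sum_congr rfl fun _ _ =>
    Finset.sum_congr rfl fun _ _ => Finset.sum_congr rfl fun _ _ => by ring

theorem inner₂_scale (H : IsG2Space g φ) (H' : IsG2Space g' φ') (ht : 0 < t) (hg : g' = t ^ 2 • g)
    {a b : V → V → ℝ} (ha : IsBilin a) (hb : IsBilin b) :
    inner₂ g a b = t ^ 4 * inner₂ g' a b := by
  rw [inner₂, (H'.frame_smul ht hg H).inner₂_eq H.frame_spec H.bilin H.symm ha hb]
  simp only [inner₂, Finset.mul_sum, (ha.left _).map_smul, (ha.right _).map_smul,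
    (hb.left _).map_smul, (hb.right _).map_smul, smul_eq_mul]
  exact Finset.sum_congr rfl fun _ _ => Finset.sum_congr rfl fun _ _ => by ring

theorem ric_scale (H : IsG2Space g φ) (H' : IsG2Space g' φ') (ht : 0 < t) (hg : g' = t ^ 2 • g)
    {r : V → V → V → V → ℝ} (hr : IsQuadrilin r) : ric g r = t ^ 2 • ric g' r := by
  funext u v
  have := (H'.frame_smul ht hg H).sum_eq H.frame_spec H.bilin H.symm (B := fun x y => r u x y v)
    ⟨fun _ => hr.snd _ _ _, fun _ => hr.trd _ _ _⟩
  rw [ric, this]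
  simp only [ric, (hr.snd _ _ _).map_smul, (hr.trd _ _ _).map_smul, smul_eq_mul, Pi.smul_apply,
    Finset.mul_sum]
  exact Finset.sum_congr rfl fun _ _ => by ring

theorem lieG2_scale (H : IsG2Space g φ) (H' : IsG2Space g' φ') (ht : 0 < t) (hg : g' = t ^ 2 • g)
    (hφ : φ' = t ^ 3 • φ) : lieG2 g' φ' = lieG2 g φ := by
  ext α
  refine and_congr_right fun hα => forall_congr' fun u => ?_
  have e : φ' u = t ^ 3 • φ u := by rw [hφ]; rfl
  rw [H.inner₂_scale H' ht hg (H.phi_bilin u) (isBilin_of_skew hα.1 hα.2), e, inner₂_comm,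
    inner₂_smul_right, inner₂_comm]
  simp [ht.ne']

theorem range_scale (H : IsG2Space g φ) (ht : 0 < t) (hφ : φ' = t ^ 3 • φ) :
    Set.range φ' = Set.range φ := by
  have e (c : ℝ) (u : V) : φ (c • u) = c • φ u := by
    funext v w; exact (H.phi_lin v w).map_smul c u
  ext α
  constructor
  · rintro ⟨u, rfl⟩
    exact ⟨t ^ 3 • u, by rw [e, hφ]; rfl⟩
  · rintro ⟨u, rfl⟩
    refine ⟨(t ^ 3)⁻¹ • u, ?_⟩
    rw [hφ, Pi.smul_apply, e, smul_smul, mul_inv_cancel₀ (pow_pos ht 3).ne', one_smul]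

theorem W77_scale (H : IsG2Space g φ) (H' : IsG2Space g' φ') (ht : 0 < t) (hg : g' = t ^ 2 • g)
    (hφ : φ' = t ^ 3 • φ) : W77 g' φ' = W77 g φ := by
  rw [W77, W77, H.lieG2_scale H' ht hg hφ]

theorem W64_scale (H : IsG2Space g φ) (H' : IsG2Space g' φ') (ht : 0 < t) (hg : g' = t ^ 2 • g)
    (hφ : φ' = t ^ 3 • φ) : W64 g' φ' = W64 g φ := by
  rw [W64, W64, H.lieG2_scale H' ht hg hφ, H.range_scale ht hφ]

theorem W27_scale (H : IsG2Space g φ) (H' : IsG2Space g' φ') (ht : 0 < t) (hg : g' = t ^ 2 • g)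
    (hφ : φ' = t ^ 3 • φ) : W27 g' φ' = W27 g φ := by
  have hW : weylTensors g' = weylTensors g := by
    ext r
    refine and_congr_right fun hr => ?_
    rw [H.ric_scale H' ht hg (isQuadrilin_of_mem hr)]
    simp [ht.ne']
  have hle : W77 g φ ⊔ W64 g φ ≤ curvatureTensors V := sup_le inf_le_left inf_le_left
  ext r
  change (r ∈ weylTensors g' ∧ ∀ s ∈ W77 g' φ' ⊔ W64 g' φ', inner₄ g' r s = 0) ↔
    (r ∈ weylTensors g ∧ ∀ s ∈ W77 g φ ⊔ W64 g φ, inner₄ g r s = 0)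
  rw [hW, H.W77_scale H' ht hg hφ, H.W64_scale H' ht hg hφ]
  refine and_congr_right fun hr => forall₂_congr fun s hs => ?_
  rw [H.inner₄_scale H' ht hg (isQuadrilin_of_mem hr.1) (isQuadrilin_of_mem (hle hs))]
  simp [ht.ne']

/-- If a curvature tensor changes by a conformal factor and a term `r_g(h)`, its orthogonal
projections to spaces of Weyl tensors only change by the factor. -/
theorem orthProj_scale (H : IsG2Space g φ) (H' : IsG2Space g' φ') (ht : 0 < t)
    (hg : g' = t ^ 2 • g) {U : Submodule ℝ (V → V → V → V → ℝ)} (hU : U ≤ weylTensors g)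
    {r p : V → V → V → V → ℝ} (hr : r ∈ curvatureTensors V) (hp : IsOrthProj g U r p)
    {h : V → V → ℝ} (hh : IsBilin h) (hs : ∀ u v, h u v = h v u) :
    orthProj g' U (t ^ 2 • (r + rg g h)) = t ^ 2 • orthProj g U r := by
  have hK : U ≤ curvatureTensors V := hU.trans weyl_le
  rw [H.orthProj_eq hK hp]
  refine H'.orthProj_eq hK ⟨Submodule.smul_mem _ _ hp.1, fun s hs' => ?_⟩
  have hm : t ^ 2 • (r + rg g h) - t ^ 2 • p ∈ curvatureTensors V :=
    Submodule.sub_mem _ (Submodule.smul_mem _ _ (Submodule.add_mem _ hr (H.rg_mem hh hs)))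
      (Submodule.smul_mem _ _ (hK hp.1))
  have h1 : inner₄ g (t ^ 2 • (r + rg g h) - t ^ 2 • p) s = 0 := by
    have : t ^ 2 • (r + rg g h) - t ^ 2 • p = t ^ 2 • ((r - p) + rg g h) := by
      rw [← smul_sub]; congr 1; abel
    rw [this, inner₄_smul_left, inner₄_add_left, hp.2 s hs', inner₄_comm g (rg g h),
      H.perp_rg (hU hs')]
    ring
  rw [H.inner₄_scale H' ht hg (isQuadrilin_of_mem hm) (isQuadrilin_of_mem (hK hs'))] at h1
  exact (mul_eq_zero.1 h1).resolve_left (pow_pos ht 8).ne'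

/-- Conformal invariance of the Weyl components. -/
theorem orthProj_conformal (H : IsG2Space g φ) (H' : IsG2Space g' φ') (ht : 0 < t)
    (hg : g' = t ^ 2 • g) (hφ : φ' = t ^ 3 • φ) {r : V → V → V → V → ℝ}
    (hr : r ∈ curvatureTensors V) {h : V → V → ℝ} (hh : IsBilin h) (hs : ∀ u v, h u v = h v u) :
    orthProj g' (W77 g' φ') (t ^ 2 • (r + rg g h)) = t ^ 2 • orthProj g (W77 g φ) r ∧
    orthProj g' (W64 g' φ') (t ^ 2 • (r + rg g h)) = t ^ 2 • orthProj g (W64 g φ) r ∧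
    orthProj g' (W27 g' φ') (t ^ 2 • (r + rg g h)) = t ^ 2 • orthProj g (W27 g φ) r := by
  obtain ⟨-, -, -, hP⟩ := H.splitting
  obtain ⟨-, -, h27, h64, h77, -⟩ := hP r hr
  rw [H.W77_scale H' ht hg hφ, H.W64_scale H' ht hg hφ, H.W27_scale H' ht hg hφ]
  exact ⟨H.orthProj_scale H' ht hg H.W77_le hr h77 hh hs,
    H.orthProj_scale H' ht hg H.W64_le hr h64 hh hs,
    H.orthProj_scale H' ht hg W27_le hr h27 hh hs⟩

end IsG2Space

end Conformal

/-! ### The algebra of the curvature formula in coordinates -/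

section CoordinateAlgebra

/-- The contraction of two covectors with a matrix `B`, which is to be the inverse metric. -/
def contract (B : Matrix (Fin 7) (Fin 7) ℝ) (X Y : Fin 7 → ℝ) : ℝ := ∑ n, ∑ l, B n l * X l * Y n

/-- The Christoffel symbols of the first kind, for the first derivatives `D i j k = ∂ᵢ g_{jk}` of
the metric. -/
noncomputable def lowerChristoffel (D : Fin 7 → Fin 7 → Fin 7 → ℝ) (i j l : Fin 7) : ℝ :=
  1 / 2 * (D i j l + D j i l - D l i j)

/-- The curvature tensor with lowered index, in terms of the inverse metric `B` and the first and
second derivatives `D` and `D₂` of the metric. -/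
noncomputable def lowerCurvature (B : Matrix (Fin 7) (Fin 7) ℝ) (D : Fin 7 → Fin 7 → Fin 7 → ℝ)
    (D₂ : Fin 7 → Fin 7 → Fin 7 → Fin 7 → ℝ) (i j k z : Fin 7) : ℝ :=
  1 / 2 * (D₂ i k j z - D₂ i z j k - D₂ j k i z + D₂ j z i k) -
    (contract B (lowerChristoffel D j k) (lowerChristoffel D i z) -
      contract B (lowerChristoffel D i k) (lowerChristoffel D j z))

theorem contract_comm {B : Matrix (Fin 7) (Fin 7) ℝ} (hB : B.transpose = B) (X Y : Fin 7 → ℝ) :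
    contract B X Y = contract B Y X := by
  rw [contract, Finset.sum_comm]
  refine Finset.sum_congr rfl fun l _ => Finset.sum_congr rfl fun n _ => ?_
  have : B n l = B l n := congrFun (congrFun hB l) n
  rw [this]; ring

theorem contract_left (B : Matrix (Fin 7) (Fin 7) ℝ) (c s t u : ℝ) (X₁ X₂ X₃ X₄ Y : Fin 7 → ℝ) :
    contract B (fun l => c * (X₁ l + s * X₂ l + t * X₃ l - u * X₄ l)) Y =
      c * (contract B X₁ Y + s * contract B X₂ Y + t * contract B X₃ Y - u * contract B X₄ Y) := by
  simp only [contract, Finset.mul_sum, ← Finset.sum_add_distrib, ← Finset.sum_sub_distrib]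
  exact Finset.sum_congr rfl fun _ _ => Finset.sum_congr rfl fun _ _ => by ring

theorem contract_right (B : Matrix (Fin 7) (Fin 7) ℝ) (c s t u : ℝ) (X Y₁ Y₂ Y₃ Y₄ : Fin 7 → ℝ) :
    contract B X (fun l => c * (Y₁ l + s * Y₂ l + t * Y₃ l - u * Y₄ l)) =
      c * (contract B X Y₁ + s * contract B X Y₂ + t * contract B X Y₃ - u * contract B X Y₄) := by
  simp only [contract, Finset.mul_sum, ← Finset.sum_add_distrib, ← Finset.sum_sub_distrib]
  exact Finset.sum_congr rfl fun _ _ => Finset.sum_congr rfl fun _ _ => by ring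

theorem contract_metric {A B : Matrix (Fin 7) (Fin 7) ℝ} (hAB : A * B = 1)
    (hB : B.transpose = B) (k : Fin 7) (Y : Fin 7 → ℝ) : contract B (fun l => A k l) Y = Y k := by
  have h (n : Fin 7) : ∑ l, B n l * A k l = if k = n then 1 else 0 := by
    rw [← Matrix.one_apply, ← hAB, Matrix.mul_apply]
    refine Finset.sum_congr rfl fun l _ => ?_
    have : B n l = B l n := congrFun (congrFun hB l) n
    rw [this, mul_comm]
  simp only [contract, ← Finset.sum_mul, h]
  simp

variable {A B : Matrix (Fin 7) (Fin 7) ℝ} {D : Fin 7 → Fin 7 → Fin 7 → ℝ}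
  {D₂ : Fin 7 → Fin 7 → Fin 7 → Fin 7 → ℝ}

theorem lowerCurvature_skew₁ (i j k z : Fin 7) :
    lowerCurvature B D D₂ i j k z = -lowerCurvature B D D₂ j i k z := by
  simp only [lowerCurvature]; ring

theorem lowerCurvature_skew₂ (hB : B.transpose = B) (i j k z : Fin 7) :
    lowerCurvature B D D₂ i j k z = -lowerCurvature B D D₂ i j z k := by
  simp only [lowerCurvature, contract_comm hB (lowerChristoffel D j k),
    contract_comm hB (lowerChristoffel D i k)]
  ring

theorem lowerCurvature_bianchi (hD : ∀ i j k, D i j k = D i k j)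
    (h₁ : ∀ i j k l, D₂ i j k l = D₂ j i k l) (h₂ : ∀ i j k l, D₂ i j k l = D₂ i j l k)
    (i j k z : Fin 7) : lowerCurvature B D D₂ i j k z + lowerCurvature B D D₂ j k i z +
      lowerCurvature B D D₂ k i j z = 0 := by
  have hL (i j) : lowerChristoffel D i j = lowerChristoffel D j i := by
    funext l; simp only [lowerChristoffel, hD l i j]; ring
  simp only [lowerCurvature, hL j i, hL k j, hL k i, h₁ k i, h₁ j i, h₁ k j, h₂ _ _ k j, h₂ _ _ k i,
    h₂ _ _ j i]
  ring

/-- The curvature of a conformally rescaled metric `e^{2f} g`, where `E`, `u`, `u₂` stand for the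
values of `e^{2f}` and of the first and second derivatives of `f`. The correction term is the
Kulkarni–Nomizu product of `g` and `-∇df + df ⊗ df - ½ |df|² g`. -/
theorem lowerCurvature_conformal (hAB : A * B = 1) (hA : A.transpose = A) (hB : B.transpose = B)
    (hD : ∀ i j k, D i j k = D i k j) {E : ℝ} (hE : E ≠ 0) {u : Fin 7 → ℝ}
    {u₂ : Fin 7 → Fin 7 → ℝ} (hu : ∀ i j, u₂ i j = u₂ j i) :
    ∃ h : Fin 7 → Fin 7 → ℝ, (∀ i j, h i j = h j i) ∧ ∀ i j k z,
      lowerCurvature (E⁻¹ • B) (fun i j k => E * (D i j k + 2 * u i * A j k))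
        (fun i j k l => E * (D₂ i j k l + 2 * u j * D i k l + 2 * u i * D j k l +
          (2 * u₂ i j + 4 * u i * u j) * A k l)) i j k z =
      E * (lowerCurvature B D D₂ i j k z + (h j k * A i z - h i k * A j z + h i z * A j k -
        h j z * A i k)) := by
  have hA' (i j) : A i j = A j i := congrFun (congrFun hA j) i
  have hL (i j) : lowerChristoffel D i j = lowerChristoffel D j i := by
    funext l; simp only [lowerChristoffel, hD l i j]; ring
  refine ⟨fun i j => -u₂ i j + contract B u (lowerChristoffel D i j) + u i * u j -
    1 / 2 * contract B u u * A i j, fun i j => by dsimp only; rw [hu i j, hL i j, hA' i j]; ring,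
    fun i j k z => ?_⟩
  have hT (i j : Fin 7) : lowerChristoffel (fun i j k => E * (D i j k + 2 * u i * A j k)) i j =
      fun l => E * (lowerChristoffel D i j l + u i * A j l + u j * A i l - A i j * u l) := by
    funext l; simp only [lowerChristoffel]; ring
  have hs (X Y : Fin 7 → ℝ) : contract (E⁻¹ • B) X Y = E⁻¹ * contract B X Y := by
    simp only [contract, Finset.mul_sum, Matrix.smul_apply, smul_eq_mul]
    exact Finset.sum_congr rfl fun _ _ => Finset.sum_congr rfl fun _ _ => by ring
  have m₁ (k : Fin 7) (Y : Fin 7 → ℝ) := contract_metric hAB hB k Y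
  have m₂ (k : Fin 7) (Y : Fin 7 → ℝ) : contract B Y (fun l => A k l) = Y k := by
    rw [contract_comm hB, m₁]
  -- Substituting symmetrizations makes the symmetries of the arrays visible to `ring`.
  obtain ⟨X, hX⟩ : ∃ X : Fin 7 → Fin 7 → Fin 7 → ℝ, ∀ i j k, D i j k = X i j k + X i k j :=
    ⟨fun i j k => D i j k / 2, fun i j k => by dsimp only; rw [hD i k j]; ring⟩
  obtain ⟨Y, hY⟩ : ∃ Y : Fin 7 → Fin 7 → ℝ, ∀ j k, A j k = Y j k + Y k j :=
    ⟨fun j k => A j k / 2, fun j k => by dsimp only; rw [hA' k j]; ring⟩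
  obtain ⟨Z, hZ⟩ : ∃ Z : Fin 7 → Fin 7 → ℝ, ∀ j k, u₂ j k = Z j k + Z k j :=
    ⟨fun j k => u₂ j k / 2, fun j k => by dsimp only; rw [hu k j]; ring⟩
  simp only [lowerCurvature, hT, hs, contract_left, contract_right, m₁, m₂,
    contract_comm hB _ u]
  simp only [← mul_assoc, inv_mul_cancel₀ hE, one_mul]
  generalize contract B (lowerChristoffel D j k) (lowerChristoffel D i z) = c₁
  generalize contract B (lowerChristoffel D i k) (lowerChristoffel D j z) = c₂
  generalize contract B u (lowerChristoffel D i z) = c₃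
  generalize contract B u (lowerChristoffel D j z) = c₄
  generalize contract B u (lowerChristoffel D j k) = c₅
  generalize contract B u (lowerChristoffel D i k) = c₆
  generalize contract B u u = c₇
  simp only [lowerChristoffel, hX, hY, hZ]
  ring

end CoordinateAlgebra

/-! ### The curvature tensor of a matrix-valued function on `ℝ⁷` -/

section Calculus

open Filter Topology G2Structure

section PartialDerivatives

variable {f h : E7 → ℝ} {p : E7} {i j : Fin 7}

theorem partialDeriv_congr (H : f =ᶠ[𝓝 p] h) : partialDeriv i f p = partialDeriv i h p := by
  rw [partialDeriv, H.fderiv_eq, partialDeriv]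

theorem partialDeriv_add (hf : DifferentiableAt ℝ f p) (hh : DifferentiableAt ℝ h p) :
    partialDeriv i (fun q => f q + h q) p = partialDeriv i f p + partialDeriv i h p := by
  simp only [partialDeriv, fderiv_fun_add hf hh, add_apply]

theorem partialDeriv_sub (hf : DifferentiableAt ℝ f p) (hh : DifferentiableAt ℝ h p) :
    partialDeriv i (fun q => f q - h q) p = partialDeriv i f p - partialDeriv i h p := by
  simp only [partialDeriv, fderiv_fun_sub hf hh, sub_apply]

theorem partialDeriv_mul (hf : DifferentiableAt ℝ f p) (hh : DifferentiableAt ℝ h p) :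
    partialDeriv i (fun q => f q * h q) p =
      partialDeriv i f p * h p + f p * partialDeriv i h p := by
  simp only [partialDeriv, fderiv_fun_mul hf hh, add_apply, smul_apply, smul_eq_mul]
  ring

theorem partialDeriv_const_mul (c : ℝ) (hf : DifferentiableAt ℝ f p) :
    partialDeriv i (fun q => c * f q) p = c * partialDeriv i f p := by
  simp only [partialDeriv, fderiv_const_mul hf, smul_apply, smul_eq_mul]

theorem partialDeriv_sum {F : Fin 7 → E7 → ℝ} (hF : ∀ n, DifferentiableAt ℝ (F n) p) :
    partialDeriv i (fun q => ∑ n, F n q) p = ∑ n, partialDeriv i (F n) p := by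
  simp only [partialDeriv, fderiv_fun_sum fun n _ => hF n, sum_apply]

theorem partialDeriv_exp (hf : DifferentiableAt ℝ f p) :
    partialDeriv i (fun q => Real.exp (2 * f q)) p =
      Real.exp (2 * f p) * (2 * partialDeriv i f p) := by
  have := (hf.hasFDerivAt.const_mul 2).exp.fderiv
  simp only [partialDeriv, this, smul_apply, smul_eq_mul]

theorem contDiffAt_partialDeriv (hf : ContDiffAt ℝ ∞ f p) :
    ContDiffAt ℝ ∞ (partialDeriv i f) p :=
  (hf.fderiv_right (m := ∞) (by simp)).clm_apply contDiffAt_const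

theorem differentiableAt_of_smooth (hf : ContDiffAt ℝ ∞ f p) : DifferentiableAt ℝ f p :=
  hf.differentiableAt (by simp)

theorem eventually_differentiableAt (hf : ContDiffAt ℝ ∞ f p) :
    ∀ᶠ q in 𝓝 p, DifferentiableAt ℝ f q :=
  ((hf.of_le (m := 1) (mod_cast le_top)).eventually (by simp)).mono fun _ h =>
    h.differentiableAt (by simp)

theorem partialDeriv_comm (hf : ContDiffAt ℝ ∞ f p) :
    partialDeriv i (partialDeriv j f) p = partialDeriv j (partialDeriv i f) p := by
  have hd : DifferentiableAt ℝ (fderiv ℝ f) p :=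
    (hf.fderiv_right (m := ∞) (by simp)).differentiableAt (by simp)
  have key (a b : Fin 7) : partialDeriv a (partialDeriv b f) p =
      fderiv ℝ (fderiv ℝ f) p (EuclideanSpace.single a 1) (EuclideanSpace.single b 1) := by
    have : partialDeriv b f = fun q => fderiv ℝ f q (EuclideanSpace.single b 1) := rfl
    rw [this, partialDeriv, fderiv_clm_apply hd (differentiableAt_const _)]
    simp
  rw [key, key]
  exact (hf.isSymmSndFDerivAt (by simpa using WithTop.coe_le_coe.2 (le_top (a := (2 : ℕ∞))))).eq _ _

end PartialDerivatives

/-- The first partial derivatives `∂ᵢ A_{jk}` of a matrix-valued function. -/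
noncomputable def matrixDeriv (A : E7 → Matrix (Fin 7) (Fin 7) ℝ) (p : E7) (i j k : Fin 7) : ℝ :=
  partialDeriv i (fun q => A q j k) p

/-- The second partial derivatives `∂ᵢ ∂ⱼ A_{kl}` of a matrix-valued function. -/
noncomputable def matrixDeriv₂ (A : E7 → Matrix (Fin 7) (Fin 7) ℝ) (p : E7) (i j k l : Fin 7) : ℝ :=
  partialDeriv i (fun q => matrixDeriv A q j k l) p

/-- The Christoffel symbols `Γᵏᵢⱼ` of the metric with matrix `A`. -/
noncomputable def matrixChristoffel (A : E7 → Matrix (Fin 7) (Fin 7) ℝ) (k i j : Fin 7)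
    (p : E7) : ℝ :=
  1 / 2 * ∑ l, (A p)⁻¹ k l * (matrixDeriv A p i j l + matrixDeriv A p j i l - matrixDeriv A p l i j)

/-- The `∂_m`-component of `R(∂ᵢ, ∂ⱼ)∂ₖ` for the metric with matrix `A`. -/
noncomputable def matrixCurvature (A : E7 → Matrix (Fin 7) (Fin 7) ℝ) (i j k m : Fin 7)
    (p : E7) : ℝ :=
  partialDeriv i (matrixChristoffel A m j k) p - partialDeriv j (matrixChristoffel A m i k) p +
    ∑ n, (matrixChristoffel A m i n p * matrixChristoffel A n j k p -
      matrixChristoffel A m j n p * matrixChristoffel A n i k p)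

/-- The matrix-valued function `A` is a Riemannian metric near `p`, except that positivity is
weakened to invertibility. -/
structure IsMetricNear (A : E7 → Matrix (Fin 7) (Fin 7) ℝ) (p : E7) : Prop where
  smooth : ∀ i j, ContDiffAt ℝ ∞ (fun q => A q i j) p
  symm : ∀ᶠ q in 𝓝 p, (A q).transpose = A q
  isUnit : ∀ᶠ q in 𝓝 p, IsUnit (A q).det

variable {A : E7 → Matrix (Fin 7) (Fin 7) ℝ} {p : E7}

namespace IsMetricNear

variable (H : IsMetricNear A p)
include H

theorem contDiffAt_matrixDeriv (i j k : Fin 7) :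
    ContDiffAt ℝ ∞ (fun q => matrixDeriv A q i j k) p :=
  contDiffAt_partialDeriv (H.smooth j k)

theorem matrixDeriv_symm : ∀ᶠ q in 𝓝 p, ∀ i j k, matrixDeriv A q i j k = matrixDeriv A q i k j := by
  filter_upwards [H.symm.eventually_nhds] with q hq i j k
  exact partialDeriv_congr (hq.mono fun q' h => congrFun (congrFun h k) j)

theorem matrixDeriv₂_comm (i j k l : Fin 7) : matrixDeriv₂ A p i j k l = matrixDeriv₂ A p j i k l :=
  partialDeriv_comm (H.smooth k l)

theorem matrixDeriv₂_symm (i j k l : Fin 7) : matrixDeriv₂ A p i j k l = matrixDeriv₂ A p i j l k :=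
  partialDeriv_congr (H.matrixDeriv_symm.mono fun _ h => h j k l)

omit H in
theorem contDiffAt_det (B : E7 → Matrix (Fin 7) (Fin 7) ℝ)
    (hB : ∀ i j, ContDiffAt ℝ ∞ (fun q => B q i j) p) : ContDiffAt ℝ ∞ (fun q => (B q).det) p := by
  simp only [Matrix.det_apply]
  exact ContDiffAt.sum fun s _ => (contDiffAt_prod fun i _ => hB _ _).const_smul _

theorem contDiffAt_inv (i j : Fin 7) : ContDiffAt ℝ ∞ (fun q => (A q)⁻¹ i j) p := by
  simp only [Matrix.inv_def, Ring.inverse_eq_inv', Matrix.smul_apply, smul_eq_mul,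
    Matrix.adjugate_apply]
  refine ((contDiffAt_det _ H.smooth).inv H.isUnit.self_of_nhds.ne_zero).mul
    (contDiffAt_det _ fun a b => ?_)
  simp only [Matrix.updateRow_apply]
  split_ifs
  · exact contDiffAt_const
  · exact H.smooth a b

theorem contDiffAt_matrixChristoffel (k i j : Fin 7) :
    ContDiffAt ℝ ∞ (matrixChristoffel A k i j) p :=
  contDiffAt_const.mul <| ContDiffAt.sum fun l _ => (H.contDiffAt_inv k l).mul <|
    ((H.contDiffAt_matrixDeriv i j l).add (H.contDiffAt_matrixDeriv j i l)).sub
      (H.contDiffAt_matrixDeriv l i j)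

omit H in
theorem matrixChristoffel_eq (k i j : Fin 7) (q : E7) : matrixChristoffel A k i j q =
    ∑ l, (A q)⁻¹ k l * lowerChristoffel (matrixDeriv A q) i j l := by
  simp only [matrixChristoffel, lowerChristoffel, Finset.mul_sum]
  exact Finset.sum_congr rfl fun l _ => by ring

theorem sum_matrixChristoffel_mul : ∀ᶠ q in 𝓝 p, ∀ i j z,
    ∑ m, matrixChristoffel A m i j q * A q m z = lowerChristoffel (matrixDeriv A q) i j z := by
  filter_upwards [H.symm, H.isUnit] with q hs hu i j z
  have h (l : Fin 7) : ∑ m, (A q)⁻¹ m l * A q m z = if z = l then 1 else 0 := by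
    rw [← Matrix.one_apply, ← Matrix.mul_nonsing_inv _ hu, Matrix.mul_apply]
    refine Finset.sum_congr rfl fun m _ => ?_
    have : A q m z = A q z m := congrFun (congrFun hs z) m
    rw [this, mul_comm]
  calc _ = ∑ l, (∑ m, (A q)⁻¹ m l * A q m z) * lowerChristoffel (matrixDeriv A q) i j l := by
        simp only [matrixChristoffel_eq, Finset.sum_mul]
        rw [Finset.sum_comm]
        exact Finset.sum_congr rfl fun l _ => Finset.sum_congr rfl fun m _ => by ring
    _ = _ := by simp [h]

theorem partialDeriv_lowerChristoffel (i j k z : Fin 7) :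
    partialDeriv i (fun q => lowerChristoffel (matrixDeriv A q) j k z) p =
      1 / 2 * (matrixDeriv₂ A p i j k z + matrixDeriv₂ A p i k j z - matrixDeriv₂ A p i z j k) := by
  have d (i j k) := differentiableAt_of_smooth (H.contDiffAt_matrixDeriv i j k)
  simp only [lowerChristoffel]
  rw [partialDeriv_const_mul _ (((d _ _ _).fun_add (d _ _ _)).fun_sub (d _ _ _)),
    partialDeriv_sub ((d _ _ _).fun_add (d _ _ _)) (d _ _ _), partialDeriv_add (d _ _ _) (d _ _ _)]
  rfl

/-- Differentiating the identity that defines the Christoffel symbols of the first kind avoids the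
derivatives of the inverse matrix. -/
theorem sum_partialDeriv_christoffel_mul (i j k z : Fin 7) :
    ∑ m, partialDeriv i (matrixChristoffel A m j k) p * A p m z =
      1 / 2 * (matrixDeriv₂ A p i j k z + matrixDeriv₂ A p i k j z - matrixDeriv₂ A p i z j k) -
        ∑ m, matrixChristoffel A m j k p * (lowerChristoffel (matrixDeriv A p) i m z +
          lowerChristoffel (matrixDeriv A p) i z m) := by
  have dG (m) := differentiableAt_of_smooth (H.contDiffAt_matrixChristoffel m j k)
  have dA (m) := differentiableAt_of_smooth (H.smooth m z)
  have h₁ := partialDeriv_congr (i := i) (H.sum_matrixChristoffel_mul.mono fun q hq => hq j k z)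
  rw [H.partialDeriv_lowerChristoffel, partialDeriv_sum fun m => (dG m).fun_mul (dA m)] at h₁
  simp only [partialDeriv_mul (dG _) (dA _), Finset.sum_add_distrib] at h₁
  have h₂ (m : Fin 7) : partialDeriv i (fun q => A q m z) p =
      lowerChristoffel (matrixDeriv A p) i m z + lowerChristoffel (matrixDeriv A p) i z m := by
    have := H.matrixDeriv_symm.self_of_nhds i z m
    have h' : partialDeriv i (fun q => A q m z) p = matrixDeriv A p i m z := rfl
    have h3 := H.matrixDeriv_symm.self_of_nhds m i z
    have h4 := H.matrixDeriv_symm.self_of_nhds z i m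
    simp only [lowerChristoffel]
    rw [h']
    linarith
  simp only [h₂] at h₁
  linarith

theorem sum_matrixCurvature_mul (i j k z : Fin 7) :
    ∑ m, matrixCurvature A i j k m p * A p m z =
      lowerCurvature (A p)⁻¹ (matrixDeriv A p) (matrixDeriv₂ A p) i j k z := by
  have hG := H.sum_matrixChristoffel_mul.self_of_nhds
  have hq (i j k : Fin 7) : ∑ m, (∑ n, matrixChristoffel A m i n p * matrixChristoffel A n j k p) *
      A p m z = ∑ n, matrixChristoffel A n j k p * lowerChristoffel (matrixDeriv A p) i n z := by
    simp only [← hG, Finset.mul_sum, Finset.sum_mul]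
    rw [Finset.sum_comm]
    exact Finset.sum_congr rfl fun l _ => Finset.sum_congr rfl fun m _ => by ring
  have hc (i j k : Fin 7) : ∑ n, matrixChristoffel A n j k p *
      lowerChristoffel (matrixDeriv A p) i z n = contract (A p)⁻¹
        (lowerChristoffel (matrixDeriv A p) j k) (lowerChristoffel (matrixDeriv A p) i z) := by
    simp only [matrixChristoffel_eq, contract, Finset.sum_mul]
  have h₁ := H.sum_partialDeriv_christoffel_mul i j k z
  have h₂ := H.sum_partialDeriv_christoffel_mul j i k z
  simp only [mul_add, Finset.sum_add_distrib, hc] at h₁ h₂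
  simp only [matrixCurvature, Finset.sum_sub_distrib, add_mul, sub_mul, Finset.sum_add_distrib, hq,
    h₁, h₂, lowerCurvature, H.matrixDeriv₂_comm j i]
  ring

variable {F : E7 → ℝ} (hF : ContDiffAt ℝ ∞ F p) {A' : E7 → Matrix (Fin 7) (Fin 7) ℝ}
  (hA' : ∀ᶠ q in 𝓝 p, A' q = Real.exp (2 * F q) • A q)
include hF hA'

theorem matrixDeriv_conformal : ∀ᶠ q in 𝓝 p, ∀ i j k, matrixDeriv A' q i j k =
    Real.exp (2 * F q) * (matrixDeriv A q i j k + 2 * partialDeriv i F q * A q j k) := by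
  have hs : ∀ᶠ q in 𝓝 p, ∀ i j, DifferentiableAt ℝ (fun q => A q i j) q := by
    simp only [eventually_all]
    exact fun i j => eventually_differentiableAt (H.smooth i j)
  filter_upwards [hA'.eventually_nhds, hs, eventually_differentiableAt hF] with q hq hd hFd i j k
  have h₁ : matrixDeriv A' q i j k =
      partialDeriv i (fun q => Real.exp (2 * F q) * A q j k) q :=
    partialDeriv_congr (hq.mono fun q' h => by
      simp only [h, Matrix.smul_apply, smul_eq_mul])
  rw [h₁, partialDeriv_mul (hFd.const_mul 2).exp (hd j k), partialDeriv_exp hFd, matrixDeriv]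
  ring

theorem matrixDeriv₂_conformal (i j k l : Fin 7) : matrixDeriv₂ A' p i j k l =
    Real.exp (2 * F p) * (matrixDeriv₂ A p i j k l +
      2 * partialDeriv j F p * matrixDeriv A p i k l +
      2 * partialDeriv i F p * matrixDeriv A p j k l +
      (2 * partialDeriv i (partialDeriv j F) p + 4 * partialDeriv i F p * partialDeriv j F p) *
        A p k l) := by
  have h₁ := partialDeriv_congr (i := i) ((H.matrixDeriv_conformal hF hA').mono fun q h => h j k l)
  have dF := differentiableAt_of_smooth hF
  have dF' := differentiableAt_of_smooth (contDiffAt_partialDeriv (i := j) hF)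
  have dA := differentiableAt_of_smooth (H.smooth k l)
  have dA' := differentiableAt_of_smooth (H.contDiffAt_matrixDeriv j k l)
  rw [matrixDeriv₂, h₁, partialDeriv_mul (dF.const_mul 2).exp
    (dA'.fun_add ((dF'.const_mul 2).fun_mul dA)), partialDeriv_exp dF,
    partialDeriv_add dA' ((dF'.const_mul 2).fun_mul dA), partialDeriv_mul (dF'.const_mul 2) dA,
    partialDeriv_const_mul 2 dF']
  simp only [matrixDeriv₂, matrixDeriv]
  ring

theorem lowerCurvature_conformal : ∃ h : Fin 7 → Fin 7 → ℝ, (∀ i j, h i j = h j i) ∧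
    ∀ i j k z, lowerCurvature (A' p)⁻¹ (matrixDeriv A' p) (matrixDeriv₂ A' p) i j k z =
      Real.exp (2 * F p) *
        (lowerCurvature (A p)⁻¹ (matrixDeriv A p) (matrixDeriv₂ A p) i j k z +
          (h j k * A p i z - h i k * A p j z + h i z * A p j k - h j z * A p i k)) := by
  have hu := H.isUnit.self_of_nhds
  have hs := H.symm.self_of_nhds
  have hD : matrixDeriv A' p = fun i j k =>
      Real.exp (2 * F p) * (matrixDeriv A p i j k + 2 * partialDeriv i F p * A p j k) := by
    funext i j k
    exact (H.matrixDeriv_conformal hF hA').self_of_nhds i j k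
  have hD₂ : matrixDeriv₂ A' p = fun i j k l => Real.exp (2 * F p) *
      (matrixDeriv₂ A p i j k l + 2 * partialDeriv j F p * matrixDeriv A p i k l +
        2 * partialDeriv i F p * matrixDeriv A p j k l +
        (2 * partialDeriv i (partialDeriv j F) p + 4 * partialDeriv i F p * partialDeriv j F p) *
          A p k l) := by
    funext i j k l
    exact H.matrixDeriv₂_conformal hF hA' i j k l
  have hi : (A' p)⁻¹ = (Real.exp (2 * F p))⁻¹ • (A p)⁻¹ := by
    rw [hA'.self_of_nhds]
    refine Matrix.inv_eq_right_inv ?_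
    rw [Matrix.smul_mul, Matrix.mul_smul, smul_smul, mul_inv_cancel₀ (Real.exp_ne_zero _), one_smul,
      Matrix.mul_nonsing_inv _ hu]
  rw [hD, hD₂, hi]
  exact G2.lowerCurvature_conformal (Matrix.mul_nonsing_inv _ hu) hs
    (by rw [Matrix.transpose_nonsing_inv, hs]) H.matrixDeriv_symm.self_of_nhds
    (Real.exp_ne_zero _) (u₂ := fun i j => partialDeriv i (partialDeriv j F) p)
    fun i j => partialDeriv_comm hF

end IsMetricNear

end Calculus

/-! ### The Riemannian curvature of a `G₂` manifold -/

section Manifold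

open Filter Topology

variable {M : Type*} [TopologicalSpace M] [ChartedSpace E7 M] [IsManifold (𝓡 7) ∞ M]

namespace G2Structure

variable (G : G2Structure M)

theorem g_add_left (x : M) (u v w : TangentSpace (𝓡 7) x) :
    G.g x (u + v) w = G.g x u w + G.g x v w := by
  simp only [g, map_add, add_apply]

theorem g_smul_left (x : M) (c : ℝ) (u w : TangentSpace (𝓡 7) x) :
    G.g x (c • u) w = c * G.g x u w := by
  simp only [g, map_smul, smul_apply, smul_eq_mul]

theorem g_symm (x : M) (u v : TangentSpace (𝓡 7) x) : G.g x u v = G.g x v u := G.metric.symm x u v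

theorem isBilin_g (x : M) : IsBilin (G.g x) :=
  isBilin_of_symm (fun v => ⟨fun u w => G.g_add_left x u w v, fun c u => G.g_smul_left x c u v⟩)
    (G.g_symm x)

theorem isG2Space (x : M) : IsG2Space (G.g x) (G.φ x) where
  bilin := G.isBilin_g x
  symm := G.g_symm x
  phi_lin v w := by
    have h (u : TangentSpace (𝓡 7) x) : ![u, v, w] = Function.update ![0, v, w] 0 u := by
      ext i; fin_cases i <;> rfl
    refine ⟨fun u u' => ?_, fun c u => ?_⟩
    · simp only [φ]
      rw [h (u + u'), h u, h u']
      exact (G.form x).map_update_add _ _ _ _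
    · simp only [φ]
      rw [h (c • u), h u]
      exact (G.form x).map_update_smul _ _ _ _
  phi_skew₁ u v w := by
    have h : ![u, v, w] = ![v, u, w] ∘ Equiv.swap (0 : Fin 3) 1 := by
      ext i; fin_cases i <;> rfl
    simp only [φ]
    rw [h]; exact (G.form x).map_swap _ (by decide)
  phi_skew₂ u v w := by
    have h : ![u, v, w] = ![u, w, v] ∘ Equiv.swap (1 : Fin 3) 2 := by
      ext i; fin_cases i <;> rfl
    simp only [φ]
    rw [h]; exact (G.form x).map_swap _ (by decide)
  isG2Form := G.isG2Form x

theorem mem_baseSet_symm (x : M) {p : E7} (hp : p ∈ (extChartAt (𝓡 7) x).target) :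
    (extChartAt (𝓡 7) x).symm p ∈ (trivializationAt E7 (TangentSpace (𝓡 7)) x).baseSet := by
  rw [TangentBundle.trivializationAt_baseSet, ← extChartAt_source (𝓡 7)]
  exact (extChartAt (𝓡 7) x).map_target hp

theorem contMDiffOn_metric (x : M) (i j : Fin 7) : ContMDiffOn (𝓡 7) 𝓘(ℝ) ∞
    (fun y => G.g y (coordField x i y) (coordField x j y))
    (trivializationAt E7 (TangentSpace (𝓡 7)) x).baseSet := by
  intro y hy
  have h (i : Fin 7) := (trivializationAt E7 (TangentSpace (𝓡 7)) x).contMDiffOn_localFrame_baseSet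
    (I := 𝓡 7) (n := ∞) (EuclideanSpace.basisFun (Fin 7) ℝ).toBasis i y hy
  have : ContMDiffWithinAt (𝓡 7) ((𝓡 7).prod 𝓘(ℝ)) ∞
      (fun y => TotalSpace.mk' ℝ (E := Bundle.Trivial M ℝ) y
        (G.metric.inner y (coordField x i y) (coordField x j y)))
        (trivializationAt E7 (TangentSpace (𝓡 7)) x).baseSet y := by
    apply ContMDiffWithinAt.clm_bundle_apply₂ (F₁ := E7) (F₂ := E7)
    · exact G.metric.contMDiff.contMDiffAt.contMDiffWithinAt
    · exact h i
    · exact h j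
  simp only [contMDiffWithinAt_totalSpace] at this
  exact this.2

theorem isUnit_det_metricMatrix (x : M) {p : E7} (hp : p ∈ (extChartAt (𝓡 7) x).target) :
    IsUnit (G.metricMatrix x p).det := by
  have hy := mem_baseSet_symm x hp
  set y := (extChartAt (𝓡 7) x).symm p with hyd
  have hb (i) : coordField x i y = (trivializationAt E7 (TangentSpace (𝓡 7)) x).basisAt
    (EuclideanSpace.basisFun (Fin 7) ℝ).toBasis hy i :=
    Bundle.Trivialization.localFrame_apply_of_mem_baseSet _ _ hy
  rw [isUnit_iff_ne_zero, Ne, ← Matrix.exists_mulVec_eq_zero_iff]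
  rintro ⟨v, hv, h⟩
  set w : TangentSpace (𝓡 7) y := ∑ i, v i • coordField x i y with hw
  have hw0 : w ≠ 0 := by
    intro h0
    refine hv (funext fun i => ?_)
    simp only [hw, hb] at h0
    exact Fintype.linearIndependent_iff.1 (Module.Basis.linearIndependent _) v h0 i
  have hc : ∀ i, G.g y (coordField x i y) w = 0 := by
    intro i
    rw [hw]
    refine Eq.trans ?_ (congrFun h i)
    simp only [g, map_sum, map_smul, Matrix.mulVec, dotProduct, metricMatrix, Matrix.of_apply]
    exact Finset.sum_congr rfl fun j _ => by rw [smul_eq_mul, mul_comm]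
  refine (G.metric.pos y w hw0).ne' ?_
  have h' (t : TangentSpace (𝓡 7) y) : G.metric.inner y (∑ i, v i • coordField x i y) t =
      ∑ i, v i * G.g y (coordField x i y) t := by
    simp only [map_sum, map_smul, sum_apply, smul_apply, smul_eq_mul, g]
  rw [← hw] at h'
  simp [h' w, hc]

theorem isMetricNear (x : M) : IsMetricNear (G.metricMatrix x) (extChartAt (𝓡 7) x x) where
  smooth i j := by
    have h := (G.contMDiffOn_metric x i j).comp (contMDiffOn_extChartAt_symm (I := 𝓡 7) (n := ∞) x)
      fun p hp => mem_baseSet_symm x hp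
    exact (h.contMDiffAt (extChartAt_target_mem_nhds x)).contDiffAt
  symm := by
    refine Eventually.of_forall fun p => ?_
    ext i j
    exact G.g_symm _ _ _
  isUnit := by
    filter_upwards [extChartAt_target_mem_nhds (I := 𝓡 7) x] with p hp
    exact G.isUnit_det_metricMatrix x hp

/-- The coordinates of a tangent vector at `x` in the preferred chart at `x`. -/
noncomputable def coeff (x : M) (i : Fin 7) (u : TangentSpace (𝓡 7) x) : ℝ :=
  (trivializationAt E7 (TangentSpace (𝓡 7)) x).localFrameCoeff (𝓡 7)
    (EuclideanSpace.basisFun (Fin 7) ℝ).toBasis i x u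

theorem isLinearMap_coeff (x : M) (i : Fin 7) : IsLinearMap ℝ (coeff x i) :=
  ⟨map_add _, map_smul _⟩

theorem sum_coeff_smul (x : M) (u : TangentSpace (𝓡 7) x) :
    ∑ i, coeff x i u • coordField x i x = u := by
  classical
  have := Trivialization.eq_sum_localFrameCoeff_smul (I := 𝓡 7)
    (e := trivializationAt E7 (TangentSpace (𝓡 7)) x)
    (b := (EuclideanSpace.basisFun (Fin 7) ℝ).toBasis)
    (s := fun y => if h : y = x then h ▸ u else 0)
    (FiberBundle.mem_baseSet_trivializationAt E7 (TangentSpace (𝓡 7)) x)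
  simpa [coeff, coordField] using this.symm

/-- The components of the curvature tensor, with lowered index, in the preferred chart at `x`. -/
noncomputable def riemCoord (x : M) (i j k z : Fin 7) : ℝ :=
  lowerCurvature (G.metricMatrix x (extChartAt (𝓡 7) x x))⁻¹
    (matrixDeriv (G.metricMatrix x) (extChartAt (𝓡 7) x x))
    (matrixDeriv₂ (G.metricMatrix x) (extChartAt (𝓡 7) x x)) i j k z

theorem metricMatrix_apply_self (x : M) (i j : Fin 7) :
    G.metricMatrix x (extChartAt (𝓡 7) x x) i j = G.g x (coordField x i x) (coordField x j x) := by
  have h : (extChartAt (𝓡 7) x).symm (extChartAt (𝓡 7) x x) = x := extChartAt_to_inv x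
  simp only [metricMatrix, Matrix.of_apply]
  rw [h]

theorem g_eq_sum (x : M) (u v : TangentSpace (𝓡 7) x) : G.g x u v =
    ∑ i, ∑ j, coeff x i u * coeff x j v * G.metricMatrix x (extChartAt (𝓡 7) x x) i j := by
  conv_lhs => rw [← sum_coeff_smul x u, ← sum_coeff_smul x v]
  simp only [metricMatrix_apply_self, g, map_sum, map_smul, sum_apply, smul_apply, smul_eq_mul,
    Finset.mul_sum]
  rw [Finset.sum_comm]
  exact Finset.sum_congr rfl fun i _ => Finset.sum_congr rfl fun j _ => by ring

theorem riem_eq_sum (x : M) (u v w z : TangentSpace (𝓡 7) x) : G.riem x u v w z =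
    ∑ i, ∑ j, ∑ k, ∑ l, coeff x i u * coeff x j v * coeff x k w * coeff x l z *
      G.riemCoord x i j k l := by
  have hz (m : Fin 7) : G.g x (coordField x m x) z = ∑ l, coeff x l z *
      G.metricMatrix x (extChartAt (𝓡 7) x x) m l := by
    conv_lhs => rw [← sum_coeff_smul x z]
    simp only [metricMatrix_apply_self, g, map_sum, map_smul, smul_eq_mul]
  have hR (i j k z : Fin 7) : G.riemCoord x i j k z =
      ∑ m, G.curvatureCoord x i j k m (extChartAt (𝓡 7) x x) *
        G.metricMatrix x (extChartAt (𝓡 7) x x) m z :=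
    ((G.isMetricNear x).sum_matrixCurvature_mul i j k z).symm
  have h : G.riem x u v w z = ∑ i, ∑ j, ∑ k, ∑ m, coeff x i u * coeff x j v * coeff x k w *
    G.curvatureCoord x i j k m (extChartAt (𝓡 7) x x) * G.g x (coordField x m x) z := rfl
  rw [h]
  refine Finset.sum_congr rfl fun i _ => Finset.sum_congr rfl fun j _ =>
    Finset.sum_congr rfl fun k _ => ?_
  simp only [hz, hR, Finset.mul_sum]
  rw [Finset.sum_comm]
  exact Finset.sum_congr rfl fun l _ => Finset.sum_congr rfl fun m _ => by ring

theorem riem_mem (x : M) : G.riem x ∈ curvatureTensors (TangentSpace (𝓡 7) x) := by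
  have H := G.isMetricNear x
  have hc (i) := isLinearMap_coeff x i
  have hs : ((G.metricMatrix x (extChartAt (𝓡 7) x x))⁻¹).transpose =
      (G.metricMatrix x (extChartAt (𝓡 7) x x))⁻¹ := by
    rw [Matrix.transpose_nonsing_inv, H.symm.self_of_nhds]
  refine ⟨fun v w z => ?_, fun u v z => ?_, fun u v w z => ?_, fun u v w z => ?_,
    fun u v w z => ?_⟩
  · simp only [riem_eq_sum]
    exact isLinearMap_sum fun i => isLinearMap_sum fun j => isLinearMap_sum fun k =>
      isLinearMap_sum fun l => isLinearMap_mul_const _ <| isLinearMap_mul_const _ <|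
        isLinearMap_mul_const _ <| isLinearMap_mul_const _ (hc i)
  · simp only [riem_eq_sum]
    exact isLinearMap_sum fun i => isLinearMap_sum fun j => isLinearMap_sum fun k =>
      isLinearMap_sum fun l => isLinearMap_mul_const _ <| isLinearMap_mul_const _ <|
        isLinearMap_const_mul _ (hc k)
  · rw [riem_eq_sum, riem_eq_sum, Finset.sum_comm]
    simp only [← Finset.sum_neg_distrib]
    refine Finset.sum_congr rfl fun j _ => Finset.sum_congr rfl fun i _ =>
      Finset.sum_congr rfl fun k _ => Finset.sum_congr rfl fun l _ => ?_
    have : G.riemCoord x i j k l = -G.riemCoord x j i k l := lowerCurvature_skew₁ i j k l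
    rw [this]; ring
  · rw [riem_eq_sum, riem_eq_sum]
    simp only [← Finset.sum_neg_distrib]
    refine Finset.sum_congr rfl fun i _ => Finset.sum_congr rfl fun j _ => ?_
    rw [Finset.sum_comm]
    refine Finset.sum_congr rfl fun l _ => Finset.sum_congr rfl fun k _ => ?_
    have : G.riemCoord x i j k l = -G.riemCoord x i j l k := lowerCurvature_skew₂ hs i j k l
    rw [this]; ring
  · have h₁ : G.riem x v w u z = ∑ i, ∑ j, ∑ k, ∑ l, coeff x j v * coeff x k w * coeff x i u *
        coeff x l z * G.riemCoord x j k i l := by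
      rw [riem_eq_sum]
      exact Finset.sum_comm_cycle
    have h₂ : G.riem x w u v z = ∑ i, ∑ j, ∑ k, ∑ l, coeff x k w * coeff x i u * coeff x j v *
        coeff x l z * G.riemCoord x k i j l := by
      rw [riem_eq_sum]
      exact Finset.sum_comm_cycle.symm
    rw [h₁, h₂, riem_eq_sum]
    simp only [← Finset.sum_add_distrib]
    refine Finset.sum_eq_zero fun i _ => Finset.sum_eq_zero fun j _ => Finset.sum_eq_zero fun k _ =>
      Finset.sum_eq_zero fun l _ => ?_
    have : G.riemCoord x i j k l + G.riemCoord x j k i l + G.riemCoord x k i j l = 0 :=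
      lowerCurvature_bianchi H.matrixDeriv_symm.self_of_nhds H.matrixDeriv₂_comm H.matrixDeriv₂_symm
        i j k l
    linear_combination coeff x i u * coeff x j v * coeff x k w * coeff x l z * this

/-- Under a conformal change `g ↦ e^{2f} g` the curvature tensor, up to the factor `e^{2f}`, changes
by a Kulkarni–Nomizu product with the metric. -/
theorem riem_conformal {f : M → ℝ} (hf : ContMDiff (𝓡 7) 𝓘(ℝ) ∞ f) {G' : G2Structure M}
    (hg : ∀ x, G'.g x = Real.exp (2 * f x) • G.g x) (x : M) :
    ∃ h : TangentSpace (𝓡 7) x → TangentSpace (𝓡 7) x → ℝ, IsBilin h ∧ (∀ u v, h u v = h v u) ∧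
      G'.riem x = Real.exp (2 * f x) • (G.riem x + rg (G.g x) h) := by
  have hx : (extChartAt (𝓡 7) x).symm (extChartAt (𝓡 7) x x) = x := extChartAt_to_inv x
  have hF : ContDiffAt ℝ ∞ (fun p => f ((extChartAt (𝓡 7) x).symm p)) (extChartAt (𝓡 7) x x) :=
    ((hf.comp_contMDiffOn (contMDiffOn_extChartAt_symm (I := 𝓡 7) (n := ∞) x)).contMDiffAt
      (extChartAt_target_mem_nhds x)).contDiffAt
  obtain ⟨h, hsymm, hh⟩ := (G.isMetricNear x).lowerCurvature_conformal hF
    (A' := G'.metricMatrix x) <| Eventually.of_forall fun p => by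
      ext i j
      simp only [metricMatrix, hg, Matrix.of_apply, Matrix.smul_apply, Pi.smul_apply]
  simp only [hx] at hh
  have hc (i) := isLinearMap_coeff x i
  refine ⟨fun u v => ∑ i, ∑ j, coeff x i u * coeff x j v * h i j,
    ⟨fun v => isLinearMap_sum fun i => isLinearMap_sum fun j => isLinearMap_mul_const _ <|
      isLinearMap_mul_const _ (hc i), fun u => isLinearMap_sum fun i => isLinearMap_sum fun j =>
      isLinearMap_mul_const _ <| isLinearMap_const_mul _ (hc j)⟩, fun u v => ?_, ?_⟩
  · dsimp only
    rw [Finset.sum_comm]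
    refine Finset.sum_congr rfl fun i _ => Finset.sum_congr rfl fun j _ => ?_
    rw [hsymm]; ring
  · funext u v w z
    have hR (i j k l) : G'.riemCoord x i j k l = _ := hh i j k l
    have p₁ (a b : Fin 7 → Fin 7 → ℝ) : (∑ j, ∑ k, a j k) * (∑ i, ∑ l, b i l) =
        ∑ i, ∑ j, ∑ k, ∑ l, a j k * b i l := by
      rw [mul_comm, Finset.sum_mul]
      refine Finset.sum_congr rfl fun i _ => ?_
      rw [Finset.mul_sum]
      refine Finset.sum_congr rfl fun j _ => ?_
      rw [mul_comm, Finset.sum_mul_sum]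
    have p₂ (a b : Fin 7 → Fin 7 → ℝ) : (∑ i, ∑ k, a i k) * (∑ j, ∑ l, b j l) =
        ∑ i, ∑ j, ∑ k, ∑ l, a i k * b j l := by
      rw [Finset.sum_mul]
      refine Finset.sum_congr rfl fun i _ => ?_
      rw [Finset.mul_sum]
      exact Finset.sum_congr rfl fun j _ => Finset.sum_mul_sum _ _ _ _
    simp only [Pi.smul_apply, Pi.add_apply, rg, riem_eq_sum, g_eq_sum, hR, smul_eq_mul]
    rw [p₁, p₂, mul_comm (∑ i, ∑ j, coeff x i u * coeff x j z * h i j), p₁,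
      mul_comm (∑ i, ∑ j, coeff x i v * coeff x j z * h i j), p₂]
    simp only [← Finset.sum_add_distrib, ← Finset.sum_sub_distrib, Finset.mul_sum]
    refine Finset.sum_congr rfl fun i _ => Finset.sum_congr rfl fun j _ =>
      Finset.sum_congr rfl fun k _ => Finset.sum_congr rfl fun l _ => ?_
    rw [riemCoord]
    ring

end G2Structure

end Manifold

end G2

theorem theorem4p10 {M : Type*} [TopologicalSpace M] [ChartedSpace G2.E7 M]
    [IsManifold (𝓡 7) ∞ M] (G : G2.G2Structure M) :
    -- the decomposition and the projection formulas at each point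
    (∀ x : M,
      let 𝒦 := G2.curvatureTensors (TangentSpace (𝓡 7) x)
      let g := G.g x
      let φ := G.φ x
      𝒦 = G2.W77 g φ ⊔ G2.W64 g φ ⊔ G2.W27 g φ ⊔ G2.R0 g ⊔ G2.S g ∧
      [G2.W77 g φ, G2.W64 g φ, G2.W27 g φ, G2.R0 g, G2.S g].Pairwise (G2.Perp g) ∧
      G2.weylTensors g = G2.W77 g φ ⊔ G2.W64 g φ ⊔ G2.W27 g φ ∧
      -- the Riemannian curvature is an algebraic curvature tensor
      G.riem x ∈ 𝒦 ∧
      -- the following is stated for all algebraic curvature tensors `r`, in particular for `R^g`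
      ∀ r ∈ 𝒦,
        let Ric₀ := G2.traceless g (G2.ric g r)
        let RicW := G2.ricW g φ r
        let s := G2.scal g r
        let W := G2.orthProj g (G2.weylTensors g) r
        let W₇₇ := G2.orthProj g (G2.W77 g φ) r
        let W₆₄ := G2.orthProj g (G2.W64 g φ) r
        let W₂₇ := G2.orthProj g (G2.W27 g φ) r
        G2.IsOrthProj g (G2.S g) r ((1 / 84 * s) • G2.rg g g) ∧
        G2.IsOrthProj g (G2.R0 g) r ((1 / 5 : ℝ) • G2.rg g Ric₀) ∧
        G2.IsOrthProj g (G2.W27 g φ) r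
          ((3 / 112 : ℝ) • (G2.rg g RicW - (5 : ℝ) • G2.rphi g φ RicW)) ∧
        G2.IsOrthProj g (G2.W64 g φ) r (G2.projMixed g φ (W - W₂₇)) ∧
        G2.IsOrthProj g (G2.W77 g φ) r (G2.projG2 g φ (W - W₂₇)) ∧
        (W₂₇ = 0 ↔ RicW = 0) ∧
        G2.inner₄ g r r = G2.inner₄ g W₇₇ W₇₇ + G2.inner₄ g W₆₄ W₆₄ +
          15 / 28 * G2.inner₂ g RicW RicW + 4 / 5 * G2.inner₂ g Ric₀ Ric₀ + 1 / 21 * s ^ 2) ∧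
    -- conformal invariance: under `φ ↦ e^{3f} φ`, `g ↦ e^{2f} g` the components of the Weyl curvature,
    -- as covariant tensors, are multiplied by `e^{2f}`, i.e. they do not change as `(1,3)`-tensors
    (∀ (f : M → ℝ) (G' : G2.G2Structure M), ContMDiff (𝓡 7) 𝓘(ℝ) ∞ f →
      (∀ x, G'.φ x = Real.exp (3 * f x) • G.φ x) → (∀ x, G'.g x = Real.exp (2 * f x) • G.g x) →
      ∀ x,
        G2.orthProj (G'.g x) (G2.W77 (G'.g x) (G'.φ x)) (G'.riem x) =
          Real.exp (2 * f x) • G2.orthProj (G.g x) (G2.W77 (G.g x) (G.φ x)) (G.riem x) ∧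
        G2.orthProj (G'.g x) (G2.W64 (G'.g x) (G'.φ x)) (G'.riem x) =
          Real.exp (2 * f x) • G2.orthProj (G.g x) (G2.W64 (G.g x) (G.φ x)) (G.riem x) ∧
        G2.orthProj (G'.g x) (G2.W27 (G'.g x) (G'.φ x)) (G'.riem x) =
          Real.exp (2 * f x) • G2.orthProj (G.g x) (G2.W27 (G.g x) (G.φ x)) (G.riem x)) := by
  refine ⟨fun x => ?_, fun f G' hf hφ hg x => ?_⟩
  · obtain ⟨h₁, h₂, h₃, h₄⟩ := (G.isG2Space x).splitting
    exact ⟨h₁, h₂, h₃, G.riem_mem x, h₄⟩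
  · obtain ⟨h, hh, hs, hR⟩ := G.riem_conformal hf hg x
    have h2 : Real.exp (2 * f x) = Real.exp (f x) ^ 2 := by rw [← Real.exp_nat_mul]; norm_num
    have h3 : Real.exp (3 * f x) = Real.exp (f x) ^ 3 := by rw [← Real.exp_nat_mul]; norm_num
    rw [hR, h2]
    exact (G.isG2Space x).orthProj_conformal (G'.isG2Space x) (Real.exp_pos _) (h2 ▸ hg x)
      (h3 ▸ hφ x) (G.riem_mem x) hh hs
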